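/- Let $n\ge 1$. A *virtual diagram* is an oriented circle generically immersed in $\mathbb R^2$ (a smooth immersion whose only multiple points are transverse double points) whose crossings are classified into real and virtual ones; diagrams with $n$ real crossings are considered. Removing small neighbourhoods of the real crossings leaves $2n$ *semiarcs*; a *detour move* replaces one semiarc by another, so that the diagram stays the same elsewhere and all crossings on the new semiarc are virtual. Two diagrams are *strictly equivalent* if they are related by finitely many detour moves and isotopies of $\mathbb R^2$. Let $\mathbf{Diagram}_{\rm strict}(n)$ be the set of strict equivalence classes, and $\mathbf{Diagram}_{\rm strict+rev}(n)$ the set of classes up to strict equivalence and reversal ${\rm rev}(D)$ of the orientation of $D$. A *Gauss code* on $n$ letters is a sequence $x_1\dots x_{2n}$ in which every element of $J=\{(j,L),(j,R): 1\le j\le n\}$ appears. At a real crossing a branch is *left* (*right*) if, as one moves along it, the other branch passes from left to right (from right to left). A Gauss code of $D$ is obtained by numbering the real crossings by $1,\dots,n$, choosing a base semiarc, and writing $(j,L)$ or $(j,R)$ for each left or right branch at the crossing $j$, in the order met along $D$ from the base semiarc. Put $\pi_*(w)$ for the code in which each number $j$ is replaced by $\pi(j)$, ${\rm shift}[m](x_1\dots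 x_{2n})=x_{m+1}\dots x_{2n}x_1\dots x_m$ and ${\rm rev}(x_1\dots x_{2n})=x_{2n}\dots x_1$. A Gauss code is *left preferred* if $(1,L)(2,L)\dots(n,L)$ is a subsequence and $x_1=(1,L)$. For a Gauss code $w$ let ${\rm proj}^{LP}(w)$ be the left preferred code obtained by renumbering so that the letters with second component $L$ appear in the order $(1,L),\dots,(n,L)$ and then shifting cyclically so that $(1,L)$ is first. On left preferred codes put ${\rm shift}^{LP}(w)={\rm proj}^{LP}({\rm shift}[1](w))$ and ${\rm rev}^{LP}(w)={\rm proj}^{LP}({\rm rev}(w))$; let $[w]^{LP}_{\rm ori}$ be the orbit of $w$ under ${\rm shift}^{LP}$, and $[w]^{LP}_{\rm unori}$ its orbit under ${\rm shift}^{LP}$ and ${\rm rev}^{LP}$. Order Gauss codes lexicographically with $(1,L)<(1,R)<\dots<(n,L)<(n,R)$. A left preferred code is *left canonical* if it is the smallest element of $[w]^{LP}_{\rm ori}$; $\mathbf{Gauss}^{LC}(n)$ is the set of these. For a Gauss code $w$ let ${\rm proj}^{LC}(w)$ be the smallest element of $[{\rm proj}^{LP}(w)]^{LP}_{\rm ori}$,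 put ${\rm rev}^{LC}(w)={\rm proj}^{LC}({\rm rev}(w))$ on $\mathbf{Gauss}^{LC}(n)$, and let $\mathbf{Gauss}^{LC}_{\rm rev}(n)$ be the quotient of $\mathbf{Gauss}^{LC}(n)$ by the action of ${\rm rev}^{LC}$. For a diagram $D$ with a Gauss code $w_0$, let $G_{\rm ori}(D)$ and $G_{\rm unori}(D)$ be the smallest elements of $[{\rm proj}^{LP}(w_0)]^{LP}_{\rm ori}$ and $[{\rm proj}^{LP}(w_0)]^{LP}_{\rm unori}$. **Theorem.** The map ${\rm rev}^{LC}$ is an involution of $\mathbf{Gauss}^{LC}(n)$. Sending $D$ to ${\rm proj}^{LC}(w)$, where $w$ is any Gauss code of $D$, gives well-defined bijections $$\mathbf{Diagram}_{\rm strict}(n)\longleftrightarrow\mathbf{Gauss}^{LC}(n),\qquad \mathbf{Diagram}_{\rm strict+rev}(n)\longleftrightarrow\mathbf{Gauss}^{LC}_{\rm rev}(n).$$ Moreover, for every Gauss code $w$ of $D$, $G_{\rm ori}(D)={\rm proj}^{LC}(w)$ and $G_{\rm unori}(D)=\min({\rm proj}^{LC}(w),{\rm proj}^{LC}({\rm rev}(w)))$,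 so that these do not depend on choices; and for virtual diagrams $D,D'$ with $n$ real crossings, 1. $D$ is strictly equivalent to $D'$ if and only if $G_{\rm ori}(D)=G_{\rm ori}(D')$; 2. $D$ is strictly equivalent to $D'$ or to ${\rm rev}(D')$ if and only if $G_{\rm unori}(D)=G_{\rm unori}(D')$. -/

import Mathlib

open scoped ContDiff

namespace VirtualDoodle

/-! ### Gauss codes -/

/-- The alphabet `J = {(1,L), (1,R), …, (n,L), (n,R)}`, indexed from `0`. The second component is
`false` for `L` and `true` for `R`, and the order is lexicographic, so that
`(0,L) < (0,R) < (1,L) < (1,R) < …`. -/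
abbrev Letter (n : ℕ) : Type := Fin n ×ₗ Bool

/-- The letter `(j, L)`. -/
def letterL {n : ℕ} (j : Fin n) : Letter n := toLex (j, false)

/-- The letter `(j, R)`. -/
def letterR {n : ℕ} (j : Fin n) : Letter n := toLex (j, true)

/-- The number of a letter. -/
def Letter.index {n : ℕ} (x : Letter n) : Fin n := (ofLex x).1

/-- Whether the second component of a letter is `L`. -/
def Letter.isL {n : ℕ} (x : Letter n) : Bool := !(ofLex x).2

/-- A Gauss code on `n` letters: a sequence of length `2n` in which every element of `J` appears.
As a subtype of `List (Letter n)` it carries the lexicographic order. -/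
abbrev GaussCode (n : ℕ) : Type :=
  {w : List (Letter n) // w.length = 2 * n ∧ ∀ x : Letter n, x ∈ w}

theorem card_letter (n : ℕ) : Fintype.card (Letter n) = 2 * n := by
  have h : Fintype.card (Letter n) = Fintype.card (Fin n × Bool) :=
    Fintype.card_congr (ofLex (α := Fin n × Bool))
  rw [h]; simp [mul_comm]

theorem GaussCode.nodup {n : ℕ} (w : GaussCode n) : w.1.Nodup := by
  have h : w.1.toFinset = Finset.univ := by
    ext x; simp [w.2.2 x]
  have h2 : w.1.dedup.length = w.1.length := by
    rw [← List.card_toFinset, h, Finset.card_univ, card_letter, w.2.1]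
  rw [← List.dedup_eq_self]
  exact (List.dedup_sublist _).eq_of_length h2

/-- `π_*` on letters. -/
def Letter.relabel {n : ℕ} (π : Equiv.Perm (Fin n)) (x : Letter n) : Letter n :=
  toLex (π (ofLex x).1, (ofLex x).2)

/-- `π_* : Gauss(n) → Gauss(n)`. -/
def relabel {n : ℕ} (π : Equiv.Perm (Fin n)) (w : GaussCode n) : GaussCode n :=
  ⟨w.1.map (Letter.relabel π), by simpa using w.2.1, fun x => by
    refine List.mem_map.2 ⟨Letter.relabel π⁻¹ x, w.2.2 _, ?_⟩
    simp [Letter.relabel]⟩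

/-- `shift[m](x₁ … x₂ₙ) = x_{m+1} … x₂ₙ x₁ … x_m`. -/
def shift {n : ℕ} (m : ℕ) (w : GaussCode n) : GaussCode n :=
  ⟨w.1.rotate m, by simpa using w.2.1, fun x => by simpa using w.2.2 x⟩

/-- `rev(x₁ … x₂ₙ) = x₂ₙ … x₁`. -/
def rev {n : ℕ} (w : GaussCode n) : GaussCode n :=
  ⟨w.1.reverse, by simpa using w.2.1, fun x => by simpa using w.2.2 x⟩

/-! ### Left preferred Gauss codes -/

/-- `w` has the subsequence `(1,L)(2,L)…(n,L)`. -/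
def IsWeaklyLeftPreferred {n : ℕ} (w : GaussCode n) : Prop :=
  ((List.finRange n).map letterL).Sublist w.1

/-- `w` is weakly left preferred and its first element is `(1,L)`. -/
def IsLeftPreferred {n : ℕ} [NeZero n] (w : GaussCode n) : Prop :=
  IsWeaklyLeftPreferred w ∧ w.1.head? = some (letterL 0)

/-- The set `Gauss^LP(n)` of left preferred Gauss codes, with the lexicographic order. -/
abbrev GaussLP (n : ℕ) [NeZero n] : Type := {w : GaussCode n // IsLeftPreferred w}

/-- The sequence `j₁ j₂ … jₙ` for which `(j₁,L)(j₂,L)…(jₙ,L)` is the subsequence of `w` obtained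
by removing the elements whose second component is `R`. -/
def leftIndices {n : ℕ} (w : GaussCode n) : List (Fin n) :=
  (w.1.filter Letter.isL).map Letter.index

theorem eq_letterL_of_isL {n : ℕ} {x : Letter n} (h : x.isL = true) :
    x = letterL x.index := by
  have h2 : (ofLex x).2 = false := by simpa [Letter.isL] using h
  change x = toLex ((ofLex x).1, false)
  rw [← h2]; rfl

theorem nodup_leftIndices {n : ℕ} (w : GaussCode n) : (leftIndices w).Nodup := by
  refine List.Nodup.map_on ?_ (w.nodup.filter _)
  intro x hx y hy hxy
  rw [eq_letterL_of_isL (List.mem_filter.1 hx).2, eq_letterL_of_isL (List.mem_filter.1 hy).2, hxy]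

theorem mem_leftIndices {n : ℕ} (w : GaussCode n) (j : Fin n) : j ∈ leftIndices w :=
  List.mem_map.2 ⟨letterL j, List.mem_filter.2 ⟨w.2.2 _, rfl⟩, rfl⟩

theorem length_leftIndices {n : ℕ} (w : GaussCode n) : (leftIndices w).length = n := by
  have h : (leftIndices w).toFinset = Finset.univ := by
    ext x; simp [mem_leftIndices w x]
  rw [← List.toFinset_card_of_nodup (nodup_leftIndices w), h]; simp

/-- The permutation sending `j₁, …, jₙ` to `1, …, n`, where `(j₁,L)…(jₙ,L)` is the subsequence of
the letters with second component `L`. -/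
def leftPerm {n : ℕ} (w : GaussCode n) : Equiv.Perm (Fin n) :=
  ((List.Nodup.getEquivOfForallMemList _ (nodup_leftIndices w) (mem_leftIndices w)).symm).trans
    (finCongr (length_leftIndices w))

theorem filter_relabel_leftPerm {n : ℕ} (w : GaussCode n) :
    (relabel (leftPerm w) w).1.filter Letter.isL = (List.finRange n).map letterL := by
  have h1 : (relabel (leftPerm w) w).1.filter Letter.isL
      = ((leftIndices w).map (leftPerm w)).map letterL := by
    simp only [relabel, leftIndices, List.filter_map, List.map_map]
    refine List.map_congr_left fun x hx => ?_
    have hx2 : (ofLex x).2 = false := by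
      simpa [Letter.isL, Letter.relabel] using (List.mem_filter.1 hx).2
    simp [Letter.relabel, letterL, Letter.index, hx2]
  rw [h1]
  congr 1
  apply List.ext_getElem
  · simp [length_leftIndices]
  · intro i hi hi'
    have hi0 : i < (leftIndices w).length := by simpa using hi
    have : (leftIndices w)[i] = List.Nodup.getEquivOfForallMemList _ (nodup_leftIndices w)
        (mem_leftIndices w) ⟨i, hi0⟩ := rfl
    rw [List.getElem_map]
    simp only [leftPerm, Equiv.trans_apply]
    rw [this, Equiv.symm_apply_apply]
    simp

/-- `proj^LP`: relabel by `leftPerm`, then shift cyclically so that `(1,L)` comes first. -/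
def projLP {n : ℕ} [NeZero n] (w : GaussCode n) : GaussLP n :=
  ⟨shift ((relabel (leftPerm w) w).1.idxOf (letterL 0)) (relabel (leftPerm w) w), by
    set v := relabel (leftPerm w) w with hv
    have hf : v.1.filter Letter.isL = (List.finRange n).map letterL := filter_relabel_leftPerm w
    have hmem : letterL 0 ∈ v.1 := v.2.2 _
    obtain ⟨a, b, hab, ha⟩ := List.eq_append_cons_of_mem hmem
    have hidx : v.1.idxOf (letterL 0) = a.length := by
      rw [hab, List.idxOf_append_of_notMem ha]; simp
    have hrot : (shift (v.1.idxOf (letterL 0)) v).1 = letterL 0 :: b ++ a := by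
      rw [hidx]; simp only [shift, hab]
      rw [List.rotate_append_length_eq]
    refine ⟨?_, by rw [hrot]; rfl⟩
    unfold IsWeaklyLeftPreferred
    rw [hrot, ← hf, hab, List.filter_append]
    have hfa : a.filter Letter.isL = [] := by
      rw [hab, List.filter_append] at hf
      obtain ⟨k, rfl⟩ := Nat.exists_eq_succ_of_ne_zero (NeZero.ne n)
      rw [List.finRange_succ, List.map_cons] at hf
      rcases h : a.filter Letter.isL with _ | ⟨x, l⟩
      · rfl
      · rw [h] at hf
        have hx : x = letterL 0 := by
          have := List.head_eq_of_cons_eq hf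
          simpa using this
        exact absurd (hx ▸ (List.mem_filter.1 (h ▸ List.mem_cons_self : x ∈ a.filter _)).1) ha
    rw [hfa, List.nil_append]
    exact List.filter_sublist.trans (List.sublist_append_left _ _)⟩

/-- `shift^LP`. -/
def shiftLP {n : ℕ} [NeZero n] (w : GaussLP n) : GaussLP n := projLP (shift 1 w.1)

/-- `rev^LP`. -/
def revLP {n : ℕ} [NeZero n] (w : GaussLP n) : GaussLP n := projLP (rev w.1)

/-- Oriented equivalence of left preferred Gauss codes. Since `shift^LP` is a bijection, the
orbits of the group it generates are the classes of the equivalence relation generated by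
`w ∼ shift^LP(w)`. -/
def LPOri {n : ℕ} [NeZero n] : GaussLP n → GaussLP n → Prop :=
  Relation.EqvGen fun w w' => w' = shiftLP w

/-- Unoriented equivalence of left preferred Gauss codes: the orbits of the group generated by the
bijections `shift^LP` and `rev^LP`. -/
def LPUnori {n : ℕ} [NeZero n] : GaussLP n → GaussLP n → Prop :=
  Relation.EqvGen fun w w' => w' = shiftLP w ∨ w' = revLP w

/-! ### Left canonical Gauss codes -/

instance {n : ℕ} : Finite (GaussCode n) :=
  Set.Finite.subset (List.finite_length_eq (Letter n) (2 * n)) fun _ h => h.1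

/-- `w` is the smallest element of its oriented class. -/
def IsLeftCanonical {n : ℕ} [NeZero n] (w : GaussLP n) : Prop :=
  ∀ v, LPOri w v → w ≤ v

/-- The set `Gauss^LC(n)` of left canonical Gauss codes. -/
abbrev GaussLC (n : ℕ) [NeZero n] : Type := {w : GaussLP n // IsLeftCanonical w}

/-- The smallest element of a nonempty set of left preferred Gauss codes. -/
noncomputable def least {n : ℕ} [NeZero n] (s : Set (GaussLP n)) (hs : s.Nonempty) : GaussLP n :=
  WellFounded.min (wellFounded_lt (α := GaussLP n)) s hs

/-- The smallest element of `[w]^LP_ori`. -/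
noncomputable def leastOri {n : ℕ} [NeZero n] (w : GaussLP n) : GaussLP n :=
  least {v | LPOri w v} ⟨w, Relation.EqvGen.refl w⟩

/-- The smallest element of `[w]^LP_unori`. -/
noncomputable def leastUnori {n : ℕ} [NeZero n] (w : GaussLP n) : GaussLP n :=
  least {v | LPUnori w v} ⟨w, Relation.EqvGen.refl w⟩

/-- `proj^LC`: the left canonical representative of the oriented class of `proj^LP(w)`. -/
noncomputable def projLC {n : ℕ} [NeZero n] (w : GaussCode n) : GaussLC n :=
  ⟨leastOri (projLP w), fun v hv => by
    have h : LPOri (projLP w) (leastOri (projLP w)) :=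
      WellFounded.min_mem (wellFounded_lt (α := GaussLP n)) {v | LPOri (projLP w) v} ⟨_, Relation.EqvGen.refl _⟩
    exact WellFounded.min_le (wellFounded_lt (α := GaussLP n)) (s := {v | LPOri (projLP w) v})
      (Relation.EqvGen.trans _ _ _ h hv)⟩

/-- `rev^LC`. -/
noncomputable def revLC {n : ℕ} [NeZero n] (w : GaussLC n) : GaussLC n := projLC (rev w.1.1)

/-- `Gauss^LC_rev(n)`, the quotient of `Gauss^LC(n)` by the action of `rev^LC`. -/
def GaussLCRev (n : ℕ) [NeZero n] : Type := Quot fun w w' : GaussLC n => w' = revLC w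

/-! ### Virtual diagrams -/

/-- The plane `ℝ²`. -/
abbrev Plane : Type := ℝ × ℝ

/-- The determinant of two plane vectors; it is positive if `v` points to the left of `u`. -/
def planeDet (u v : Plane) : ℝ := u.1 * v.2 - u.2 * v.1

/-- Two real parameters name the same point of the circle `ℝ/ℤ`. -/
def SamePoint (s t : ℝ) : Prop := ∃ k : ℤ, t = s + k

/-- A virtual diagram: an oriented circle, generically immersed in the plane (a smooth immersion
of `ℝ/ℤ` whose only multiple points are transverse double points), with a choice of those crossings
which are real. All other crossings are virtual. -/
structure VirtualDiagram where
  /-- the immersion, as a map of period `1` -/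
  curve : ℝ → Plane
  periodic : Function.Periodic curve 1
  smooth : ContDiff ℝ ∞ curve
  immersed : ∀ t, deriv curve t ≠ 0
  transverse : ∀ s t, curve s = curve t → ¬ SamePoint s t →
    planeDet (deriv curve s) (deriv curve t) ≠ 0
  no_triple : ∀ r s t, curve r = curve s → curve r = curve t →
    SamePoint r s ∨ SamePoint r t ∨ SamePoint s t
  /-- the set of real crossings -/
  real : Finset Plane
  real_crossing : ∀ c ∈ real, ∃ s t, ¬ SamePoint s t ∧ curve s = c ∧ curve t = c

/-- `rev(D)`: the orientation of the circle is reversed. -/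
def VirtualDiagram.rev (D : VirtualDiagram) : VirtualDiagram where
  curve t := D.curve (-t)
  periodic t := by
    have h := D.periodic (-t - 1)
    rw [sub_add_cancel] at h
    change D.curve (-(t + 1)) = D.curve (-t)
    rw [h, neg_add, sub_eq_add_neg]
  smooth := D.smooth.comp contDiff_neg
  immersed t := by
    rw [deriv_comp_neg]; exact neg_ne_zero.2 (D.immersed _)
  transverse s t h hst := by
    rw [deriv_comp_neg, deriv_comp_neg]
    have := D.transverse (-s) (-t) h fun ⟨k, hk⟩ => hst ⟨-k, by push_cast; linarith⟩
    simpa [planeDet] using this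
  no_triple r s t h1 h2 := by
    have key : ∀ a b : ℝ, SamePoint (-a) (-b) → SamePoint a b :=
      fun a b ⟨k, hk⟩ => ⟨-k, by push_cast; linarith⟩
    exact (D.no_triple (-r) (-s) (-t) h1 h2).imp (key _ _) (Or.imp (key _ _) (key _ _))
  real := D.real
  real_crossing c hc := by
    obtain ⟨s, t, hst, hs, ht⟩ := D.real_crossing c hc
    exact ⟨-s, -t, fun ⟨k, hk⟩ => hst ⟨-k, by push_cast; linarith⟩, by simpa using hs,
      by simpa using ht⟩

/-! ### Strict equivalence -/

/-- A smooth isotopy of the plane: a smooth family of diffeomorphisms starting at the identity.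
Time runs over `ℝ`; a smooth isotopy over `[0,1]` gets this form, with the same end, if its time is
reparametrized so as to stand still near `0` and near `1`. -/
def IsPlaneIsotopy (H : ℝ → Plane ≃ Plane) : Prop :=
  H 0 = Equiv.refl Plane ∧
  ContDiff ℝ ∞ (fun p : ℝ × Plane => H p.1 p.2) ∧
  ∀ t, ContDiff ℝ ∞ (H t).symm

/-- An orientation preserving diffeomorphism of the circle `ℝ/ℤ`, lifted to `ℝ`. -/
def IsReparametrization (σ : ℝ → ℝ) : Prop :=
  ContDiff ℝ ∞ σ ∧ (∀ t, 0 < deriv σ t) ∧ ∀ t, σ (t + 1) = σ t + 1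

/-- `D'` is the image of `D` under an isotopy of the plane, as an oriented immersed circle (hence
up to parametrization) with the same crossings real. -/
def Isotopic (D D' : VirtualDiagram) : Prop :=
  ∃ (H : ℝ → Plane ≃ Plane) (σ : ℝ → ℝ), IsPlaneIsotopy H ∧ IsReparametrization σ ∧
    (∀ t, D'.curve t = H 1 (D.curve (σ t))) ∧
    D'.real = D.real.map (H 1).toEmbedding

/-- A detour move: `D` and `D'` have the same real crossings and are identical except on an arc
`[a,b]` of the circle which passes through no real crossing, that is, on an arc contained in a
semiarc. All crossings on the new arc are virtual. -/
def DetourMove (D D' : VirtualDiagram) : Prop :=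
  D'.real = D.real ∧ ∃ a b : ℝ, a < b ∧ b < a + 1 ∧
    (∀ t ∈ Set.Icc a b, D.curve t ∉ D.real ∧ D'.curve t ∉ D'.real) ∧
    ∀ t, (∀ k : ℤ, t + (k : ℝ) ∉ Set.Icc a b) → D'.curve t = D.curve t

/-- Strict equivalence: a finite sequence of detour moves and isotopies of the plane. -/
def StrictEquiv : VirtualDiagram → VirtualDiagram → Prop :=
  Relation.EqvGen fun D D' => Isotopic D D' ∨ DetourMove D D'

/-- Virtual diagrams with `n` real crossings. -/
abbrev Diagram (n : ℕ) : Type := {D : VirtualDiagram // D.real.card = n}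

/-- Reversal of the orientation on diagrams with `n` real crossings. -/
def Diagram.rev {n : ℕ} (D : Diagram n) : Diagram n := ⟨D.1.rev, D.2⟩

/-- Strict equivalence as a setoid on diagrams with `n` real crossings. -/
def strictSetoid (n : ℕ) : Setoid (Diagram n) where
  r D D' := StrictEquiv D.1 D'.1
  iseqv := ⟨fun _ => .refl _, fun h => .symm _ _ h, fun h h' => .trans _ _ _ h h'⟩

/-- The equivalence relation generated by strict equivalence and reversal of orientations. -/
def strictRevSetoid (n : ℕ) : Setoid (Diagram n) :=
  Relation.EqvGen.setoid fun D D' => StrictEquiv D.1 D'.1 ∨ D' = D.rev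

/-- `Diagram_strict(n)`. -/
def DiagramStrict (n : ℕ) : Type := Quotient (strictSetoid n)

/-- `Diagram_{strict+rev}(n)`. -/
def DiagramStrictRev (n : ℕ) : Type := Quotient (strictRevSetoid n)

/-! ### Gauss codes of virtual diagrams -/

/-- The branch through the parameter `t` is a left branch: for one who moves along it, the other
branch at the crossing passes from the left to the right. -/
def VirtualDiagram.IsLeftBranch (D : VirtualDiagram) (t : ℝ) : Prop :=
  ∃ s, ¬ SamePoint t s ∧ D.curve s = D.curve t ∧ planeDet (deriv D.curve t) (deriv D.curve s) < 0

open Classical in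
/-- The `J`-label of the branch through `t`, for the labeling `f` of the real crossings. -/
noncomputable def VirtualDiagram.label {n : ℕ} (D : VirtualDiagram) (f : Plane → Fin n) (t : ℝ) :
    Letter n :=
  if D.IsLeftBranch t then letterL (f (D.curve t)) else letterR (f (D.curve t))

/-- `w` is the Gauss code of `D` for the labeling `f` of the real crossings and the base semiarc
through the parameter `t₀`: the list of the labels of the branches at real crossings, in the order
in which they are met on one turn that starts at `t₀`. -/
def VirtualDiagram.IsGaussCodeAt {n : ℕ} (D : VirtualDiagram) (f : Plane → Fin n) (t₀ : ℝ)
    (w : GaussCode n) : Prop :=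
  ∃ ts : List ℝ, ts.Pairwise (· < ·) ∧
    (∀ t, t ∈ ts ↔ (t₀ < t ∧ t < t₀ + 1) ∧ D.curve t ∈ D.real) ∧
    w.1 = ts.map (D.label f)

/-- `w` is a Gauss code of `D`, for some labeling of the real crossings (a bijection onto the
numbers) and some base semiarc. -/
def IsGaussCodeOf {n : ℕ} (D : Diagram n) (w : GaussCode n) : Prop :=
  ∃ (f : Plane → Fin n) (t₀ : ℝ), Set.BijOn f D.1.real Set.univ ∧ D.1.curve t₀ ∉ D.1.real ∧
    D.1.IsGaussCodeAt f t₀ w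

theorem SamePoint.symm {s t : ℝ} : SamePoint s t → SamePoint t s :=
  fun ⟨k, hk⟩ => ⟨-k, by push_cast; linarith⟩

theorem SamePoint.trans {r s t : ℝ} : SamePoint r s → SamePoint s t → SamePoint r t :=
  fun ⟨k, hk⟩ ⟨l, hl⟩ => ⟨k + l, by push_cast; linarith⟩

theorem SamePoint.eq_of_mem {a s t : ℝ} (h : SamePoint s t) (hs : s ∈ Set.Ico a (a + 1))
    (ht : t ∈ Set.Ico a (a + 1)) : s = t := by
  obtain ⟨k, hk⟩ := h
  have h1 : (k : ℝ) < 1 := by linarith [hs.1, ht.2]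
  have h2 : (-1 : ℝ) < k := by linarith [hs.2, ht.1]
  have h3 : k < 1 := by exact_mod_cast h1
  have h4 : -1 < k := by exact_mod_cast h2
  have h5 : k = 0 := by omega
  rw [hk, h5]; simp

theorem exists_samePoint_mem (a s : ℝ) : ∃ t ∈ Set.Ico a (a + 1), SamePoint s t :=
  ⟨toIcoMod one_pos a s, toIcoMod_mem_Ico _ _ _, -toIcoDiv one_pos a s, by
    simp [toIcoMod]; ring⟩

theorem VirtualDiagram.curve_eq {D : VirtualDiagram} {s t : ℝ} (h : SamePoint s t) :
    D.curve t = D.curve s := by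
  obtain ⟨k, rfl⟩ := h
  simpa using D.periodic.int_mul k s

theorem VirtualDiagram.deriv_eq {D : VirtualDiagram} {s t : ℝ} (h : SamePoint s t) :
    deriv D.curve t = deriv D.curve s := by
  obtain ⟨k, rfl⟩ := h
  have h2 : (fun x => D.curve (x + k)) = D.curve := by
    funext x; simpa using D.periodic.int_mul k x
  rw [← deriv_comp_add_const, h2]

/-- A real crossing has exactly two parameters in one turn. -/
theorem VirtualDiagram.exists_two (D : VirtualDiagram) (a : ℝ) {c : Plane} (hc : c ∈ D.real) :
    ∃ s ∈ Set.Ico a (a + 1), ∃ t ∈ Set.Ico a (a + 1), ¬ SamePoint s t ∧ D.curve s = c ∧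
      D.curve t = c ∧ ∀ r ∈ Set.Ico a (a + 1), D.curve r = c → r = s ∨ r = t := by
  obtain ⟨s, t, hst, hs, ht⟩ := D.real_crossing c hc
  obtain ⟨s', hs', hss⟩ := exists_samePoint_mem a s
  obtain ⟨t', ht', htt⟩ := exists_samePoint_mem a t
  have h0 : ¬ SamePoint s' t' := fun h => hst ((hss.trans h).trans htt.symm)
  have h1 : D.curve s' = c := (D.curve_eq hss).trans hs
  have h2 : D.curve t' = c := (D.curve_eq htt).trans ht
  refine ⟨s', hs', t', ht', h0, h1, h2, fun r hr hrc => ?_⟩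
  rcases D.no_triple r s' t' (hrc.trans h1.symm) (hrc.trans h2.symm) with h | h | h
  · exact .inl (h.eq_of_mem hr hs')
  · exact .inr (h.eq_of_mem hr ht')
  · exact absurd h h0

theorem VirtualDiagram.isLeftBranch_iff (D : VirtualDiagram) {s t : ℝ} (hst : ¬ SamePoint t s)
    (h : D.curve s = D.curve t) :
    D.IsLeftBranch t ↔ planeDet (deriv D.curve t) (deriv D.curve s) < 0 := by
  refine ⟨fun ⟨r, hr, hc, hd⟩ => ?_, fun hd => ⟨s, hst, h, hd⟩⟩
  rcases D.no_triple t s r h.symm hc.symm with h' | h' | h'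
  · exact absurd h' hst
  · exact absurd h' hr
  · rwa [D.deriv_eq h'] at hd

/-- Of the two branches at a crossing exactly one is a left branch. -/
theorem VirtualDiagram.isLeftBranch_iff_not (D : VirtualDiagram) {s t : ℝ}
    (hst : ¬ SamePoint s t) (h : D.curve s = D.curve t) :
    D.IsLeftBranch s ↔ ¬ D.IsLeftBranch t := by
  have hts : ¬ SamePoint t s := fun h' => hst h'.symm
  rw [D.isLeftBranch_iff hst h.symm, D.isLeftBranch_iff hts h]
  have h0 := D.transverse s t h hst
  have h1 : planeDet (deriv D.curve t) (deriv D.curve s)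
      = -planeDet (deriv D.curve s) (deriv D.curve t) := by simp [planeDet]; ring
  rw [h1]
  constructor
  · intro h2; linarith
  · intro h2; exact lt_of_le_of_ne (by linarith) h0

theorem VirtualDiagram.finite_real_params (D : VirtualDiagram) (a : ℝ) :
    {t | t ∈ Set.Ico a (a + 1) ∧ D.curve t ∈ D.real}.Finite := by
  have h : {t | t ∈ Set.Ico a (a + 1) ∧ D.curve t ∈ D.real} ⊆
      ⋃ c ∈ (D.real : Set Plane), {t | t ∈ Set.Ico a (a + 1) ∧ D.curve t = c} := by
    intro t ht
    simp only [Set.mem_iUnion]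
    exact ⟨D.curve t, ht.2, ht.1, rfl⟩
  refine Set.Finite.subset (Set.Finite.biUnion D.real.finite_toSet fun c hc => ?_) h
  obtain ⟨s, -, t, -, -, -, -, hall⟩ := D.exists_two a hc
  exact Set.Finite.subset (Set.toFinite {s, t}) fun r hr => by
    simpa using hall r hr.1 hr.2

/-- Every virtual diagram has a Gauss code. -/
theorem exists_isGaussCodeOf {n : ℕ} [NeZero n] (D : Diagram n) :
    ∃ w : GaussCode n, IsGaussCodeOf D w := by
  classical
  obtain ⟨f, hf⟩ : ∃ f : Plane → Fin n, Set.BijOn f D.1.real Set.univ := by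
    have e : (D.1.real : Set Plane) ≃ Fin n := D.1.real.equivFinOfCardEq D.2
    refine ⟨fun c => if h : c ∈ (D.1.real : Set Plane) then e ⟨c, h⟩ else 0, fun _ _ => trivial,
      fun c hc d hd hcd => ?_, fun j _ => ⟨(e.symm j).1, (e.symm j).2, ?_⟩⟩
    · simp only [hc, hd, dif_pos] at hcd
      exact congrArg Subtype.val (e.injective hcd)
    · simp [(e.symm j).2]
  obtain ⟨t₀, ht₀⟩ : ∃ t₀ : ℝ, D.1.curve t₀ ∉ D.1.real := by
    by_contra hcon
    push Not at hcon
    refine (Set.Ico_infinite (show (0 : ℝ) < 0 + 1 by norm_num)) ?_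
    exact (D.1.finite_real_params 0).subset fun t ht => ⟨ht, hcon t⟩
  set S : Finset ℝ := (D.1.finite_real_params t₀).toFinset with hS
  have hmemS : ∀ t, t ∈ S ↔ t ∈ Set.Ico t₀ (t₀ + 1) ∧ D.1.curve t ∈ D.1.real := by
    intro t; simp [hS]
  set ts : List ℝ := S.sort (· ≤ ·) with hts
  have hmem : ∀ t, t ∈ ts ↔ t ∈ S := fun t => by simp [hts]
  have hinj : ∀ s ∈ ts, ∀ t ∈ ts, D.1.label f s = D.1.label f t → s = t := by
    intro s hs t ht hl
    obtain ⟨hs1, hs2⟩ := (hmemS s).1 ((hmem s).1 hs)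
    obtain ⟨ht1, ht2⟩ := (hmemS t).1 ((hmem t).1 ht)
    by_contra hne
    have hst : ¬ SamePoint s t := fun h => hne (h.eq_of_mem hs1 ht1)
    have hfst : f (D.1.curve s) = f (D.1.curve t) := by
      have := congrArg Letter.index hl
      unfold VirtualDiagram.label at this
      split_ifs at this <;> simpa [Letter.index, letterL, letterR] using this
    have hc := hf.injOn hs2 ht2 hfst
    have hiff := D.1.isLeftBranch_iff_not hst hc
    have hl2 := congrArg Letter.isL hl
    unfold VirtualDiagram.label at hl2
    by_cases h : D.1.IsLeftBranch t
    · simp [h, hiff, Letter.isL, letterL, letterR] at hl2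
    · simp [h, hiff, Letter.isL, letterL, letterR] at hl2
  have hsurj : ∀ x : Letter n, x ∈ ts.map (D.1.label f) := by
    intro x
    obtain ⟨c, hc, hcx⟩ := hf.surjOn (Set.mem_univ x.index)
    obtain ⟨s, hs, t, ht, hst, hsc, htc, -⟩ := D.1.exists_two t₀ hc
    have hs' : s ∈ ts := (hmem s).2 ((hmemS s).2 ⟨hs, by rw [hsc]; exact hc⟩)
    have ht' : t ∈ ts := (hmem t).2 ((hmemS t).2 ⟨ht, by rw [htc]; exact hc⟩)
    have hiff := D.1.isLeftBranch_iff_not hst (hsc.trans htc.symm)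
    have hx : x = letterL x.index ∨ x = letterR x.index := by
      rcases h : x.isL with _ | _
      · right
        have h2 : (ofLex x).2 = true := by simpa [Letter.isL] using h
        change x = toLex ((ofLex x).1, true)
        rw [← h2]; rfl
      · exact .inl (eq_letterL_of_isL h)
    rw [List.mem_map]
    by_cases h : D.1.IsLeftBranch t
    · rcases hx with hx | hx
      · exact ⟨t, ht', by rw [hx]; simp [VirtualDiagram.label, h, htc, hcx]⟩
      · exact ⟨s, hs', by rw [hx]; simp [VirtualDiagram.label, hiff, h, hsc, hcx]⟩
    · rcases hx with hx | hx
      · exact ⟨s, hs', by rw [hx]; simp [VirtualDiagram.label, hiff, h, hsc, hcx]⟩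
      · exact ⟨t, ht', by rw [hx]; simp [VirtualDiagram.label, h, htc, hcx]⟩
  have hnd : (ts.map (D.1.label f)).Nodup :=
    List.Nodup.map_on hinj (Finset.sort_nodup _ _)
  have hlen : (ts.map (D.1.label f)).length = 2 * n := by
    rw [← List.toFinset_card_of_nodup hnd, ← card_letter n, ← Finset.card_univ]
    congr 1
    ext x; simpa using hsurj x
  refine ⟨⟨ts.map (D.1.label f), hlen, hsurj⟩, f, t₀, hf, ht₀, ts,
    (Finset.sortedLT_sort S).pairwise, fun t => ?_, rfl⟩
  rw [hmem, hmemS]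
  refine and_congr_left fun ht => ⟨fun h => ⟨lt_of_le_of_ne h.1 ?_, h.2⟩, fun h => ⟨h.1.le, h.2⟩⟩
  rintro rfl
  exact ht₀ ht

/-- A Gauss code of `D`. -/
noncomputable def gaussCode {n : ℕ} [NeZero n] (D : Diagram n) : GaussCode n :=
  (exists_isGaussCodeOf D).choose

/-- The oriented left canonical Gauss code `G_ori(D)`: the smallest element of `[w]^LP_ori`, where
`w = proj^LP(w₀)` for a Gauss code `w₀` of `D`. -/
noncomputable def Gori {n : ℕ} [NeZero n] (D : Diagram n) : GaussLP n :=
  leastOri (projLP (gaussCode D))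

/-- The unoriented left canonical Gauss code `G_unori(D)`: the smallest element of
`[w]^LP_unori`, where `w = proj^LP(w₀)` for a Gauss code `w₀` of `D`. -/
noncomputable def Gunori {n : ℕ} [NeZero n] (D : Diagram n) : GaussLP n :=
  leastUnori (projLP (gaussCode D))

end VirtualDoodle

open VirtualDoodle

namespace VirtualDoodle

/-! ### Combinatorics of Gauss codes -/

section
variable {n : ℕ}

/-! Everything passes through one relation on Gauss codes, `CodeEquiv`: equality up to renumbering
and cyclic shift. The theorem splits into the statement that left canonical codes are normal forms
for `CodeEquiv`, and the statement that sending a diagram to its codes identifies strict equivalence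
classes with `CodeEquiv` classes.

The first half is combinatorial. Shifting a code past a right letter does not change its left
preferred form, and shifting past a left letter changes it by `shiftLP` (`projLP_shift_one`). Hence
the orbits of `shiftLP` are exactly the traces of the `CodeEquiv` classes on left preferred codes
(`lpOri_iff`), and `projLC` is a complete invariant of `CodeEquiv` (`projLC_eq_iff`). Reversal
respects `CodeEquiv`, so `revLC` is an involution, and an unoriented class is the union of the
oriented classes of a code and of its reverse (`leastUnori_projLP`).

The second half is geometric. The codes of one diagram form a full `CodeEquiv` class
(`HasGaussCode.codeEquiv`, `HasGaussCode.of_codeEquiv`). Isotopies preserve it because their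
Jacobian stays positive; detour moves preserve it because they leave the curve unchanged near the
real crossings (`StrictEquiv.hasGaussCode_iff`).

Conversely, two diagrams with a common code are first reparametrized so that the branches at real
crossings are met at the multiples of 1/(2n) (`exists_marked`). Isotopies then carry the crossings
to common points and make them identical straight crosses (`exists_straight`). Now the two curves
differ only inside semiarcs, and these are exchanged one by one by detour moves
(`strictEquiv_of_eq_off_arcs`).

The difficulty is genericity: an arc borrowed from another curve may be tangent to the rest, or
create triple points. This is settled by a Sard argument. In a six-parameter family of perturbations
supported on the arc, each kind of degeneracy occurs only on a null set (`ae_genericOn_perturb`), so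
a good perturbation exists, even one that is good for two curves at the same time. The same
perturbations make generic a closed curve that is prescribed only near its crossings, so every code
is realized (`exists_hasGaussCode`). -/

@[simp] theorem relabel_relabel (π ρ : Equiv.Perm (Fin n)) (w : GaussCode n) :
    relabel π (relabel ρ w) = relabel (ρ.trans π) w := by
  apply Subtype.ext
  simp [relabel, Letter.relabel, Function.comp_def]

@[simp] theorem relabel_refl (w : GaussCode n) : relabel (Equiv.refl _) w = w := by
  apply Subtype.ext
  have : (Letter.relabel (Equiv.refl (Fin n)) : Letter n → Letter n) = id := by
    funext x; rfl
  simp [relabel, this]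

theorem shift_relabel (m : ℕ) (π : Equiv.Perm (Fin n)) (w : GaussCode n) :
    shift m (relabel π w) = relabel π (shift m w) := by
  apply Subtype.ext
  simp [shift, relabel, List.map_rotate]

theorem shift_shift (m k : ℕ) (w : GaussCode n) : shift m (shift k w) = shift (k + m) w := by
  apply Subtype.ext
  simp [shift, List.rotate_rotate]

@[simp] theorem shift_zero (w : GaussCode n) : shift 0 w = w := by
  apply Subtype.ext
  simp [shift]

theorem rev_relabel (π : Equiv.Perm (Fin n)) (w : GaussCode n) :
    rev (relabel π w) = relabel π (rev w) := by
  apply Subtype.ext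
  simp [rev, relabel]

@[simp] theorem rev_rev (w : GaussCode n) : rev (rev w) = w := by
  apply Subtype.ext
  simp [rev]

theorem rev_shift (m : ℕ) (w : GaussCode n) :
    rev (shift m w) = shift (w.1.length - m % w.1.length) (rev w) := by
  apply Subtype.ext
  simp [rev, shift, List.reverse_rotate]

/-- Two Gauss codes differ by a renumbering and a cyclic shift. -/
def CodeEquiv (w w' : GaussCode n) : Prop := ∃ m π, w' = shift m (relabel π w)

theorem CodeEquiv.refl (w : GaussCode n) : CodeEquiv w w := ⟨0, Equiv.refl _, by simp⟩

theorem CodeEquiv.trans {w w' w'' : GaussCode n} (h : CodeEquiv w w') (h' : CodeEquiv w' w'') :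
    CodeEquiv w w'' := by
  obtain ⟨m, π, rfl⟩ := h
  obtain ⟨k, ρ, rfl⟩ := h'
  exact ⟨m + k, π.trans ρ, by rw [← shift_relabel, shift_shift, relabel_relabel]⟩

theorem CodeEquiv.symm {w w' : GaussCode n} (h : CodeEquiv w w') : CodeEquiv w' w := by
  obtain ⟨m, π, rfl⟩ := h
  refine ⟨w.1.length - m % w.1.length, π.symm, ?_⟩
  rw [← shift_relabel, shift_shift, relabel_relabel]
  simp only [Equiv.self_trans_symm, relabel_refl]
  apply Subtype.ext
  simp only [shift]
  rcases Nat.eq_zero_or_pos w.1.length with h0 | h0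
  · simp [List.length_eq_zero_iff.1 h0]
  · rw [← List.rotate_mod]
    have : (m + (w.1.length - m % w.1.length)) % w.1.length = 0 := by
      have h1 := Nat.mod_lt m h0
      have h2 := Nat.mod_add_div m w.1.length
      have : m + (w.1.length - m % w.1.length) = w.1.length * (m / w.1.length + 1) := by
        rw [mul_add, mul_one]; omega
      rw [this]; simp
    rw [this]; simp

theorem codeEquiv_equivalence : Equivalence (CodeEquiv (n := n)) :=
  ⟨CodeEquiv.refl, CodeEquiv.symm, CodeEquiv.trans⟩

theorem CodeEquiv.rev {w w' : GaussCode n} (h : CodeEquiv w w') : CodeEquiv (rev w) (rev w') := by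
  obtain ⟨m, π, rfl⟩ := h
  exact ⟨_, π, by rw [rev_shift, rev_relabel]⟩

theorem codeEquiv_shift (m : ℕ) (w : GaussCode n) : CodeEquiv w (shift m w) :=
  ⟨m, Equiv.refl _, by simp⟩

/-! ### Normalization of codes by the order of the left letters -/

theorem leftIndices_relabel (π : Equiv.Perm (Fin n)) (w : GaussCode n) :
    leftIndices (relabel π w) = (leftIndices w).map π := by
  simp only [leftIndices, relabel, List.filter_map, List.map_map]
  rfl

theorem leftIndices_relabel_leftPerm (w : GaussCode n) :
    leftIndices (relabel (leftPerm w) w) = List.finRange n := by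
  rw [leftIndices, filter_relabel_leftPerm, List.map_map]
  have : (Letter.index ∘ letterL : Fin n → Fin n) = id := rfl
  rw [this, List.map_id]

/-- Every number occurs among the left indices, so a permutation is determined by its values there.
This uniqueness is the only property of `leftPerm` needed to compare it across codes. -/
theorem eq_leftPerm {w : GaussCode n} {π : Equiv.Perm (Fin n)}
    (h : (leftIndices w).map π = List.finRange n) : π = leftPerm w := by
  have h2 := leftIndices_relabel_leftPerm w
  rw [leftIndices_relabel, ← h] at h2
  ext j
  rw [List.map_inj_left.1 h2 j (mem_leftIndices w j)]

theorem relabel_leftPerm_relabel (π : Equiv.Perm (Fin n)) (w : GaussCode n) :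
    relabel (leftPerm (relabel π w)) (relabel π w) = relabel (leftPerm w) w := by
  rw [relabel_relabel]
  congr 1
  apply eq_leftPerm
  have := leftIndices_relabel_leftPerm (relabel π w)
  rw [leftIndices_relabel, leftIndices_relabel, List.map_map] at this
  exact this

/-- In a list without repetitions exactly one rotation puts `x` first, so a preliminary rotation has
no effect on the result. -/
theorem rotate_idxOf_eq {l : List (Letter n)} (hl : l.Nodup) {x : Letter n} (hx : x ∈ l) (m : ℕ) :
    (l.rotate m).rotate ((l.rotate m).idxOf x) = l.rotate (l.idxOf x) := by
  have h1 : l.length ≠ 0 := by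
    intro h; rw [List.length_eq_zero_iff] at h; simp [h] at hx
  have e1 : ∀ k : ℕ, x ∈ l.rotate k →
      ∃ r, (l.rotate k).rotate ((l.rotate k).idxOf x) = x :: r := by
    intro k hk
    obtain ⟨a, b, hab, ha⟩ := List.eq_append_cons_of_mem hk
    rw [hab, List.idxOf_append_of_notMem ha]
    simp only [List.idxOf_cons_self, add_zero]
    rw [List.rotate_append_length_eq]
    exact ⟨_, rfl⟩
  obtain ⟨r, hr⟩ := e1 m (by simpa using hx)
  obtain ⟨r', hr'⟩ := e1 0 (by simpa using hx)
  rw [List.rotate_zero] at hr'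
  have hrot : (x :: r).IsRotated (x :: r') := by
    rw [← hr, ← hr']
    exact ((List.IsRotated.forall _ _).trans (List.IsRotated.forall _ _)).trans
      (List.IsRotated.forall _ _).symm
  obtain ⟨k, hk⟩ := hrot
  have hnd : (x :: r).Nodup := by rw [← hr]; simpa using hl
  rw [hr, hr', ← hk]
  have hk' : ((x :: r).rotate (k % (x :: r).length)) = x :: r' := by rw [List.rotate_mod, hk]
  have hlt : k % (x :: r).length < (x :: r).length := Nat.mod_lt _ (by simp)
  have h0 : ((x :: r).rotate k).head? = some x := by rw [hk]; rfl
  rw [← List.rotate_mod, List.head?_rotate hlt] at h0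
  have h2 : k % (x :: r).length = 0 := by
    rw [List.getElem?_eq_some_iff] at h0
    obtain ⟨h3, h4⟩ := h0
    exact (List.Nodup.getElem_inj_iff hnd (hi := h3) (hj := by simp)).1 (by simpa using h4)
  rw [← List.rotate_mod, h2, List.rotate_zero]

variable [NeZero n]

theorem coe_projLP (w : GaussCode n) : (projLP w).1 =
    shift ((relabel (leftPerm w) w).1.idxOf (letterL 0)) (relabel (leftPerm w) w) := rfl

theorem projLP_relabel (π : Equiv.Perm (Fin n)) (w : GaussCode n) :
    projLP (relabel π w) = projLP w := by
  apply Subtype.ext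
  rw [coe_projLP, coe_projLP, relabel_leftPerm_relabel]

theorem codeEquiv_projLP (w : GaussCode n) : CodeEquiv w (projLP w).1 := ⟨_, _, rfl⟩

theorem projLP_eq_self (v : GaussLP n) : projLP v.1 = v := by
  have h1 : leftIndices v.1 = List.finRange n := by
    have hs : ((List.finRange n).map letterL).Sublist (v.1.1.filter Letter.isL) := by
      have := v.2.1.filter Letter.isL
      rwa [List.filter_eq_self.2] at this
      intro x hx
      obtain ⟨j, -, rfl⟩ := List.mem_map.1 hx
      rfl
    have hlen : ((List.finRange n).map letterL).length = (v.1.1.filter Letter.isL).length := by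
      have := length_leftIndices v.1
      simp only [leftIndices, List.length_map] at this
      simp [this]
    rw [leftIndices, ← hs.eq_of_length hlen, List.map_map]
    have : (Letter.index ∘ letterL : Fin n → Fin n) = id := rfl
    rw [this, List.map_id]
  have h2 : leftPerm v.1 = Equiv.refl _ := by
    symm; apply eq_leftPerm; simp [h1]
  apply Subtype.ext
  rw [coe_projLP, h2, relabel_refl]
  have h3 : v.1.1.idxOf (letterL 0) = 0 := by
    have := v.2.2
    rcases h : v.1.1 with _ | ⟨x, l⟩
    · rw [h] at this; simp at this
    · rw [h] at this; simp at this; simp [this]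
  rw [h3, shift_zero]

/-- The shift moves the first letter to the end. If it is a right letter, the order of the left
letters is unchanged, and with it the normal form. If it is a left letter, it already gets the
number `0`, so `projLP w` is a mere renumbering of `w`, and shifting commutes with renumbering. -/
theorem projLP_shift_one (w : GaussCode n) :
    projLP (shift 1 w) = projLP w ∨ projLP (shift 1 w) = shiftLP (projLP w) := by
  have hw := w.2.1
  rcases h : w.1 with _ | ⟨x, l⟩
  · have := NeZero.ne n
    rw [h] at hw; simp at hw; omega
  have hsh : (shift 1 w).1 = l ++ [x] := by simp [shift, h]
  rcases hx : x.isL with _ | _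
  · left
    have h1 : leftIndices (shift 1 w) = leftIndices w := by
      simp [leftIndices, hsh, h, hx, List.filter_append]
    have h2 : leftPerm (shift 1 w) = leftPerm w := by
      symm; apply eq_leftPerm
      rw [h1, ← leftIndices_relabel, leftIndices_relabel_leftPerm]
    apply Subtype.ext
    rw [coe_projLP, coe_projLP, h2, ← shift_relabel]
    apply Subtype.ext
    exact rotate_idxOf_eq (GaussCode.nodup _) ((relabel (leftPerm w) w).2.2 _) 1
  · right
    have h1 : (projLP w).1 = relabel (leftPerm w) w := by
      rw [coe_projLP]
      have h3 : leftPerm w x.index = 0 := by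
        have := leftIndices_relabel_leftPerm w
        rw [leftIndices_relabel] at this
        obtain ⟨k, rfl⟩ := Nat.exists_eq_succ_of_ne_zero (NeZero.ne n)
        simp only [leftIndices, h, List.filter_cons, hx, List.finRange_succ] at this
        simp at this
        exact this.1
      have : (relabel (leftPerm w) w).1.idxOf (letterL 0) = 0 := by
        simp only [relabel, h, List.map_cons]
        rw [eq_letterL_of_isL hx]
        have : Letter.relabel (leftPerm w) (letterL x.index) = letterL 0 := by
          rw [← h3]; rfl
        rw [this, List.idxOf_cons_self]
      rw [this, shift_zero]
    rw [shiftLP, h1, shift_relabel, projLP_relabel]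

theorem lpOri_projLP_shift (w : GaussCode n) (m : ℕ) :
    LPOri (projLP w) (projLP (shift m w)) := by
  induction m with
  | zero => rw [shift_zero]; exact .refl _
  | succ m ih =>
    rw [← shift_shift]
    rcases projLP_shift_one (shift m w) with h | h
    · rwa [h]
    · exact ih.trans _ _ _ (.rel _ _ h)

/-- One step of `shiftLP` is a shift followed by a renumbering and a shift. Conversely `projLP`
fixes left preferred codes and forgets renumberings, so a `CodeEquiv` is tracked through `projLP`
one letter at a time. -/
theorem lpOri_iff {v v' : GaussLP n} : LPOri v v' ↔ CodeEquiv v.1 v'.1 := by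
  constructor
  · intro h
    refine (codeEquiv_equivalence.comap (Subtype.val : GaussLP n → GaussCode n)).eqvGen_iff.1
      (h.mono fun a b hab => ?_)
    subst hab
    exact (codeEquiv_shift 1 a.1).trans (codeEquiv_projLP _)
  · rintro ⟨m, π, h⟩
    have h1 := lpOri_projLP_shift (relabel π v.1) m
    rwa [← h, projLP_relabel, projLP_eq_self, projLP_eq_self] at h1

/-- Reversal is compatible with `CodeEquiv` and is its own inverse, so only the parity of the number
of reversals in a chain matters. -/
theorem lpUnori_iff {v v' : GaussLP n} :
    LPUnori v v' ↔ CodeEquiv v.1 v'.1 ∨ CodeEquiv (rev v.1) v'.1 := by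
  constructor
  · intro h
    induction h with
    | rel a b hab =>
      rcases hab with rfl | rfl
      · exact .inl ((codeEquiv_shift 1 a.1).trans (codeEquiv_projLP _))
      · exact .inr (codeEquiv_projLP _)
    | refl a => exact .inl (.refl _)
    | symm a b _ ih =>
      rcases ih with h | h
      · exact .inl h.symm
      · right
        have := h.symm.rev
        rwa [rev_rev] at this
    | trans a b c _ _ ih1 ih2 =>
      rcases ih1 with h1 | h1 <;> rcases ih2 with h2 | h2
      · exact .inl (h1.trans h2)
      · exact .inr (h1.rev.trans h2)
      · exact .inr (h1.trans h2)
      · have := h1.rev.trans h2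
        rw [rev_rev] at this
        exact .inl this
  · have hori : ∀ {a b : GaussLP n}, LPOri a b → LPUnori a b := fun h => h.mono fun _ _ => .inl
    rintro (h | h)
    · exact hori (lpOri_iff.2 h)
    · refine .trans _ _ _ (.rel _ _ (.inr rfl)) (hori (lpOri_iff.2 ?_))
      exact (codeEquiv_projLP _).symm.trans h

/-! ### Least representatives of oriented and unoriented classes -/

theorem leastOri_mem (v : GaussLP n) : LPOri v (leastOri v) :=
  WellFounded.min_mem (wellFounded_lt (α := GaussLP n)) {x | LPOri v x} ⟨_, Relation.EqvGen.refl _⟩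

theorem leastOri_le {v x : GaussLP n} (h : LPOri v x) : leastOri v ≤ x :=
  WellFounded.min_le (wellFounded_lt (α := GaussLP n)) (s := {x | LPOri v x}) h

theorem leastUnori_mem (v : GaussLP n) : LPUnori v (leastUnori v) :=
  WellFounded.min_mem (wellFounded_lt (α := GaussLP n)) {x | LPUnori v x}
    ⟨_, Relation.EqvGen.refl _⟩

theorem leastUnori_le {v x : GaussLP n} (h : LPUnori v x) : leastUnori v ≤ x :=
  WellFounded.min_le (wellFounded_lt (α := GaussLP n)) (s := {x | LPUnori v x}) h

theorem coe_projLC (w : GaussCode n) : (projLC w).1 = leastOri (projLP w) := rfl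

theorem codeEquiv_projLC (w : GaussCode n) : CodeEquiv w (projLC w).1.1 :=
  (codeEquiv_projLP w).trans (lpOri_iff.1 (leastOri_mem (projLP w)))

theorem projLC_eq_iff {w w' : GaussCode n} : projLC w = projLC w' ↔ CodeEquiv w w' := by
  constructor
  · intro h
    have := codeEquiv_projLC w'
    rw [← h] at this
    exact (codeEquiv_projLC w).trans this.symm
  · intro h
    apply Subtype.ext
    have key : ∀ {a b : GaussCode n}, CodeEquiv a b → leastOri (projLP a) ≤ leastOri (projLP b) :=
      fun {a b} hab => leastOri_le (lpOri_iff.2 (((codeEquiv_projLP a).symm.trans hab).trans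
        (codeEquiv_projLC b)))
    exact le_antisymm (key h) (key h.symm)

theorem projLC_eq_self (v : GaussLC n) : projLC v.1.1 = v := by
  apply Subtype.ext
  rw [coe_projLC, projLP_eq_self]
  exact le_antisymm (leastOri_le (.refl _)) (v.2 _ (leastOri_mem _))

theorem revLC_projLC (w : GaussCode n) : revLC (projLC w) = projLC (rev w) :=
  projLC_eq_iff.2 (codeEquiv_projLC w).symm.rev

theorem revLC_involutive : Function.Involutive (revLC : GaussLC n → GaussLC n) := by
  intro v
  conv_lhs => rw [← projLC_eq_self v]
  rw [revLC_projLC, revLC_projLC, rev_rev, projLC_eq_self]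

/-- The unoriented class is the union of the oriented classes of `w` and `rev w`; the minimum over a
union is the smaller of the two minima. -/
theorem leastUnori_projLP (w : GaussCode n) :
    leastUnori (projLP w) = min (projLC w).1 (projLC (rev w)).1 := by
  apply le_antisymm
  · refine le_min (leastUnori_le ?_) (leastUnori_le ?_)
    · exact lpUnori_iff.2 (.inl ((codeEquiv_projLP w).symm.trans (codeEquiv_projLC w)))
    · exact lpUnori_iff.2 (.inr ((codeEquiv_projLP w).symm.rev.trans (codeEquiv_projLC (rev w))))
  · rcases lpUnori_iff.1 (leastUnori_mem (projLP w)) with h | h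
    · exact (min_le_left _ _).trans (leastOri_le (lpOri_iff.2 h))
    · exact (min_le_right _ _).trans (leastOri_le (lpOri_iff.2
        (((codeEquiv_projLP (rev w)).symm.trans (codeEquiv_projLP w).rev).trans h)))

theorem leastUnori_projLP_eq_iff {w w' : GaussCode n} :
    leastUnori (projLP w) = leastUnori (projLP w') ↔ CodeEquiv w w' ∨ CodeEquiv w (rev w') := by
  constructor
  · intro h
    have h1 := lpUnori_iff.1 (leastUnori_mem (projLP w))
    have h2 := lpUnori_iff.1 (leastUnori_mem (projLP w'))
    rw [← h] at h2
    have p := codeEquiv_projLP w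
    have p' := codeEquiv_projLP w'
    rcases h1 with h1 | h1 <;> rcases h2 with h2 | h2
    · exact .inl ((p.trans h1).trans (p'.trans h2).symm)
    · exact .inr ((p.trans h1).trans (p'.rev.trans h2).symm)
    -- Exactly one of the two minimizers was reached by a reversal; reversing the whole chain moves
    -- it to the other side.
    · right
      have := ((p.rev.trans h1).trans (p'.trans h2).symm).rev
      rwa [rev_rev] at this
    · left
      have := ((p.rev.trans h1).trans (p'.rev.trans h2).symm).rev
      rwa [rev_rev, rev_rev] at this
  · rintro (h | h) <;> rw [leastUnori_projLP, leastUnori_projLP]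
    · rw [projLC_eq_iff.2 h, projLC_eq_iff.2 h.rev]
    · have h' := h.rev
      rw [rev_rev] at h'
      rw [projLC_eq_iff.2 h, projLC_eq_iff.2 h', min_comm]

end
end VirtualDoodle

namespace VirtualDoodle
open MeasureTheory Set Filter Topology

/-! ### Generic perturbations of plane curves -/

/-- The curve `γ` is immersed, has transverse double points and no triple points, as far as the
parameters in `V` are concerned. -/
structure GenericOn (γ : ℝ → Plane) (V : Set ℝ) : Prop where
  immersed : ∀ t ∈ V, deriv γ t ≠ 0
  transverse : ∀ s ∈ V, ∀ t ∈ V, γ s = γ t → ¬ SamePoint s t →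
    planeDet (deriv γ s) (deriv γ t) ≠ 0
  no_triple : ∀ r ∈ V, ∀ s ∈ V, ∀ t ∈ V, γ r = γ s → γ r = γ t →
    SamePoint r s ∨ SamePoint r t ∨ SamePoint s t

instance : (volume : Measure Plane).IsAddHaarMeasure :=
  inferInstanceAs ((volume : Measure ℝ).prod (volume : Measure ℝ)).IsAddHaarMeasure

/-- The equidimensional case of Sard's theorem: the derivative of `F` at each point of `W` kills a
nonzero vector, so its determinant vanishes. The condition is phrased by derivatives along a line,
which spares computing `fderiv ℝ F` in the applications. -/
theorem volume_image_eq_zero {E : Type*} [NormedAddCommGroup E] [NormedSpace ℝ E]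
    [MeasureSpace E] [BorelSpace E] [FiniteDimensional ℝ E]
    [(volume : Measure E).IsAddHaarMeasure] {F : E → E} {W : Set E}
    (hF : ∀ x ∈ W, DifferentiableAt ℝ F x ∧
      ∃ v : E, v ≠ 0 ∧ ∀ a, HasDerivAt (fun h : ℝ => F (x + h • v)) a 0 → a = 0) :
    volume (F '' W) = 0 := by
  refine addHaar_image_eq_zero_of_det_fderivWithin_eq_zero volume
    (f' := fun x => fderiv ℝ F x) (fun x hx => (hF x hx).1.hasFDerivAt.hasFDerivWithinAt) ?_
  intro x hx
  obtain ⟨hd, v, hv, h⟩ := hF x hx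
  have h1 : HasDerivAt (fun h : ℝ => x + h • v) v 0 := by
    simpa using ((hasDerivAt_id (0 : ℝ)).smul_const v).const_add x
  have h2 : HasDerivAt (fun h : ℝ => F (x + h • v)) (fderiv ℝ F x v) 0 := by
    have : HasFDerivAt F (fderiv ℝ F x) (x + (0 : ℝ) • v) := by simpa using hd.hasFDerivAt
    exact this.comp_hasDerivAt 0 h1
  have h3 := h _ h2
  by_contra hdet
  have h4 : Function.Injective (fderiv ℝ F x) := by
    have h5 : IsUnit (LinearMap.det (fderiv ℝ F x : E →ₗ[ℝ] E)) := isUnit_iff_ne_zero.2 hdet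
    exact ((LinearMap.isUnit_iff_isUnit_det _).2 h5 |> fun u => ((Module.End.isUnit_iff _).1 u).1)
  exact hv (h4 (by simpa using h3))

theorem eq_zero_of_const_along {E : Type*} [NormedAddCommGroup E] [NormedSpace ℝ E]
    {F : E → E} {x v : E} (h : ∀ k : ℝ, F (x + k • v) = F x) (a : E)
    (ha : HasDerivAt (fun k : ℝ => F (x + k • v)) a 0) : a = 0 := by
  simp only [h] at ha
  exact ha.unique (hasDerivAt_const _ _)

theorem exists_combination_of_planeDet_eq_zero {u v : Plane} (h : planeDet u v = 0) :
    ∃ a b : ℝ, (a, b) ≠ (0, 0) ∧ a • u = b • v := by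
  by_cases hu : u = 0
  · exact ⟨1, 0, by simp, by simp [hu]⟩
  unfold planeDet at h
  by_cases h1 : u.1 = 0
  · have h2 : u.2 ≠ 0 := fun h2 => hu (Prod.ext h1 h2)
    refine ⟨v.2, u.2, by simp [h2], Prod.ext ?_ ?_⟩
    · simp [h1]
      have : u.2 * v.1 = 0 := by rw [h1] at h; linarith
      simpa [h2] using this
    · simp [mul_comm]
  · refine ⟨v.1, u.1, by simp [h1], Prod.ext ?_ ?_⟩
    · simp [mul_comm]
    · simp; linarith

theorem planeDet_ne_zero_of_injective {u v : Plane} (h : planeDet u v ≠ 0) {a b : ℝ}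
    (hab : a • u = b • v) : a = 0 ∧ b = 0 := by
  unfold planeDet at h
  have h1 := congrArg Prod.fst hab
  have h2 := congrArg Prod.snd hab
  simp at h1 h2
  constructor
  · have : a * (u.1 * v.2 - u.2 * v.1) = 0 := by linear_combination v.2 * h1 - v.1 * h2
    simpa [h] using this
  · have : b * (u.1 * v.2 - u.2 * v.1) = 0 := by linear_combination u.2 * h1 - u.1 * h2
    simpa [h] using this

/-- Transversality makes the derivative of (s, t) ↦ γ s - γ t injective at a double point, so double
points are isolated among parameter pairs, and a discrete subset of the plane is countable. -/
theorem GenericOn.countable_double {γ : ℝ → Plane} {V : Set ℝ} (h : GenericOn γ V)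
    (hγ : Differentiable ℝ γ) :
    {c | ∃ s ∈ V, ∃ t ∈ V, ¬ SamePoint s t ∧ γ s = c ∧ γ t = c}.Countable := by
  set S : Set (ℝ × ℝ) := {x | x.1 ∈ V ∧ x.2 ∈ V ∧ ¬ SamePoint x.1 x.2 ∧ γ x.1 = γ x.2} with hS
  have hSc : S.Countable := by
    refine (HereditarilyLindelofSpace.isLindelof S).countable_of_isDiscrete ?_
    rw [isDiscrete_iff_nhdsNE]
    rintro ⟨s, t⟩ ⟨hs, ht, hst, hc⟩
    have hd := h.transverse s hs t ht hc hst
    set L : ℝ × ℝ →L[ℝ] Plane :=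
      (ContinuousLinearMap.fst ℝ ℝ ℝ).smulRight (deriv γ s) -
        (ContinuousLinearMap.snd ℝ ℝ ℝ).smulRight (deriv γ t) with hL
    have h1 : HasFDerivAt (fun x : ℝ × ℝ => γ x.1 - γ x.2) L (s, t) := by
      have a1 := (hγ s).hasDerivAt.hasFDerivAt.comp (s, t)
        (hasFDerivAt_fst (𝕜 := ℝ) (p := ((s, t) : ℝ × ℝ)))
      have a2 := (hγ t).hasDerivAt.hasFDerivAt.comp (s, t)
        (hasFDerivAt_snd (𝕜 := ℝ) (p := ((s, t) : ℝ × ℝ)))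
      refine (a1.sub a2).congr_fderiv ?_
      ext <;> simp [hL]
    have h2 : ∃ C, AntilipschitzWith C L := by
      obtain ⟨K, -, hK⟩ := (L : ℝ × ℝ →ₗ[ℝ] Plane).exists_antilipschitzWith (by
        rw [LinearMap.ker_eq_bot']
        rintro ⟨a, b⟩ hab
        have : a • deriv γ s = b • deriv γ t := by
          simpa [hL, sub_eq_zero] using hab
        obtain ⟨rfl, rfl⟩ := planeDet_ne_zero_of_injective hd this
        rfl)
      exact ⟨K, hK⟩
    have h3 := h1.eventually_ne (c := 0) h2
    rw [inf_principal_eq_bot]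
    filter_upwards [h3] with x hx hxS
    exact hx (sub_eq_zero.2 hxS.2.2.2)
  refine (hSc.image fun x => γ x.1).mono ?_
  rintro c ⟨s, hs, t, ht, hst, rfl, htc⟩
  exact ⟨(s, t), ⟨hs, ht, hst, htc.symm⟩, rfl⟩

/-- Parameters of perturbations. -/
abbrev Perturbation : Type := Plane × Plane × Plane

instance : (volume : Measure (Plane × Plane)).IsAddHaarMeasure :=
  inferInstanceAs ((volume : Measure Plane).prod (volume : Measure Plane)).IsAddHaarMeasure

instance : (volume : Measure Perturbation).IsAddHaarMeasure :=
  Measure.prod.instIsAddHaarMeasure (volume : Measure Plane) (volume : Measure (Plane × Plane))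

/-- The perturbation of `γ` by a polynomial of degree two in `g`, cut off by `φ`. -/
def perturb (γ : ℝ → Plane) (φ g : ℝ → ℝ) (l : Perturbation) (t : ℝ) : Plane :=
  γ t + φ t • (l.1 + g t • l.2.1 + (g t) ^ 2 • l.2.2)

/-! ### Null sets of non-generic perturbations -/

section
variable {γ : ℝ → Plane} {φ g : ℝ → ℝ}

theorem contDiff_perturb (hγ : ContDiff ℝ ∞ γ) (hφ : ContDiff ℝ ∞ φ) (hg : ContDiff ℝ ∞ g)
    (l : Perturbation) : ContDiff ℝ ∞ (perturb γ φ g l) := by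
  unfold perturb; fun_prop

theorem perturb_eq_of_eq_zero {t : ℝ} (h : φ t = 0) (l : Perturbation) :
    perturb γ φ g l t = γ t := by simp [perturb, h]

theorem hasDerivAt_perturb {γ' : Plane} {φ' g' t : ℝ} (hγ : HasDerivAt γ γ' t)
    (hφ : HasDerivAt φ φ' t) (hg : HasDerivAt g g' t) (l : Perturbation) :
    HasDerivAt (perturb γ φ g l)
      (γ' + (φ t • (g' • l.2.1 + (2 * g t * g') • l.2.2)
        + φ' • (l.1 + g t • l.2.1 + (g t) ^ 2 • l.2.2))) t := by
  refine hγ.add (hφ.smul ?_)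
  have h1 := (hg.smul_const l.2.1).const_add l.1
  have h2 := (hg.pow 2).smul_const l.2.2
  convert h1.add h2 using 1
  · rfl
  · norm_num

theorem deriv_perturb_eq_of_eq_zero (hγ : Differentiable ℝ γ) (hφ : Differentiable ℝ φ)
    (hg : Differentiable ℝ g) {t : ℝ} (h : φ t = 0) (h' : deriv φ t = 0) (l : Perturbation) :
    deriv (perturb γ φ g l) t = deriv γ t := by
  rw [(hasDerivAt_perturb (hγ t).hasDerivAt (hφ t).hasDerivAt (hg t).hasDerivAt l).deriv]
  simp [h, h']

/-- Almost all perturbations are immersed. -/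
theorem null_not_immersed (hγ : ContDiff ℝ ∞ γ) (hφ : ContDiff ℝ ∞ φ) (hg : ContDiff ℝ ∞ g)
    (hg' : ∀ t, φ t ≠ 0 → deriv g t ≠ 0) :
    volume {l : Perturbation | ∃ t, φ t ≠ 0 ∧ deriv (perturb γ φ g l) t = 0} = 0 := by
  have dγ : Differentiable ℝ γ := hγ.differentiable (by simp)
  have dφ : Differentiable ℝ φ := hφ.differentiable (by simp)
  have dg : Differentiable ℝ g := hg.differentiable (by simp)
  have dγ' : Differentiable ℝ (deriv γ) :=
    ((contDiff_infty_iff_deriv.1 hγ).2).differentiable (by simp)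
  have dφ' : Differentiable ℝ (deriv φ) :=
    ((contDiff_infty_iff_deriv.1 hφ).2).differentiable (by simp)
  have dg' : Differentiable ℝ (deriv g) :=
    ((contDiff_infty_iff_deriv.1 hg).2).differentiable (by simp)
  -- The equation of a vanishing derivative is solved for the linear coefficient, given the time t,
  -- the value x.2.1 of the quadratic polynomial at t, and the quadratic coefficient. These are five
  -- real parameters; the sixth, x.1.2, is a dummy along which `F` is constant.
  let B : Perturbation → Plane := fun x =>
    (-(φ x.1.1 * deriv g x.1.1)⁻¹) • (deriv γ x.1.1 + deriv φ x.1.1 • x.2.1)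
      - (2 * g x.1.1) • x.2.2
  let F : Perturbation → Perturbation := fun x =>
    (x.2.1 - g x.1.1 • B x - (g x.1.1) ^ 2 • x.2.2, B x, x.2.2)
  refine measure_mono_null (t := F '' {x | φ x.1.1 ≠ 0}) ?_ (volume_image_eq_zero ?_)
  · rintro ⟨A, B', C⟩ ⟨t, ht, hd⟩
    rw [(hasDerivAt_perturb (dγ t).hasDerivAt (dφ t).hasDerivAt (dg t).hasDerivAt _).deriv] at hd
    have hB : B ((t, 0), A + g t • B' + (g t) ^ 2 • C, C) = B' := by
      have h0 := hg' t ht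
      have h1 := congrArg Prod.fst hd
      have h2 := congrArg Prod.snd hd
      simp at h1 h2
      ext
      · simp [B]; field_simp; linear_combination -h1
      · simp [B]; field_simp; linear_combination -h2
    refine ⟨((t, 0), A + g t • B' + (g t) ^ 2 • C, C), ht, ?_⟩
    simp only [F, hB]
    ext <;> simp <;> ring
  · intro x hx
    have h0 := hg' _ hx
    have hx' : φ x.1.1 ≠ 0 := hx
    have dB : DifferentiableAt ℝ B x := by
      simp only [B]
      fun_prop (disch := simp [hx', h0])
    refine ⟨by simp only [F]; fun_prop, ((0, 1), 0, 0), by simp, fun a ha => ?_⟩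
    exact eq_zero_of_const_along (by simp [F, B]) a ha

theorem hasDerivAt_along {E : Type*} [NormedAddCommGroup E] [NormedSpace ℝ E] {f : ℝ → E}
    {p : ℝ} (hf : DifferentiableAt ℝ f p) (v : ℝ) :
    HasDerivAt (fun h : ℝ => f (p + h * v)) (v • deriv f p) 0 := by
  have hl : HasDerivAt (fun h : ℝ => p + h * v) v 0 := by
    simpa using ((hasDerivAt_id (0 : ℝ)).mul_const v).const_add p
  have : HasDerivAt f (deriv f p) (p + 0 * v) := by simpa using hf.hasDerivAt
  exact this.scomp 0 hl

/-- The product rule splits the velocity of the moving point into the part with frozen `l`, which is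
the velocity of `q` by assumption, and the part coming from the variation of `l`. The latter must
vanish. This turns a tangency into a critical point of the parametrization of the bad set. -/
theorem perturbation_deriv_eq_zero (dγ : Differentiable ℝ γ) (dφ : Differentiable ℝ φ)
    (dg : Differentiable ℝ g) {l : ℝ → Perturbation} {l' : Perturbation} (hl : HasDerivAt l l' 0)
    {p v : ℝ} (hp : φ p ≠ 0) {q : ℝ → Plane}
    (hq : HasDerivAt q (v • deriv (perturb γ φ g (l 0)) p) 0)
    (h : ∀ᶠ h in 𝓝 (0 : ℝ), perturb γ φ g (l h) (p + h * v) = q h) :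
    l'.1 + g p • l'.2.1 + (g p) ^ 2 • l'.2.2 = 0 := by
  have h1 : HasDerivAt (fun h => (l h).1) l'.1 0 := hl.fst
  have h2 : HasDerivAt (fun h => (l h).2.1) l'.2.1 0 := hl.snd.fst
  have h3 : HasDerivAt (fun h => (l h).2.2) l'.2.2 0 := hl.snd.snd
  have kγ := hasDerivAt_along (dγ p) v
  have kφ := hasDerivAt_along (dφ p) v
  have kg := hasDerivAt_along (dg p) v
  have d1 := kγ.add (kφ.smul ((h1.add (kg.smul h2)).add ((kg.pow 2).smul h3)))
  have d2 := hq.congr_of_eventuallyEq h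
  have heq := d1.unique d2
  rw [(hasDerivAt_perturb (dγ p).hasDerivAt (dφ p).hasDerivAt (dg p).hasDerivAt _).deriv] at heq
  have : φ p • (l'.1 + g p • l'.2.1 + (g p) ^ 2 • l'.2.2) = 0 := by
    ext
    · have := congrArg Prod.fst heq
      simp at this ⊢
      linear_combination this
    · have := congrArg Prod.snd heq
      simp at this ⊢
      linear_combination this
  exact (smul_eq_zero.1 this).resolve_left hp

/-- Almost all perturbations are transverse to the unperturbed curve. -/
theorem null_not_transverse_fixed (dγ : Differentiable ℝ γ) (dφ : Differentiable ℝ φ)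
    (dg : Differentiable ℝ g) :
    volume {l : Perturbation | ∃ s t, φ s ≠ 0 ∧ perturb γ φ g l s = γ t ∧
      planeDet (deriv (perturb γ φ g l) s) (deriv γ t) = 0} = 0 := by
  -- The constant coefficient is solved from the incidence of the perturbed curve at s = x.1.1 with
  -- `γ` at t = x.1.2. The parameter space now has full dimension six, so nullity has to come from
  -- the tangency.
  let F : Perturbation → Perturbation := fun x =>
    ((φ x.1.1)⁻¹ • (γ x.1.2 - γ x.1.1) - g x.1.1 • x.2.1 - (g x.1.1) ^ 2 • x.2.2, x.2.1, x.2.2)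
  have hF : ∀ x, φ x.1.1 ≠ 0 → perturb γ φ g (F x) x.1.1 = γ x.1.2 := by
    intro x hx
    simp only [perturb, F]
    ext <;> simp <;> field_simp <;> ring
  refine measure_mono_null (t := F '' {x | φ x.1.1 ≠ 0 ∧
    planeDet (deriv (perturb γ φ g (F x)) x.1.1) (deriv γ x.1.2) = 0}) ?_ (volume_image_eq_zero ?_)
  · rintro ⟨A, B, C⟩ ⟨s, t, hs, hst, hd⟩
    have h1 : F ((s, t), B, C) = (A, B, C) := by
      simp only [F, ← hst, perturb]
      ext <;> simp <;> field_simp <;> ring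
    exact ⟨((s, t), B, C), ⟨hs, by rw [h1]; exact hd⟩, h1⟩
  · rintro ⟨⟨s, t⟩, B, C⟩ ⟨hx, hd⟩
    have hx' : φ s ≠ 0 := hx
    -- Parallel velocities allow s and t to move at rates σ and τ so that the incidence persists to
    -- first order with fixed coefficients; this is the direction killed by the derivative of `F`.
    obtain ⟨σ, τ, hστ, hcomb⟩ := exists_combination_of_planeDet_eq_zero hd
    refine ⟨by simp only [F]; fun_prop (disch := simp [hx']), ((σ, τ), 0, 0), ?_, fun a ha => ?_⟩
    · intro h; apply hστ; simpa using h
    have ha2 : a.2 = 0 := by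
      have hsnd : HasDerivAt (fun h : ℝ => (F (((s, t), B, C) + h • ((σ, τ), 0, 0))).2) a.2 0 :=
        ha.snd
      refine hsnd.unique ?_
      simpa [F] using hasDerivAt_const (0 : ℝ) (B, C)
    have key := perturbation_deriv_eq_zero dγ dφ dg ha hx' (v := σ)
      (q := fun h => γ (t + h * τ)) (by simpa [← hcomb] using hasDerivAt_along (dγ t) τ) (by
        have : ∀ᶠ h in 𝓝 (0 : ℝ), φ (s + h * σ) ≠ 0 :=
          (hasDerivAt_along (dφ s) σ).continuousAt.eventually_ne (by simpa using hx')
        filter_upwards [this] with h hh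
        have := hF (((s, t), B, C) + h • ((σ, τ), 0, 0)) (by simpa using hh)
        simp only [Prod.fst_add, Prod.smul_fst, smul_eq_mul, Prod.snd_add, Prod.smul_snd] at this
        exact this)
    rw [ha2] at key
    exact Prod.ext (by simpa using key) ha2

/-- Interpolation of two values, with a prescribed leading coefficient. -/
noncomputable def interpolateTwo (γ : ℝ → Plane) (φ g : ℝ → ℝ) (s t : ℝ) (z C : Plane) :
    Perturbation :=
  let ys := (φ s)⁻¹ • (z - γ s) - (g s) ^ 2 • C
  let yt := (φ t)⁻¹ • (z - γ t) - (g t) ^ 2 • C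
  (ys - g s • (g s - g t)⁻¹ • (ys - yt), (g s - g t)⁻¹ • (ys - yt), C)

theorem perturb_interpolateTwo {s t : ℝ} (hs : φ s ≠ 0) (ht : φ t ≠ 0) (hst : g s ≠ g t)
    (z C : Plane) :
    perturb γ φ g (interpolateTwo γ φ g s t z C) s = z ∧
      perturb γ φ g (interpolateTwo γ φ g s t z C) t = z := by
  have h : g s - g t ≠ 0 := sub_ne_zero.2 hst
  constructor <;> simp only [perturb, interpolateTwo] <;> ext <;> simp <;> field_simp <;> ring

theorem interpolateTwo_perturb {s t : ℝ} (hs : φ s ≠ 0) (ht : φ t ≠ 0) (hst : g s ≠ g t)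
    (l : Perturbation) (h : perturb γ φ g l s = perturb γ φ g l t) :
    interpolateTwo γ φ g s t (perturb γ φ g l s) l.2.2 = l := by
  have h0 : g s - g t ≠ 0 := sub_ne_zero.2 hst
  have e : ∀ r, φ r ≠ 0 → (φ r)⁻¹ • (perturb γ φ g l r - γ r) - (g r) ^ 2 • l.2.2
      = l.1 + g r • l.2.1 := by
    intro r hr
    simp only [perturb]
    ext <;> simp <;> field_simp <;> ring
  have hB : (g s - g t)⁻¹ • (l.1 + g s • l.2.1 - (l.1 + g t • l.2.1)) = l.2.1 := by
    ext <;> simp <;> field_simp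
  simp only [interpolateTwo]
  rw [e s hs, h, e t ht, hB]
  simp

/-- Almost all perturbations are self-transverse. -/
theorem null_not_transverse_self (dγ : Differentiable ℝ γ) (dφ : Differentiable ℝ φ)
    (dg : Differentiable ℝ g) :
    volume {l : Perturbation | ∃ s t, φ s ≠ 0 ∧ φ t ≠ 0 ∧ g s ≠ g t ∧
      perturb γ φ g l s = perturb γ φ g l t ∧
      planeDet (deriv (perturb γ φ g l) s) (deriv (perturb γ φ g l) t) = 0} = 0 := by
  let F : Perturbation → Perturbation := fun x => interpolateTwo γ φ g x.1.1 x.1.2 x.2.1 x.2.2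
  refine measure_mono_null (t := F '' {x | φ x.1.1 ≠ 0 ∧ φ x.1.2 ≠ 0 ∧ g x.1.1 ≠ g x.1.2 ∧
    planeDet (deriv (perturb γ φ g (F x)) x.1.1) (deriv (perturb γ φ g (F x)) x.1.2) = 0}) ?_
    (volume_image_eq_zero ?_)
  · rintro l ⟨s, t, hs, ht, hg, hst, hd⟩
    have h1 : F ((s, t), perturb γ φ g l s, l.2.2) = l := interpolateTwo_perturb hs ht hg l hst
    exact ⟨((s, t), perturb γ φ g l s, l.2.2), ⟨hs, ht, hg, by rw [h1]; exact hd⟩, h1⟩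
  · rintro ⟨⟨s, t⟩, z, C⟩ ⟨hs, ht, hst, hd⟩
    have hs' : φ s ≠ 0 := hs
    have ht' : φ t ≠ 0 := ht
    have hst' : g s - g t ≠ 0 := sub_ne_zero.2 hst
    obtain ⟨σ, τ, hστ, hcomb⟩ := exists_combination_of_planeDet_eq_zero hd
    -- The common velocity of the two branches when s and t move at rates σ and τ; the prescribed
    -- common value z has to move along with it.
    set ζ := σ • deriv (perturb γ φ g (F ((s, t), z, C))) s with hζ
    refine ⟨by simp only [F, interpolateTwo]; fun_prop (disch := simp [hs', ht', hst']),
      ((σ, τ), ζ, 0), ?_, fun a ha => ?_⟩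
    · intro h; apply hστ
      exact congrArg Prod.fst h
    have ha2 : a.2.2 = 0 := by
      have hsnd : HasDerivAt (fun h : ℝ => (F (((s, t), z, C) + h • ((σ, τ), ζ, 0))).2.2)
        a.2.2 0 := ha.snd.snd
      refine hsnd.unique ?_
      simpa [F, interpolateTwo] using hasDerivAt_const (0 : ℝ) C
    have hz : HasDerivAt (fun h : ℝ => z + h • ζ) ζ 0 := by
      simpa using ((hasDerivAt_id (0 : ℝ)).smul_const ζ).const_add z
    have e1 : ∀ᶠ h in 𝓝 (0 : ℝ), φ (s + h * σ) ≠ 0 :=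
      (hasDerivAt_along (dφ s) σ).continuousAt.eventually_ne (by simpa using hs')
    have e2 : ∀ᶠ h in 𝓝 (0 : ℝ), φ (t + h * τ) ≠ 0 :=
      (hasDerivAt_along (dφ t) τ).continuousAt.eventually_ne (by simpa using ht')
    have e3 : ∀ᶠ h in 𝓝 (0 : ℝ), g (s + h * σ) - g (t + h * τ) ≠ 0 :=
      ((hasDerivAt_along (dg s) σ).continuousAt.sub
        (hasDerivAt_along (dg t) τ).continuousAt).eventually_ne (by simpa using hst')
    have key1 := perturbation_deriv_eq_zero dγ dφ dg ha hs' (v := σ)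
      (q := fun h => z + h • ζ) (by simpa [hζ] using hz) (by
        filter_upwards [e1, e2, e3] with h h1 h2 h3
        simpa [F] using (perturb_interpolateTwo h1 h2 (sub_ne_zero.1 h3) (z + h • ζ) C).1)
    have key2 := perturbation_deriv_eq_zero dγ dφ dg ha ht' (v := τ)
      (q := fun h => z + h • ζ) (by simpa [← hcomb] using hz) (by
        filter_upwards [e1, e2, e3] with h h1 h2 h3
        simpa [F] using (perturb_interpolateTwo h1 h2 (sub_ne_zero.1 h3) (z + h • ζ) C).2)
    rw [ha2] at key1 key2
    -- The two branches give a.1 + g s • a.2.1 = 0 and a.1 + g t • a.2.1 = 0, and g s ≠ g t.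
    have hB : a.2.1 = 0 := by
      have : (g s - g t) • a.2.1 = 0 := by
        rw [sub_smul, sub_eq_zero]
        simpa using key1.trans key2.symm
      simpa [hst'] using this
    rw [hB] at key1
    exact Prod.ext (by simpa using key1) (Prod.ext hB ha2)

/-- Almost all perturbations avoid a given point. -/
theorem null_mem (dγ : Differentiable ℝ γ) (dφ : Differentiable ℝ φ) (dg : Differentiable ℝ g)
    (c : Plane) : volume {l : Perturbation | ∃ r, φ r ≠ 0 ∧ perturb γ φ g l r = c} = 0 := by
  -- Only the time and two coefficients are free, five parameters; x.1.2 is the dummy direction.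
  let F : Perturbation → Perturbation := fun x =>
    ((φ x.1.1)⁻¹ • (c - γ x.1.1) - g x.1.1 • x.2.1 - (g x.1.1) ^ 2 • x.2.2, x.2.1, x.2.2)
  refine measure_mono_null (t := F '' {x | φ x.1.1 ≠ 0}) ?_ (volume_image_eq_zero ?_)
  · rintro ⟨A, B, C⟩ ⟨s, hs, hc⟩
    refine ⟨((s, 0), B, C), hs, ?_⟩
    simp only [F, ← hc, perturb]
    ext <;> simp <;> field_simp <;> ring
  · intro x hx
    have hx' : φ x.1.1 ≠ 0 := hx
    exact ⟨by simp only [F]; fun_prop (disch := simp [hx']), ((0, 1), 0, 0), by simp,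
      fun a ha => eq_zero_of_const_along (by simp [F]) a ha⟩

/-- Almost all perturbations have no double point on the unperturbed curve. -/
theorem null_double_fixed (dγ : Differentiable ℝ γ) (dφ : Differentiable ℝ φ)
    (dg : Differentiable ℝ g) :
    volume {l : Perturbation | ∃ r s t, φ r ≠ 0 ∧ φ s ≠ 0 ∧ g r ≠ g s ∧
      perturb γ φ g l r = γ t ∧ perturb γ φ g l s = γ t} = 0 := by
  -- Three times and the quadratic coefficient give five parameters; x.2.1.2 is the dummy direction.
  let F : Perturbation → Perturbation := fun x =>
    interpolateTwo γ φ g x.1.1 x.1.2 (γ x.2.1.1) x.2.2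
  refine measure_mono_null (t := F '' {x | φ x.1.1 ≠ 0 ∧ φ x.1.2 ≠ 0 ∧ g x.1.1 - g x.1.2 ≠ 0}) ?_
    (volume_image_eq_zero ?_)
  · rintro l ⟨r, s, t, hr, hs, hg, hrt, hst⟩
    refine ⟨((r, s), (t, 0), l.2.2), ⟨hr, hs, sub_ne_zero.2 hg⟩, ?_⟩
    simp only [F, ← hrt]
    exact interpolateTwo_perturb hr hs hg l (hrt.trans hst.symm)
  · rintro x ⟨h1, h2, h3⟩
    exact ⟨by simp only [F, interpolateTwo]; fun_prop (disch := simp [h1, h2, h3]),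
      ((0, 0), (0, 1), 0), by simp,
      fun a ha => eq_zero_of_const_along (by simp [F]) a ha⟩

/-- Almost all perturbations have no triple points. -/
theorem null_triple (dγ : Differentiable ℝ γ) (dφ : Differentiable ℝ φ)
    (dg : Differentiable ℝ g) :
    volume {l : Perturbation | ∃ r s t, φ r ≠ 0 ∧ φ s ≠ 0 ∧ φ t ≠ 0 ∧ g r ≠ g s ∧ g r ≠ g t ∧
      g s ≠ g t ∧ perturb γ φ g l r = perturb γ φ g l s ∧
      perturb γ φ g l r = perturb γ φ g l t} = 0 := by
  -- The second divided difference: three prescribed values determine a quadratic polynomial in g,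
  -- which is why the perturbations have degree two. Three times and the common point give five
  -- parameters, with x.2.1.2 as dummy.
  let C : Perturbation → Plane := fun x =>
    ((g x.1.1 - g x.1.2)⁻¹ * (g x.1.1 - g x.2.1.1)⁻¹) • (φ x.1.1)⁻¹ • (x.2.2 - γ x.1.1)
    - ((g x.1.1 - g x.1.2)⁻¹ * (g x.1.2 - g x.2.1.1)⁻¹) • (φ x.1.2)⁻¹ • (x.2.2 - γ x.1.2)
    + ((g x.1.1 - g x.2.1.1)⁻¹ * (g x.1.2 - g x.2.1.1)⁻¹) •
      (φ x.2.1.1)⁻¹ • (x.2.2 - γ x.2.1.1)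
  let F : Perturbation → Perturbation := fun x =>
    interpolateTwo γ φ g x.1.1 x.1.2 x.2.2 (C x)
  refine measure_mono_null (t := F '' {x | φ x.1.1 ≠ 0 ∧ φ x.1.2 ≠ 0 ∧ φ x.2.1.1 ≠ 0 ∧
      g x.1.1 - g x.1.2 ≠ 0 ∧ g x.1.1 - g x.2.1.1 ≠ 0 ∧ g x.1.2 - g x.2.1.1 ≠ 0}) ?_
    (volume_image_eq_zero ?_)
  · rintro l ⟨r, s, t, hr, hs, ht, hrs, hrt, hst, h1, h2⟩
    have k1 := sub_ne_zero.2 hrs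
    have k2 := sub_ne_zero.2 hrt
    have k3 := sub_ne_zero.2 hst
    refine ⟨((r, s), (t, 0), perturb γ φ g l r), ⟨hr, hs, ht, k1, k2, k3⟩, ?_⟩
    have e : ∀ r, φ r ≠ 0 → (φ r)⁻¹ • (perturb γ φ g l r - γ r)
        = l.1 + g r • l.2.1 + (g r) ^ 2 • l.2.2 := by
      intro r hr
      simp only [perturb]
      ext <;> simp <;> field_simp
    have hC : C ((r, s), (t, 0), perturb γ φ g l r) = l.2.2 := by
      simp only [C]
      rw [e r hr, h1, e s hs, ← h1, h2, e t ht]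
      ext <;> simp <;> field_simp <;> ring
    simp only [F, hC]
    exact interpolateTwo_perturb hr hs hrs l h1
  · rintro x ⟨h1, h2, h3, h4, h5, h6⟩
    exact ⟨by
      simp only [F, C, interpolateTwo]; fun_prop (disch := simp [h1, h2, h3, h4, h5, h6]),
      ((0, 0), (0, 1), 0), by simp,
      fun a ha => eq_zero_of_const_along (by simp [F, C]) a ha⟩

/-- On `V` the cutoff vanishes, and so does its derivative since `φ` has a minimum there; the curve
keeps its values and velocities on `V`. Degeneracies that involve moved parameters fall into the
null sets above, the function `g` separating distinct points of the support of `φ`. -/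
theorem ae_genericOn_perturb {V : Set ℝ} (hγ : ContDiff ℝ ∞ γ) (hφ : ContDiff ℝ ∞ φ)
    (hg : ContDiff ℝ ∞ g) (hφ0 : ∀ t, 0 ≤ φ t) (hV : ∀ t ∈ V, φ t = 0)
    (hg' : ∀ t, φ t ≠ 0 → deriv g t ≠ 0)
    (hginj : ∀ s t, φ s ≠ 0 → φ t ≠ 0 → g s = g t → SamePoint s t) (h : GenericOn γ V) :
    ∀ᵐ l : Perturbation, GenericOn (perturb γ φ g l) (V ∪ {t | φ t ≠ 0}) := by
  have dγ : Differentiable ℝ γ := hγ.differentiable (by simp)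
  have dφ : Differentiable ℝ φ := hφ.differentiable (by simp)
  have dg : Differentiable ℝ g := hg.differentiable (by simp)
  have hval : ∀ l, ∀ t ∈ V, perturb γ φ g l t = γ t := fun l t ht =>
    perturb_eq_of_eq_zero (hV t ht) l
  have hder : ∀ l, ∀ t ∈ V, deriv (perturb γ φ g l) t = deriv γ t := fun l t ht => by
    refine deriv_perturb_eq_of_eq_zero dγ dφ dg (hV t ht) ?_ l
    exact IsLocalMin.deriv_eq_zero (Eventually.of_forall fun s => by rw [hV t ht]; exact hφ0 s)
  have hc := h.countable_double dγ
  -- A moved branch must avoid all double points of the fixed part; countability reduces this to one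
  -- null set for each point.
  have ae_c : ∀ᵐ l : Perturbation, ∀ c ∈ {c | ∃ s ∈ V, ∃ t ∈ V, ¬ SamePoint s t ∧ γ s = c ∧
      γ t = c}, ¬ ∃ r, φ r ≠ 0 ∧ perturb γ φ g l r = c :=
    (ae_ball_iff hc).2 fun c _ => measure_eq_zero_iff_ae_notMem.1 (null_mem dγ dφ dg c)
  filter_upwards [measure_eq_zero_iff_ae_notMem.1 (null_not_immersed hγ hφ hg hg'),
    measure_eq_zero_iff_ae_notMem.1 (null_not_transverse_fixed dγ dφ dg),
    measure_eq_zero_iff_ae_notMem.1 (null_not_transverse_self dγ dφ dg),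
    measure_eq_zero_iff_ae_notMem.1 (null_double_fixed dγ dφ dg),
    measure_eq_zero_iff_ae_notMem.1 (null_triple dγ dφ dg), ae_c] with l i1 i2 i3 i4 i5 i6
  have hanti : ∀ u v, planeDet u v ≠ 0 → planeDet v u ≠ 0 := by
    intro u v huv hvu
    apply huv
    unfold planeDet at hvu ⊢
    linarith
  have hinj : ∀ {s t}, φ s ≠ 0 → φ t ≠ 0 → ¬ SamePoint s t → g s ≠ g t :=
    fun hs ht hst hgg => hst (hginj _ _ hs ht hgg)
  refine ⟨?_, ?_, ?_⟩
  · rintro t (ht | ht)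
    · rw [hder l t ht]; exact h.immersed t ht
    · exact fun h0 => i1 ⟨t, ht, h0⟩
  · rintro s (hs | hs) t (ht | ht) hst hne
    · rw [hder l s hs, hder l t ht]
      rw [hval l s hs, hval l t ht] at hst
      exact h.transverse s hs t ht hst hne
    · rw [hval l s hs] at hst
      rw [hder l s hs]
      exact hanti _ _ fun h0 => i2 ⟨t, s, ht, hst.symm, h0⟩
    · rw [hval l t ht] at hst
      rw [hder l t ht]
      exact fun h0 => i2 ⟨s, t, hs, hst, h0⟩
    · exact fun h0 => i3 ⟨s, t, hs, ht, hinj hs ht hne, hst, h0⟩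
  -- The cases differ by how many of the three parameters are moved: none uses the genericity on
  -- `V`, one uses `i6`, two use `i4`, three use `i5`.
  · rintro r (hr | hr) s (hs | hs) t (ht | ht) h1 h2 <;> by_contra! hcon <;>
      obtain ⟨n1, n2, n3⟩ := hcon
    · rw [hval l r hr, hval l s hs] at h1
      rw [hval l r hr, hval l t ht] at h2
      rcases h.no_triple r hr s hs t ht h1 h2 with h | h | h <;> contradiction
    · rw [hval l r hr] at h1 h2
      rw [hval l s hs] at h1
      exact i6 _ ⟨r, hr, s, hs, n1, rfl, h1.symm⟩ ⟨t, ht, h2.symm⟩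
    · rw [hval l r hr] at h1 h2
      rw [hval l t ht] at h2
      exact i6 _ ⟨r, hr, t, ht, n2, rfl, h2.symm⟩ ⟨s, hs, h1.symm⟩
    · rw [hval l r hr] at h1 h2
      exact i4 ⟨s, t, r, hs, ht, hinj hs ht n3, h1.symm, h2.symm⟩
    · have h3 := h1.symm.trans h2
      rw [hval l s hs] at h1 h3
      rw [hval l t ht] at h3
      exact i6 _ ⟨s, hs, t, ht, n3, rfl, h3.symm⟩ ⟨r, hr, h1⟩
    · have h3 := h1.symm.trans h2
      rw [hval l s hs] at h1 h3
      exact i4 ⟨r, t, s, hr, ht, hinj hr ht n2, h1, h3.symm⟩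
    · have h3 := h1.symm.trans h2
      rw [hval l t ht] at h2 h3
      exact i4 ⟨r, s, t, hr, hs, hinj hr hs n1, h2, h3⟩
    · exact i5 ⟨r, s, t, hr, hs, ht, hinj hr hs n1, hinj hr ht n2, hinj hs ht n3, h1, h2⟩

end
end VirtualDoodle

namespace VirtualDoodle
open Set Filter Topology

/-! ### Isotopies of the plane -/

theorem IsPlaneIsotopy.trans {H K : ℝ → Plane ≃ Plane} (hH : IsPlaneIsotopy H)
    (hK : IsPlaneIsotopy K) : IsPlaneIsotopy fun t => (H t).trans (K t) := by
  refine ⟨by simp [hH.1, hK.1], ?_, fun t => ?_⟩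
  · exact hK.2.1.comp (contDiff_fst.prodMk hH.2.1)
  · exact (hH.2.2 t).comp (hK.2.2 t)

theorem IsPlaneIsotopy.contDiff {H : ℝ → Plane ≃ Plane} (hH : IsPlaneIsotopy H) (t : ℝ) :
    ContDiff ℝ ∞ (H t) :=
  hH.2.1.comp (contDiff_const.prodMk contDiff_id)

/-- The identity plus a contraction is a homeomorphism. Its derivative at each point is the identity
plus an operator of norm less than one, hence injective and so invertible in finite dimension, which
makes the inverse smooth. -/
theorem exists_homeomorph_add {u : Plane → Plane} (hu : ContDiff ℝ ∞ u) {K : NNReal} (hK : K < 1)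
    (hl : LipschitzWith K u) : ∃ h : Plane ≃ₜ Plane, (∀ x, h x = x + u x) ∧
      ContDiff ℝ ∞ h.symm := by
  have ha : ApproximatesLinearOn (fun x => x + u x)
      ((ContinuousLinearEquiv.refl ℝ Plane : Plane →L[ℝ] Plane)) univ K := by
    rw [ApproximatesLinearOn.approximatesLinearOn_iff_lipschitzOnWith]
    have : (fun x => x + u x) - ⇑((ContinuousLinearEquiv.refl ℝ Plane : Plane →L[ℝ] Plane)) = u := by
      ext x <;> simp
    rw [this]
    exact hl.lipschitzOnWith
  have hc : Subsingleton Plane ∨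
      K < ‖((ContinuousLinearEquiv.refl ℝ Plane).symm : Plane →L[ℝ] Plane)‖₊⁻¹ := by
    right
    have : ‖((ContinuousLinearEquiv.refl ℝ Plane).symm : Plane →L[ℝ] Plane)‖₊ = 1 := by
      have := ContinuousLinearMap.norm_id (𝕜 := ℝ) (E := Plane)
      exact NNReal.eq this
    rw [this]; simpa using hK
  let h : Plane ≃ₜ Plane := ha.toHomeomorph _ hc
  have hh : ∀ x, h x = x + u x := fun x => rfl
  have du : Differentiable ℝ u := hu.differentiable (by simp)
  have hinj : ∀ x, Function.Injective (ContinuousLinearMap.id ℝ Plane + fderiv ℝ u x) := by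
    intro x
    rw [injective_iff_map_eq_zero]
    intro y hy
    have h1 : y = -(fderiv ℝ u x y) := by
      rw [eq_neg_iff_add_eq_zero]; simpa using hy
    have h2 : ‖y‖ ≤ K * ‖y‖ := by
      calc ‖y‖ = ‖fderiv ℝ u x y‖ := by rw [h1, norm_neg, ← h1]
        _ ≤ ‖fderiv ℝ u x‖ * ‖y‖ := ContinuousLinearMap.le_opNorm _ _
        _ ≤ K * ‖y‖ := by
          gcongr
          exact norm_fderiv_le_of_lipschitz ℝ hl
    by_contra hne
    have h3 : 0 < ‖y‖ := norm_pos_iff.2 hne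
    have h4 : (K : ℝ) < 1 := by exact_mod_cast hK
    nlinarith
  refine ⟨h, hh, ?_⟩
  refine h.contDiff_symm (f₀' := fun x => (LinearEquiv.ofInjectiveEndo
    ((ContinuousLinearMap.id ℝ Plane + fderiv ℝ u x : Plane →L[ℝ] Plane) : Plane →ₗ[ℝ] Plane)
    (hinj x)).toContinuousLinearEquiv) (fun x => ?_) ?_
  · have h1 : HasFDerivAt (fun x => x + u x) (ContinuousLinearMap.id ℝ Plane + fderiv ℝ u x) x :=
      (hasFDerivAt_id x).add (du x).hasFDerivAt
    refine HasFDerivAt.congr_fderiv h1 ?_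
    ext <;> rfl
  · exact contDiff_id.add hu

/-- The family x + θ(t) u(x), with θ the smooth transition from 0 to 1, consists of identity plus
contraction because 0 ≤ θ ≤ 1 does not increase the Lipschitz constant. -/
theorem exists_isotopy_add {u : Plane → Plane} (hu : ContDiff ℝ ∞ u) {K : NNReal} (hK : K < 1)
    (hl : LipschitzWith K u) : ∃ H : ℝ → Plane ≃ Plane, IsPlaneIsotopy H ∧
      ∀ x, H 1 x = x + u x := by
  have key : ∀ t : ℝ, ∃ h : Plane ≃ₜ Plane, (∀ x, h x = x + Real.smoothTransition t • u x) ∧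
      ContDiff ℝ ∞ h.symm := by
    intro t
    refine exists_homeomorph_add (u := fun x => Real.smoothTransition t • u x)
      (by fun_prop) hK ?_
    refine LipschitzWith.of_dist_le_mul fun x y => ?_
    rw [dist_smul₀]
    calc ‖Real.smoothTransition t‖ * dist (u x) (u y) ≤ 1 * (K * dist x y) := by
          gcongr
          · rw [Real.norm_of_nonneg (Real.smoothTransition.nonneg t)]
            exact Real.smoothTransition.le_one t
          · exact hl.dist_le_mul x y
      _ = K * dist x y := one_mul _
  choose h h1 h2 using key
  refine ⟨fun t => (h t).toEquiv, ⟨?_, ?_, h2⟩, fun x => ?_⟩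
  · ext x <;> simp [h1]
  · have : (fun p : ℝ × Plane => (h p.1).toEquiv p.2) =
        fun p => p.2 + Real.smoothTransition p.1 • u p.2 := by
      funext p; exact h1 _ _
    rw [this]
    have h3 : ContDiff ℝ ∞ Real.smoothTransition := Real.smoothTransition.contDiff
    fun_prop
  · simp [h1]

/-- There is an isotopy, supported in a ball, that ends with a given small perturbation of the
identity on the concentric ball of half the radius. -/
theorem exists_local_isotopy : ∃ η : ℝ, 0 < η ∧ ∀ (c : Plane) (ε : ℝ) (r : Plane → Plane), 0 < ε →
    ContDiff ℝ ∞ r → (∀ x ∈ Metric.ball c ε, ‖r x‖ ≤ η * ε) →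
    (∀ x ∈ Metric.ball c ε, ‖fderiv ℝ r x‖ ≤ η) →
    ∃ H : ℝ → Plane ≃ Plane, IsPlaneIsotopy H ∧ (∀ x ∉ Metric.ball c ε, H 1 x = x) ∧
      ∀ x ∈ Metric.ball c (ε / 2), H 1 x = x + r x := by
  let b : ContDiffBump (0 : Plane) := ⟨1 / 2, 1, by norm_num, by norm_num⟩
  have hb : ContDiff ℝ ∞ b := b.contDiff
  have db : Differentiable ℝ b := hb.differentiable (by simp)
  obtain ⟨C, hC⟩ := (b.hasCompactSupport.fderiv ℝ).exists_bound_of_continuous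
    (hb.continuous_fderiv (by simp))
  have hC0 : 0 ≤ C := (norm_nonneg _).trans (hC 0)
  -- With `C` a bound for the derivative of the unit bump, the cut off displacement has derivative
  -- at most η + (C / ε)(η ε) = 1/2; the radius cancels, so η does not depend on the ball.
  refine ⟨1 / (2 * (C + 1)), by positivity, fun c ε r hε hr h1 h2 => ?_⟩
  set η := 1 / (2 * (C + 1)) with hη
  have dr : Differentiable ℝ r := hr.differentiable (by simp)
  have hmem : ∀ x, ε⁻¹ • (x - c) ∈ Metric.ball (0 : Plane) 1 ↔ x ∈ Metric.ball c ε := by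
    intro x
    rw [mem_ball_zero_iff, norm_smul, mem_ball_iff_norm, norm_inv, Real.norm_of_nonneg hε.le,
      inv_mul_lt_iff₀ hε, mul_one]
  have hzero : ∀ x ∉ Metric.ball c ε, b (ε⁻¹ • (x - c)) = 0 := by
    intro x hx
    rw [← hmem] at hx
    by_contra h0
    exact hx (b.support_eq ▸ h0)
  let u : Plane → Plane := fun x => b (ε⁻¹ • (x - c)) • r x
  have hu : ContDiff ℝ ∞ u := by
    have : ContDiff ℝ ∞ (fun x : Plane => ε⁻¹ • (x - c)) := by fun_prop
    exact (hb.comp this).smul hr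
  have hder : ∀ x, HasFDerivAt u (b (ε⁻¹ • (x - c)) • fderiv ℝ r x +
      ((fderiv ℝ b (ε⁻¹ • (x - c))).comp (ε⁻¹ • ContinuousLinearMap.id ℝ Plane)).smulRight (r x))
      x := by
    intro x
    have h3 : HasFDerivAt (fun x : Plane => ε⁻¹ • (x - c)) (ε⁻¹ • ContinuousLinearMap.id ℝ Plane) x :=
      ((hasFDerivAt_id x).sub_const c).const_smul ε⁻¹
    have h4 := (db (ε⁻¹ • (x - c))).hasFDerivAt.comp x h3
    exact h4.smul (dr x).hasFDerivAt
  have hbound : ∀ x, ‖fderiv ℝ u x‖ ≤ 1 / 2 := by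
    intro x
    rw [(hder x).fderiv]
    by_cases hx : x ∈ Metric.ball c ε
    · have e1 : ‖b (ε⁻¹ • (x - c)) • fderiv ℝ r x‖ ≤ 1 * η := by
        rw [norm_smul]
        gcongr
        · rw [Real.norm_of_nonneg b.nonneg]; exact b.le_one
        · exact h2 x hx
      have e2 : ‖((fderiv ℝ b (ε⁻¹ • (x - c))).comp
          (ε⁻¹ • ContinuousLinearMap.id ℝ Plane)).smulRight (r x)‖ ≤ (C * ε⁻¹) * (η * ε) := by
        rw [ContinuousLinearMap.norm_smulRight_apply]
        gcongr
        · refine (ContinuousLinearMap.opNorm_comp_le _ _).trans ?_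
          gcongr
          · exact hC _
          · rw [norm_smul, norm_inv, Real.norm_of_nonneg hε.le, ContinuousLinearMap.norm_id, mul_one]
        · exact h1 x hx
      calc _ ≤ 1 * η + (C * ε⁻¹) * (η * ε) := (norm_add_le _ _).trans (add_le_add e1 e2)
        _ = 1 / 2 := by rw [hη]; field_simp; ring
    · have e0 := hzero x hx
      have e1 : fderiv ℝ b (ε⁻¹ • (x - c)) = 0 := by
        refine IsLocalMin.fderiv_eq_zero (Eventually.of_forall fun y => ?_)
        rw [e0]; exact b.nonneg
      rw [e0, e1]; simp
  have hlip : LipschitzWith (1 / 2) u := by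
    refine lipschitzWith_of_nnnorm_fderiv_le (𝕜 := ℝ) (hu.differentiable (by simp)) fun x => ?_
    rw [← NNReal.coe_le_coe]
    simpa using hbound x
  obtain ⟨H, hH, hH1⟩ := exists_isotopy_add hu (K := 1 / 2) (by
    rw [← NNReal.coe_lt_coe]; norm_num) hlip
  refine ⟨H, hH, fun x hx => ?_, fun x hx => ?_⟩
  · rw [hH1]; simp [u, hzero x hx]
  · rw [hH1]
    have : b (ε⁻¹ • (x - c)) = 1 := by
      refine b.one_of_mem_closedBall ?_
      rw [mem_closedBall_zero_iff, norm_smul, norm_inv, Real.norm_of_nonneg hε.le,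
        inv_mul_le_iff₀ hε]
      have := (mem_ball_iff_norm.1 hx).le
      change _ ≤ ε * (1 / 2)
      linarith
    simp [u, this]

/-- A point with two vectors can be moved to another one by an isotopy that stands still near `K`. -/
def FrameMove (K : Set Plane) (x y : Plane × Plane × Plane) : Prop :=
  ∃ H : ℝ → Plane ≃ Plane, IsPlaneIsotopy H ∧ (∀ k ∈ K, ∀ᶠ z in 𝓝 k, H 1 z = z) ∧
    H 1 x.1 = y.1 ∧ fderiv ℝ (H 1) x.1 x.2.1 = y.2.1 ∧ fderiv ℝ (H 1) x.1 x.2.2 = y.2.2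

/-! ### Transport of framed points by isotopies -/

theorem FrameMove.trans {K : Set Plane} {x y z : Plane × Plane × Plane} (h : FrameMove K x y)
    (h' : FrameMove K y z) : FrameMove K x z := by
  obtain ⟨H, hH, h1, h2, h3, h4⟩ := h
  obtain ⟨G, hG, g1, g2, g3, g4⟩ := h'
  have d : ∀ {F : ℝ → Plane ≃ Plane} (_ : IsPlaneIsotopy F) (p : Plane),
      DifferentiableAt ℝ (F 1) p := fun hF p => ((hF.contDiff 1).differentiable (by simp)) p
  have hd : fderiv ℝ ((H 1).trans (G 1)) x.1 = (fderiv ℝ (G 1) y.1).comp (fderiv ℝ (H 1) x.1) := by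
    rw [← h2]
    exact fderiv_comp x.1 (d hG _) (d hH _)
  refine ⟨_, hH.trans hG, fun k hk => ?_, by simp [h2, g2], ?_, ?_⟩
  · filter_upwards [h1 k hk, g1 k hk] with w hw1 hw2
    simp [hw1, hw2]
  · simp only [hd, ContinuousLinearMap.comp_apply, h3, g3]
  · simp only [hd, ContinuousLinearMap.comp_apply, h4, g4]

/-- The linear form `w ↦ planeDet w v`. -/
noncomputable def planeDetForm (v : Plane) : Plane →L[ℝ] ℝ :=
  v.2 • ContinuousLinearMap.fst ℝ ℝ ℝ - v.1 • ContinuousLinearMap.snd ℝ ℝ ℝ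

theorem planeDetForm_apply (v w : Plane) : planeDetForm v w = planeDet w v := by
  simp [planeDetForm, planeDet]; ring

theorem continuous_planeDet : Continuous fun x : Plane × Plane => planeDet x.1 x.2 := by
  unfold planeDet; fun_prop

/-- The affine map between two nearby frames is close to the identity, so it is the end of an
isotopy supported in a small ball away from `K`. The nearness is required of the pair, so that
transport is available in both directions. -/
theorem eventually_frameMove {K : Set Plane} (hK : K.Finite) {x : Plane × Plane × Plane}
    (hx : x.1 ∉ K) (hd : planeDet x.2.1 x.2.2 < 0) :
    ∀ᶠ p : (Plane × Plane × Plane) × (Plane × Plane × Plane) in 𝓝 (x, x),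
      FrameMove K p.1 p.2 := by
  obtain ⟨η, hη, key⟩ := exists_local_isotopy
  obtain ⟨ε, hε, hεK⟩ : ∃ ε > 0, Metric.closedBall x.1 ε ⊆ Kᶜ :=
    Metric.nhds_basis_closedBall.mem_iff.1 (hK.isClosed.isOpen_compl.mem_nhds hx)
  -- Cramer's rule: the linear map that sends each vector of the first frame to its difference from
  -- the second frame, so that the identity plus `M p` carries frame to frame.
  let M : (Plane × Plane × Plane) × (Plane × Plane × Plane) → Plane →L[ℝ] Plane := fun p =>
    (planeDet p.1.2.1 p.1.2.2)⁻¹ • ((planeDetForm p.1.2.2).smulRight (p.2.2.1 - p.1.2.1)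
      - (planeDetForm p.1.2.1).smulRight (p.2.2.2 - p.1.2.2))
  have hM0 : M (x, x) = 0 := by simp [M]
  have cdet : Continuous fun p : (Plane × Plane × Plane) × (Plane × Plane × Plane) =>
      planeDet p.1.2.1 p.1.2.2 := by unfold planeDet; fun_prop
  have cform : Continuous planeDetForm := by unfold planeDetForm; fun_prop
  have hMc : ContinuousAt M (x, x) := by
    refine (cdet.continuousAt.inv₀ hd.ne).smul (Continuous.continuousAt ?_)
    have c1 : Continuous fun p : (Plane × Plane × Plane) × (Plane × Plane × Plane) =>
      planeDetForm p.1.2.2 := cform.comp (by fun_prop)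
    have c2 : Continuous fun p : (Plane × Plane × Plane) × (Plane × Plane × Plane) =>
      planeDetForm p.1.2.1 := cform.comp (by fun_prop)
    have sm := (isBoundedBilinearMap_smulRight (𝕜 := ℝ) (E := Plane) (F := Plane)).continuous
    exact (sm.comp (c1.prodMk (by fun_prop :
        Continuous fun p : (Plane × Plane × Plane) × (Plane × Plane × Plane) =>
          p.2.2.1 - p.1.2.1))).sub
      (sm.comp (c2.prodMk (by fun_prop :
        Continuous fun p : (Plane × Plane × Plane) × (Plane × Plane × Plane) =>
          p.2.2.2 - p.1.2.2)))
  have e1 : ∀ᶠ p in 𝓝 (x, x), ‖M p‖ < η / 4 := by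
    refine hMc.norm.eventually_lt continuousAt_const ?_
    rw [hM0]; simpa using hη
  have e2 : ∀ᶠ p : (Plane × Plane × Plane) × (Plane × Plane × Plane) in 𝓝 (x, x),
      ‖p.2.1 - p.1.1‖ < η * ε / 2 := by
    refine ContinuousAt.eventually_lt (by fun_prop) continuousAt_const ?_
    simp; positivity
  have e3 : ∀ᶠ p : (Plane × Plane × Plane) × (Plane × Plane × Plane) in 𝓝 (x, x),
      ‖p.1.1 - x.1‖ < ε / 2 := by
    refine ContinuousAt.eventually_lt (by fun_prop) continuousAt_const ?_
    simp; positivity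
  have e4 : ∀ᶠ p : (Plane × Plane × Plane) × (Plane × Plane × Plane) in 𝓝 (x, x),
      planeDet p.1.2.1 p.1.2.2 ≠ 0 := cdet.continuousAt.eventually_ne hd.ne
  filter_upwards [e1, e2, e3, e4] with p h1 h2 h3 h4
  let r : Plane → Plane := fun z => (p.2.1 - p.1.1) + M p (z - p.1.1)
  have hr : ContDiff ℝ ∞ r := by fun_prop
  have hder : ∀ z, HasFDerivAt r (M p) z := by
    intro z
    have := ((M p).hasFDerivAt (x := z - p.1.1)).comp z ((hasFDerivAt_id z).sub_const p.1.1)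
    exact (this.const_add (p.2.1 - p.1.1))
  obtain ⟨H, hH, hH1, hH2⟩ := key x.1 ε r hε hr (fun z hz => by
      have hz' := mem_ball_iff_norm.1 hz
      have a1 : ‖z - p.1.1‖ ≤ 2 * ε := by
        calc ‖z - p.1.1‖ = ‖(z - x.1) - (p.1.1 - x.1)‖ := by congr 1; abel
          _ ≤ ‖z - x.1‖ + ‖p.1.1 - x.1‖ := norm_sub_le _ _
          _ ≤ 2 * ε := by linarith
      calc ‖r z‖ ≤ ‖p.2.1 - p.1.1‖ + ‖M p (z - p.1.1)‖ := norm_add_le _ _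
        _ ≤ η * ε / 2 + η / 4 * (2 * ε) := by
          gcongr
          exact ((M p).le_opNorm _).trans (by gcongr)
        _ = η * ε := by ring)
    (fun z _ => by rw [(hder z).fderiv]; linarith)
  have hp : p.1.1 ∈ Metric.ball x.1 (ε / 2) := mem_ball_iff_norm.2 h3
  have hfd : fderiv ℝ (H 1) p.1.1 = ContinuousLinearMap.id ℝ Plane + M p := by
    have : HasFDerivAt (fun z => z + r z) (ContinuousLinearMap.id ℝ Plane + M p) p.1.1 :=
      (hasFDerivAt_id _).add (hder _)
    refine (this.congr_of_eventuallyEq ?_).fderiv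
    filter_upwards [Metric.isOpen_ball.mem_nhds hp] with z hz using hH2 z hz
  refine ⟨H, hH, fun k hk => ?_, ?_, ?_, ?_⟩
  · have : k ∉ Metric.closedBall x.1 ε := fun h => hεK h hk
    filter_upwards [Metric.isClosed_closedBall.isOpen_compl.mem_nhds this] with z hz
    exact hH1 z fun h => hz (Metric.ball_subset_closedBall h)
  · rw [hH2 _ hp]; simp [r]
  · rw [hfd]
    have z1 : planeDet p.1.2.1 p.1.2.1 = 0 := by unfold planeDet; ring
    simp [M, planeDetForm_apply, z1, smul_smul, h4]
  · rw [hfd]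
    have z1 : planeDet p.1.2.2 p.1.2.2 = 0 := by unfold planeDet; ring
    have z2 : planeDet p.1.2.2 p.1.2.1 = - planeDet p.1.2.1 p.1.2.2 := by unfold planeDet; ring
    simp [M, planeDetForm_apply, z1, z2, smul_smul, h4]

/-- With plane vectors as complex numbers, a frame is (u, u w) with u ≠ 0, and it is negative
exactly if Im w < 0. Writing u as an exponential exhibits the set as a continuous image of the
product of ℂ with a half plane. -/
theorem isPreconnected_negative_frames :
    IsPreconnected {q : Plane × Plane | planeDet q.1 q.2 < 0} := by
  let f : ℂ × ℂ → Plane × Plane := fun z =>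
    (((Complex.exp z.1).re, (Complex.exp z.1).im),
      ((Complex.exp z.1 * z.2).re, (Complex.exp z.1 * z.2).im))
  have hf : Continuous f := by fun_prop
  have hS : IsPreconnected ((univ : Set ℂ) ×ˢ {w : ℂ | w.im < 0}) :=
    isPreconnected_univ.prod (convex_halfSpace_im_lt 0).isPreconnected
  have : {q : Plane × Plane | planeDet q.1 q.2 < 0}
      = f '' ((univ : Set ℂ) ×ˢ {w : ℂ | w.im < 0}) := by
    have hdet : ∀ u w : ℂ, planeDet (u.re, u.im) ((u * w).re, (u * w).im)
        = Complex.normSq u * w.im := by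
      intro u w
      simp [planeDet, Complex.normSq_apply]; ring
    ext ⟨u, v⟩
    simp only [mem_ofPred_eq, mem_image, mem_prod, mem_univ, true_and]
    constructor
    · intro h
      have hu : (⟨u.1, u.2⟩ : ℂ) ≠ 0 := by
        intro h0
        have h1 := congrArg Complex.re h0
        have h2 := congrArg Complex.im h0
        simp at h1 h2
        simp [planeDet, h1, h2] at h
      have h3 : (⟨u.1, u.2⟩ : ℂ) * (⟨v.1, v.2⟩ / ⟨u.1, u.2⟩) = ⟨v.1, v.2⟩ := mul_div_cancel₀ _ hu
      refine ⟨(Complex.log ⟨u.1, u.2⟩, ⟨v.1, v.2⟩ / ⟨u.1, u.2⟩), ?_, ?_⟩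
      · have h4 := hdet ⟨u.1, u.2⟩ (⟨v.1, v.2⟩ / ⟨u.1, u.2⟩)
        rw [h3] at h4
        have h5 : 0 < Complex.normSq ⟨u.1, u.2⟩ := Complex.normSq_pos.2 hu
        have h6 : planeDet (u.1, u.2) (v.1, v.2) < 0 := h
        rw [h4] at h6
        exact (pos_iff_neg_of_mul_neg h6).1 h5
      · simp only [f]
        rw [Complex.exp_log hu, h3]
    · rintro ⟨⟨z, w⟩, hw, h⟩
      obtain ⟨rfl, rfl⟩ := Prod.ext_iff.1 h
      simp only [f]
      rw [hdet]
      exact mul_neg_of_pos_of_neg (Complex.normSq_pos.2 (Complex.exp_ne_zero z)) hw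
  rw [this]
  exact hS.image f hf.continuousOn

/-- Any two negative frames at points off a finite set are related by an isotopy that stands still
near that set. -/
theorem frameMove {K : Set Plane} (hK : K.Finite) {x y : Plane × Plane × Plane} (hx : x.1 ∉ K)
    (hxd : planeDet x.2.1 x.2.2 < 0) (hy : y.1 ∉ K) (hyd : planeDet y.2.1 y.2.2 < 0) :
    FrameMove K x y := by
  have hpc : IsPreconnected (Kᶜ ×ˢ {q : Plane × Plane | planeDet q.1 q.2 < 0}) := by
    refine IsPreconnected.prod ?_ isPreconnected_negative_frames
    refine (hK.countable.isPathConnected_compl_of_one_lt_rank ?_).isConnected.isPreconnected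
    rw [← Module.finrank_eq_rank]
    exact_mod_cast (by simp : 1 < Module.finrank ℝ Plane)
  -- A transitive relation that holds in both directions between each point and its neighbours holds
  -- throughout a preconnected set.
  refine hpc.induction₂' (FrameMove K) (fun z hz => ?_) (fun _ _ _ _ _ _ h h' => h.trans h')
    (x := x) (y := y) ⟨hx, hxd⟩ ⟨hy, hyd⟩
  have h := eventually_frameMove hK hz.1 hz.2
  have t1 : Tendsto (fun y => (z, y)) (𝓝 z) (𝓝 (z, z)) :=
    (Continuous.prodMk_right z).continuousAt
  have t2 : Tendsto (fun y => (y, z)) (𝓝 z) (𝓝 (z, z)) :=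
    (Continuous.prodMk_left z).continuousAt
  exact ((t1.eventually h).and (t2.eventually h)).filter_mono nhdsWithin_le_nhds

end VirtualDoodle

namespace VirtualDoodle
open Set Filter Topology

/-! ### Gauss codes of virtual diagrams -/

/-- The list of the parameters of real crossings on one turn from `t₀`. -/
def CrossingTimes (D : VirtualDiagram) (t₀ : ℝ) (ts : List ℝ) : Prop :=
  ts.Pairwise (· < ·) ∧ ∀ t, t ∈ ts ↔ (t₀ < t ∧ t < t₀ + 1) ∧ D.curve t ∈ D.real

theorem samePoint_add_int (t : ℝ) (k : ℤ) : SamePoint t (t + k) := ⟨k, rfl⟩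

theorem VirtualDiagram.curve_add_int (D : VirtualDiagram) (t : ℝ) (k : ℤ) :
    D.curve (t + k) = D.curve t := D.curve_eq (samePoint_add_int t k)

theorem VirtualDiagram.isLeftBranch_congr_samePoint (D : VirtualDiagram) {s t : ℝ}
    (h : SamePoint s t) : D.IsLeftBranch s ↔ D.IsLeftBranch t := by
  have key : ∀ {s t : ℝ}, SamePoint s t → D.IsLeftBranch s → D.IsLeftBranch t := by
    rintro s t h ⟨r, h1, h2, h3⟩
    exact ⟨r, fun h' => h1 (h.trans h'), by rw [h2, D.curve_eq h], by rwa [D.deriv_eq h]⟩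
  exact ⟨key h, key h.symm⟩

theorem VirtualDiagram.label_congr {n : ℕ} {D D' : VirtualDiagram} {f f' : Plane → Fin n}
    {t t' : ℝ} (h : D.IsLeftBranch t ↔ D'.IsLeftBranch t')
    (hf : f (D.curve t) = f' (D'.curve t')) : D.label f t = D'.label f' t' := by
  unfold VirtualDiagram.label
  by_cases h' : D'.IsLeftBranch t'
  · rw [if_pos (h.2 h'), if_pos h', hf]
  · rw [if_neg (mt h.1 h'), if_neg h', hf]

theorem VirtualDiagram.label_samePoint {n : ℕ} (D : VirtualDiagram) (f : Plane → Fin n) {s t : ℝ}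
    (h : SamePoint s t) : D.label f s = D.label f t :=
  label_congr (D.isLeftBranch_congr_samePoint h) (by rw [D.curve_eq h])

theorem VirtualDiagram.label_comp {n : ℕ} (D : VirtualDiagram) {f f' : Plane → Fin n}
    (π : Equiv.Perm (Fin n)) {t : ℝ} (h : f' (D.curve t) = π (f (D.curve t))) :
    D.label f' t = (D.label f t).relabel π := by
  unfold VirtualDiagram.label
  split_ifs <;> simp [h, letterL, letterR, Letter.relabel]

namespace CrossingTimes
variable {D : VirtualDiagram} {t₀ : ℝ} {ts : List ℝ}

theorem unique {ts' : List ℝ} (h : CrossingTimes D t₀ ts) (h' : CrossingTimes D t₀ ts') :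
    ts = ts' :=
  h.1.eq_of_mem_iff h'.1 fun t => (h.2 t).trans (h'.2 t).symm

theorem add_int (h : CrossingTimes D t₀ ts) (k : ℤ) :
    CrossingTimes D (t₀ + k) (ts.map (· + (k : ℝ))) := by
  refine ⟨List.pairwise_map.2 (h.1.imp fun hab => by simpa using hab), fun t => ?_⟩
  simp only [List.mem_map]
  constructor
  · rintro ⟨s, hs, rfl⟩
    obtain ⟨⟨h1, h2⟩, h3⟩ := (h.2 s).1 hs
    exact ⟨⟨by linarith, by linarith⟩, by rwa [D.curve_add_int]⟩
  · rintro ⟨⟨h1, h2⟩, h3⟩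
    refine ⟨t - k, (h.2 _).2 ⟨⟨by linarith, by linarith⟩, ?_⟩, by simp⟩
    have := D.curve_add_int (t - k) k
    rw [sub_add_cancel] at this
    rwa [← this]

/-- The crossings of `A`, met before the new base point, are met again one turn later and so come
last. -/
theorem change_base {A B : List ℝ} (h : CrossingTimes D t₀ (A ++ B)) (h0 : D.curve t₀ ∉ D.real)
    {t₁ : ℝ} (h1 : t₀ ≤ t₁) (h2 : t₁ < t₀ + 1) (hA : ∀ a ∈ A, a < t₁) (hB : ∀ b ∈ B, t₁ < b) :
    CrossingTimes D t₁ (B ++ A.map (· + 1)) := by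
  obtain ⟨hp, hm⟩ := h
  rw [List.pairwise_append] at hp
  have hper : ∀ t, D.curve (t + 1) = D.curve t := D.periodic
  refine ⟨List.pairwise_append.2 ⟨hp.2.1, List.pairwise_map.2 (hp.1.imp fun hab => by simpa using hab),
    fun b hb a ha => ?_⟩, fun t => ?_⟩
  · obtain ⟨a', ha', rfl⟩ := List.mem_map.1 ha
    have k1 := ((hm b).1 (List.mem_append_right _ hb)).1
    have k2 := ((hm a').1 (List.mem_append_left _ ha')).1
    linarith
  · simp only [List.mem_append, List.mem_map]
    constructor
    · rintro (hb | ⟨a, ha, rfl⟩)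
      · obtain ⟨⟨k1, k2⟩, k3⟩ := (hm t).1 (List.mem_append_right _ hb)
        exact ⟨⟨hB t hb, by linarith⟩, k3⟩
      · obtain ⟨⟨k1, k2⟩, k3⟩ := (hm a).1 (List.mem_append_left _ ha)
        exact ⟨⟨by linarith, by linarith [hA a ha]⟩, by rwa [hper]⟩
    · rintro ⟨⟨k1, k2⟩, k3⟩
      rcases lt_trichotomy t (t₀ + 1) with h | h | h
      · rcases List.mem_append.1 ((hm t).2 ⟨⟨by linarith, h⟩, k3⟩) with h' | h'
        · linarith [hA t h']
        · exact .inl h'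
      · rw [h, hper] at k3
        exact absurd k3 h0
      · right
        have k4 : D.curve (t - 1) ∈ D.real := by
          rw [← hper, sub_add_cancel]; exact k3
        refine ⟨t - 1, ?_, by ring⟩
        rcases List.mem_append.1 ((hm (t - 1)).2 ⟨⟨by linarith, by linarith⟩, k4⟩) with h' | h'
        · exact h'
        · linarith [hB _ h']

end CrossingTimes

/-- The Gauss codes of a virtual diagram. -/
def VirtualDiagram.HasGaussCode {n : ℕ} (D : VirtualDiagram) (w : GaussCode n) : Prop :=
  ∃ (f : Plane → Fin n) (t₀ : ℝ) (ts : List ℝ), Set.BijOn f D.real Set.univ ∧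
    D.curve t₀ ∉ D.real ∧ CrossingTimes D t₀ ts ∧ w.1 = ts.map (D.label f)

theorem isGaussCodeOf_iff {n : ℕ} {D : Diagram n} {w : GaussCode n} :
    IsGaussCodeOf D w ↔ D.1.HasGaussCode w := by
  constructor
  · rintro ⟨f, t₀, hf, h0, ts, h1, h2, h3⟩
    exact ⟨f, t₀, ts, hf, h0, ⟨h1, h2⟩, h3⟩
  · rintro ⟨f, t₀, ts, hf, h0, ⟨h1, h2⟩, h3⟩
    exact ⟨f, t₀, hf, h0, ts, h1, h2, h3⟩

theorem exists_perm_of_bijOn {n : ℕ} {S : Set Plane} {f f' : Plane → Fin n}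
    (hf : BijOn f S univ) (hf' : BijOn f' S univ) :
    ∃ π : Equiv.Perm (Fin n), ∀ c ∈ S, f' c = π (f c) := by
  have hg : ∀ j, ∃ c ∈ S, f c = j := fun j => hf.surjOn (mem_univ j)
  choose g hg1 hg2 using hg
  have hinj : Function.Injective (f' ∘ g) := fun i j h => by
    have := hf'.injOn (hg1 i) (hg1 j) h
    rw [← hg2 i, ← hg2 j, this]
  refine ⟨Equiv.ofBijective _ (Finite.injective_iff_bijective.1 hinj), fun c hc => ?_⟩
  change f' c = f' (g (f c))
  rw [hf.injOn (hg1 (f c)) hc (hg2 (f c))]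

/-- Two labelings differ by a permutation, and moving the base point rotates the list of crossings.
-/
theorem VirtualDiagram.HasGaussCode.codeEquiv {n : ℕ} {D : VirtualDiagram} {w w' : GaussCode n}
    (h : D.HasGaussCode w) (h' : D.HasGaussCode w') : CodeEquiv w w' := by
  obtain ⟨f, t₀, ts, hf, h0, hts, hw⟩ := h
  obtain ⟨f', t₀', ts', hf', h0', hts', hw'⟩ := h'
  obtain ⟨π, hπ⟩ := exists_perm_of_bijOn hf hf'
  -- Whole turns do not affect the code, so the second base point may be taken in the turn that
  -- starts at the first.
  set k := toIcoDiv one_pos t₀ t₀' with hk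
  set t₁ := t₀' + ((-k : ℤ) : ℝ) with ht₁
  have ht₁' : t₁ ∈ Ico t₀ (t₀ + 1) := by
    have := toIcoMod_mem_Ico one_pos t₀ t₀'
    rw [toIcoMod] at this
    simpa [ht₁, ← hk, sub_eq_add_neg] using this
  have h1 : CrossingTimes D t₁ (ts'.map (· + ((-k : ℤ) : ℝ))) := hts'.add_int (-k)
  have h01 : D.curve t₁ ∉ D.real := by rwa [ht₁, D.curve_add_int]
  set A := ts.filter (· < t₁) with hA
  set B := ts.filter (t₁ < ·) with hB
  have hAB : ts = A ++ B := by
    refine hts.1.eq_of_mem_iff (List.pairwise_append.2 ⟨hts.1.filter _, hts.1.filter _,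
      fun a ha b hb => ?_⟩) fun t => ?_
    · have e1 : a < t₁ := by simpa using (List.mem_filter.1 ha).2
      have e2 : t₁ < b := by simpa using (List.mem_filter.1 hb).2
      exact e1.trans e2
    · simp only [hA, hB, List.mem_append, List.mem_filter, decide_eq_true_eq, ← and_or_left]
      refine ⟨fun ht => ⟨ht, lt_or_gt_of_ne ?_⟩, fun ht => ht.1⟩
      rintro rfl
      exact h01 ((hts.2 _).1 ht).2
  have h2 : CrossingTimes D t₁ (B ++ A.map (· + 1)) := by
    refine CrossingTimes.change_base (hAB ▸ hts) h0 ht₁'.1 ht₁'.2 (fun a ha => ?_) fun b hb => ?_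
    · simpa using (List.mem_filter.1 ha).2
    · simpa using (List.mem_filter.1 hb).2
  have h3 := h1.unique h2
  have hl1 : ts'.map (D.label f') = (ts'.map (· + ((-k : ℤ) : ℝ))).map (D.label f') := by
    rw [List.map_map]
    exact List.map_congr_left fun t _ => D.label_samePoint f' (samePoint_add_int t _)
  have hl2 : (A.map (· + 1)).map (D.label f') = A.map (D.label f') := by
    rw [List.map_map]
    exact List.map_congr_left fun t _ => D.label_samePoint f' (SamePoint.symm ⟨1, by simp⟩)
  have hl3 : ts.map (D.label f') = w.1.map (Letter.relabel π) := by
    rw [hw, List.map_map]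
    exact List.map_congr_left fun t ht => D.label_comp π (hπ _ ((hts.2 t).1 ht).2)
  refine ⟨A.length, π, Subtype.ext ?_⟩
  rw [hw', hl1, h3, List.map_append, hl2]
  simp only [shift, relabel]
  rw [← hl3, hAB, List.map_append]
  have := List.rotate_append_length_eq (A.map (D.label f')) (B.map (D.label f'))
  rw [List.length_map] at this
  exact this.symm

/-- A renumbering is absorbed in the labeling, and a shift by one letter in moving the base point
past one crossing. -/
theorem VirtualDiagram.HasGaussCode.of_codeEquiv {n : ℕ} {D : VirtualDiagram} {w w' : GaussCode n}
    (h : D.HasGaussCode w) (h' : CodeEquiv w w') : D.HasGaussCode w' := by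
  obtain ⟨m, π, rfl⟩ := h'
  have key : ∀ v : GaussCode n, D.HasGaussCode v → D.HasGaussCode (shift 1 v) := by
    rintro v ⟨f, t₀, ts, hf, h0, hts, hv⟩
    rcases ts with _ | ⟨t, rest⟩
    · refine ⟨f, t₀, [], hf, h0, hts, ?_⟩
      simp [shift, hv]
    have hlt := ((hts.2 t).1 (by simp)).1
    -- The new base lies halfway between the first crossing and the next one, or the end of the turn
    -- if there is no other.
    obtain ⟨t₁, h1, h2, h3⟩ : ∃ t₁, t < t₁ ∧ t₁ < t₀ + 1 ∧ ∀ b ∈ rest, t₁ < b := by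
      have hp := List.pairwise_cons.1 hts.1
      rcases rest with _ | ⟨b, r⟩
      · exact ⟨(t + (t₀ + 1)) / 2, by linarith, by linarith, by simp⟩
      · have hb := hp.1 b (by simp)
        have hb' := ((hts.2 b).1 (by simp)).1
        refine ⟨(t + b) / 2, by linarith, by linarith, fun c hc => ?_⟩
        rcases List.mem_cons.1 hc with rfl | hc
        · linarith
        · have := (List.pairwise_cons.1 hp.2).1 c hc
          linarith
    have h4 : D.curve t₁ ∉ D.real := by
      intro hr
      rcases List.mem_cons.1 ((hts.2 t₁).2 ⟨⟨by linarith, h2⟩, hr⟩) with h | h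
      · linarith
      · exact lt_irrefl _ (h3 _ h)
    have h5 : CrossingTimes D t₁ (rest ++ [t].map (· + 1)) :=
      CrossingTimes.change_base (A := [t]) hts h0 (by linarith) h2 (by simpa using h1) h3
    refine ⟨f, t₁, _, hf, h4, h5, ?_⟩
    have : D.label f (t + 1) = D.label f t := D.label_samePoint f (SamePoint.symm ⟨1, by simp⟩)
    simp [shift, hv, this]
  induction m with
  | zero =>
    rw [shift_zero]
    obtain ⟨f, t₀, ts, hf, h0, hts, hw⟩ := h
    refine ⟨π ∘ f, t₀, ts, (Equiv.bijective π).bijOn_univ.comp hf, h0, hts, ?_⟩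
    simp only [relabel, hw, List.map_map]
    exact List.map_congr_left fun t _ => (D.label_comp π rfl).symm
  | succ m ih =>
    rw [← shift_shift]
    exact key _ ih

/-- Reversal negates both velocities, which leaves their determinant unchanged; so labels persist
and only their order is reversed. -/
theorem VirtualDiagram.isLeftBranch_rev (D : VirtualDiagram) (t : ℝ) :
    D.rev.IsLeftBranch t ↔ D.IsLeftBranch (-t) := by
  have hn : ∀ s t : ℝ, SamePoint s t ↔ SamePoint (-s) (-t) := fun s t =>
    ⟨fun ⟨k, hk⟩ => ⟨-k, by push_cast; linarith⟩, fun ⟨k, hk⟩ => ⟨-k, by push_cast; linarith⟩⟩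
  have hd : ∀ s, deriv D.rev.curve s = -deriv D.curve (-s) := fun s => deriv_comp_neg _ _
  unfold VirtualDiagram.IsLeftBranch
  constructor
  · rintro ⟨s, h1, h2, h3⟩
    refine ⟨-s, fun h => h1 ((hn _ _).2 h), h2, ?_⟩
    rw [hd, hd] at h3
    simpa [planeDet] using h3
  · rintro ⟨s, h1, h2, h3⟩
    refine ⟨-s, fun h => h1 ?_, ?_, ?_⟩
    · have := (hn _ _).1 h; rwa [neg_neg] at this
    · change D.curve (- -s) = D.curve (-t); rwa [neg_neg]
    · rw [hd, hd, neg_neg]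
      simpa [planeDet] using h3

theorem VirtualDiagram.HasGaussCode.rev {n : ℕ} {D : VirtualDiagram} {w : GaussCode n}
    (h : D.HasGaussCode w) : D.rev.HasGaussCode (VirtualDoodle.rev w) := by
  obtain ⟨f, t₀, ts, hf, h0, hts, hw⟩ := h
  have hc : ∀ t, D.rev.curve t = D.curve (-t) := fun t => rfl
  refine ⟨f, -t₀ - 1, (ts.map (- ·)).reverse, hf, ?_, ⟨?_, fun t => ?_⟩, ?_⟩
  · rw [hc]
    have : D.curve (-(-t₀ - 1)) = D.curve t₀ := by
      have := D.periodic t₀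
      rw [← this]; congr 1; ring
    rw [this]; exact h0
  · rw [List.pairwise_reverse]
    exact List.pairwise_map.2 (hts.1.imp fun hab => by simpa using hab)
  · rw [List.mem_reverse, List.mem_map, hc]
    constructor
    · rintro ⟨s, hs, rfl⟩
      obtain ⟨⟨h1, h2⟩, h3⟩ := (hts.2 s).1 hs
      exact ⟨⟨by linarith, by linarith⟩, by rwa [neg_neg]⟩
    · rintro ⟨⟨h1, h2⟩, h3⟩
      exact ⟨-t, (hts.2 _).2 ⟨⟨by linarith, by linarith⟩, h3⟩, by simp⟩
  · simp only [VirtualDoodle.rev, hw, List.map_reverse, List.map_map]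
    congr 1
    refine List.map_congr_left fun t _ => ?_
    refine VirtualDiagram.label_congr ?_ ?_
    · rw [D.isLeftBranch_rev, neg_neg]
    · simp [hc]

/-! ### Invariance of the Gauss codes -/

theorem planeDet_map (L : Plane →L[ℝ] Plane) (u v : Plane) :
    planeDet (L u) (L v) = planeDet (L (1, 0)) (L (0, 1)) * planeDet u v := by
  have h : ∀ w : Plane, L w = w.1 • L (1, 0) + w.2 • L (0, 1) := by
    intro w
    rw [← map_smul, ← map_smul, ← map_add]
    congr 1
    ext <;> simp
  rw [h u, h v]
  simp [planeDet]; ring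

theorem jacobian_ne_zero {h : Plane ≃ Plane} (h1 : ContDiff ℝ ∞ h) (h2 : ContDiff ℝ ∞ h.symm)
    (x : Plane) : planeDet (fderiv ℝ h x (1, 0)) (fderiv ℝ h x (0, 1)) ≠ 0 := by
  have d1 : DifferentiableAt ℝ h.symm (h x) := (h2.differentiable (by simp)) _
  have d2 : DifferentiableAt ℝ h x := (h1.differentiable (by simp)) _
  have h3 := fderiv_comp x d1 d2
  have h4 : (h.symm ∘ h : Plane → Plane) = id := by funext y; simp
  rw [h4, fderiv_id] at h3
  intro h0
  have h5 := planeDet_map (fderiv ℝ h.symm (h x)) (fderiv ℝ h x (1, 0)) (fderiv ℝ h x (0, 1))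
  have h6 : ∀ v, fderiv ℝ h.symm (h x) (fderiv ℝ h x v) = v := fun v => by
    rw [← ContinuousLinearMap.comp_apply, ← h3]; rfl
  rw [h6, h6, h0] at h5
  simp [planeDet] at h5

/-- The Jacobian is continuous in time, never zero because each stage is a diffeomorphism, and equal
to 1 at time 0. -/
theorem IsPlaneIsotopy.jacobian_pos {H : ℝ → Plane ≃ Plane} (hH : IsPlaneIsotopy H) (x : Plane) :
    0 < planeDet (fderiv ℝ (H 1) x (1, 0)) (fderiv ℝ (H 1) x (0, 1)) := by
  set F : ℝ × Plane → Plane := fun p => H p.1 p.2 with hF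
  have hd : ∀ t v, fderiv ℝ (H t) x v = fderiv ℝ F (t, x) (0, v) := by
    intro t v
    have h1 : HasFDerivAt F (fderiv ℝ F (t, x)) (t, x) :=
      ((hH.2.1.differentiable (by simp)) _).hasFDerivAt
    have h2 : HasFDerivAt (fun y : Plane => (t, y)) (ContinuousLinearMap.inr ℝ ℝ Plane) x :=
      hasFDerivAt_prodMk_right t x
    have h3 := h1.comp x h2
    have h4 : (F ∘ fun y : Plane => (t, y)) = H t := rfl
    rw [h4] at h3
    rw [h3.fderiv]; rfl
  have hcF : Continuous (fderiv ℝ F) := hH.2.1.continuous_fderiv (by simp)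
  have hc : Continuous fun t => planeDet (fderiv ℝ (H t) x (1, 0)) (fderiv ℝ (H t) x (0, 1)) := by
    simp only [hd]
    have c1 : Continuous fun t : ℝ => fderiv ℝ F (t, x) := hcF.comp (by fun_prop)
    exact continuous_planeDet.comp ((c1.clm_apply continuous_const).prodMk
      (c1.clm_apply continuous_const))
  have h0 : planeDet (fderiv ℝ (H 0) x (1, 0)) (fderiv ℝ (H 0) x (0, 1)) = 1 := by
    rw [hH.1]
    have : ((Equiv.refl Plane : Plane ≃ Plane) : Plane → Plane) = id := rfl
    rw [this, fderiv_id]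
    simp [planeDet]
  by_contra hneg
  push Not at hneg
  obtain ⟨t, -, ht⟩ := intermediate_value_Icc' (zero_le_one' ℝ) hc.continuousOn
    (show (0 : ℝ) ∈ Icc _ _ from ⟨hneg, by rw [h0]; norm_num⟩)
  exact jacobian_ne_zero (hH.contDiff t) (hH.2.2 t) x ht

theorem IsReparametrization.strictMono {σ : ℝ → ℝ} (h : IsReparametrization σ) : StrictMono σ :=
  strictMono_of_deriv_pos h.2.1

theorem IsReparametrization.map_add_int {σ : ℝ → ℝ} (h : IsReparametrization σ) (t : ℝ) (k : ℤ) :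
    σ (t + k) = σ t + k := by
  have h1 : Function.Periodic (fun t => σ t - t) 1 := fun t => by
    change σ (t + 1) - (t + 1) = σ t - t
    rw [h.2.2]; ring
  have := h1.int_mul k t
  simp at this
  linarith

theorem IsReparametrization.surjective {σ : ℝ → ℝ} (h : IsReparametrization σ) :
    Function.Surjective σ := by
  intro y
  refine mem_range_of_exists_le_of_exists_ge h.1.continuous ?_ ?_
  · refine ⟨0 + ((⌊y - σ 0⌋ : ℤ) : ℝ), ?_⟩
    rw [h.map_add_int]
    linarith [Int.floor_le (y - σ 0)]
  · refine ⟨0 + ((⌈y - σ 0⌉ : ℤ) : ℝ), ?_⟩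
    rw [h.map_add_int]
    linarith [Int.le_ceil (y - σ 0)]

theorem IsReparametrization.samePoint_iff {σ : ℝ → ℝ} (h : IsReparametrization σ) {s t : ℝ} :
    SamePoint (σ s) (σ t) ↔ SamePoint s t := by
  constructor
  · rintro ⟨k, hk⟩
    refine ⟨k, h.strictMono.injective ?_⟩
    rw [hk, h.map_add_int]
  · rintro ⟨k, rfl⟩
    exact ⟨k, h.map_add_int _ _⟩

/-- The determinant of two velocities at a crossing is multiplied by the Jacobian and by two values
of the derivative of `σ`, all positive, so left branches stay left. -/
theorem Isotopic.hasGaussCode {n : ℕ} {D D' : VirtualDiagram} (h : Isotopic D D')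
    {w : GaussCode n} (hw : D.HasGaussCode w) : D'.HasGaussCode w := by
  obtain ⟨H, σ, hH, hσ, hc, hr⟩ := h
  obtain ⟨f, t₀, ts, hf, h0, hts, hw⟩ := hw
  let τ : ℝ ≃o ℝ := hσ.strictMono.orderIsoOfSurjective σ hσ.surjective
  have hτ : ∀ t, τ t = σ t := fun t => rfl
  have hτs : ∀ t, σ (τ.symm t) = t := fun t => τ.apply_symm_apply t
  have hmem : ∀ t, D'.curve t ∈ D'.real ↔ D.curve (σ t) ∈ D.real := by
    intro t
    rw [hc, hr]
    simp
  have hd : ∀ t, deriv D'.curve t =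
      deriv σ t • fderiv ℝ (H 1) (D.curve (σ t)) (deriv D.curve (σ t)) := by
    intro t
    have e : D'.curve = fun t => H 1 (D.curve (σ t)) := funext hc
    have h1 : HasFDerivAt (H 1) (fderiv ℝ (H 1) (D.curve (σ t))) (D.curve (σ t)) :=
      (((hH.contDiff 1).differentiable (by simp)) _).hasFDerivAt
    have h2 : HasDerivAt D.curve (deriv D.curve (σ t)) (σ t) :=
      ((D.smooth.differentiable (by simp)) _).hasDerivAt
    have h3 : HasDerivAt σ (deriv σ t) t := ((hσ.1.differentiable (by simp)) _).hasDerivAt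
    rw [e]
    have h4 := h1.comp_hasDerivAt t (h2.scomp t h3)
    rw [map_smul] at h4
    exact h4.deriv
  have hleft : ∀ t, D'.IsLeftBranch t ↔ D.IsLeftBranch (σ t) := by
    have key : ∀ s t, D'.curve s = D'.curve t →
        (planeDet (deriv D'.curve t) (deriv D'.curve s) < 0 ↔
          planeDet (deriv D.curve (σ t)) (deriv D.curve (σ s)) < 0) := by
      intro s t hst
      have hst' : D.curve (σ s) = D.curve (σ t) := by
        rw [hc, hc] at hst; exact (H 1).injective hst
      rw [hd, hd, hst']
      have e : ∀ (a b : ℝ) (u v : Plane), planeDet (a • u) (b • v) = (a * b) * planeDet u v := by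
        intro a b u v; simp [planeDet]; ring
      rw [e, planeDet_map, ← mul_assoc]
      have hp : 0 < deriv σ t * deriv σ s * planeDet (fderiv ℝ (H 1) (D.curve (σ t)) (1, 0))
          (fderiv ℝ (H 1) (D.curve (σ t)) (0, 1)) :=
        mul_pos (mul_pos (hσ.2.1 t) (hσ.2.1 s)) (hH.jacobian_pos _)
      exact ⟨fun h => (pos_iff_neg_of_mul_neg h).1 hp, fun h => mul_neg_of_pos_of_neg hp h⟩
    intro t
    constructor
    · rintro ⟨s, h1, h2, h3⟩
      refine ⟨σ s, fun h => h1 (hσ.samePoint_iff.1 h), ?_, (key s t h2).1 h3⟩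
      rw [hc, hc] at h2; exact (H 1).injective h2
    · rintro ⟨s', h1, h2, h3⟩
      obtain ⟨s, rfl⟩ := hσ.surjective s'
      have h4 : D'.curve s = D'.curve t := by rw [hc, hc, h2]
      exact ⟨s, fun h => h1 (hσ.samePoint_iff.2 h), h4, (key s t h4).2 h3⟩
  refine ⟨f ∘ (H 1).symm, τ.symm t₀, ts.map τ.symm, ?_, ?_, ⟨?_, fun t => ?_⟩, ?_⟩
  · rw [hr]
    refine hf.comp ⟨?_, (H 1).symm.injective.injOn, ?_⟩
    · intro c hc; simpa using hc
    · intro c hc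
      exact ⟨H 1 c, by simpa using hc, by simp⟩
  · rw [hmem, hτs]; exact h0
  · exact List.pairwise_map.2 (hts.1.imp fun hab => by simpa using hab)
  · rw [List.mem_map, hmem]
    have e1 : t = τ.symm (σ t) := (τ.symm_apply_apply t).symm
    have e2 : (∃ a ∈ ts, τ.symm a = t) ↔ σ t ∈ ts := by
      constructor
      · rintro ⟨a, ha, rfl⟩; rwa [hτs]
      · exact fun h => ⟨σ t, h, e1.symm⟩
    rw [e2, hts.2]
    have e3 : t₀ < σ t ↔ τ.symm t₀ < t := by
      rw [← hσ.strictMono.lt_iff_lt (a := τ.symm t₀), hτs]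
    have e4 : σ t < t₀ + 1 ↔ t < τ.symm t₀ + 1 := by
      rw [← hσ.strictMono.lt_iff_lt (b := τ.symm t₀ + 1), hσ.2.2, hτs]
    rw [e3, e4]
  · rw [hw, List.map_map]
    refine List.map_congr_left fun t _ => VirtualDiagram.label_congr ?_ ?_
    · rw [hleft, hτs]
    · simp [hc, hτs]

/-- The complement of the translates of the closed arc is a union of open gaps. Thus equality of
curves off an arc is equality near each of its points, which gives equality of velocities as well.
-/
theorem exists_gap_of_forall_notMem {a b : ℝ} {t : ℝ} (h : ∀ k : ℤ, t + (k : ℝ) ∉ Icc a b) :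
    ∃ m : ℤ, t ∈ Ioo (b + m) (a + m + 1) := by
  refine ⟨⌊t - a⌋, ?_, ?_⟩
  · by_contra hcon
    refine h (-⌊t - a⌋) ⟨?_, ?_⟩
    · push_cast; linarith [Int.floor_le (t - a)]
    · push_cast; linarith
  · linarith [Int.lt_floor_add_one (t - a)]

theorem forall_notMem_of_mem_gap {a b t : ℝ} {m : ℤ} (ht : t ∈ Ioo (b + m) (a + m + 1)) (k : ℤ) :
    t + (k : ℝ) ∉ Icc a b := by
  rintro ⟨h1, h2⟩
  rcases le_or_gt (-m) k with h | h
  · have : (-m : ℝ) ≤ k := by exact_mod_cast h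
    linarith [ht.1]
  · have : (k : ℝ) ≤ -m - 1 := by
      have : k ≤ -m - 1 := by omega
      exact_mod_cast this
    linarith [ht.2]

theorem DetourMove.symm {D D' : VirtualDiagram} (h : DetourMove D D') : DetourMove D' D := by
  obtain ⟨hr, a, b, hab, hb, h1, h2⟩ := h
  exact ⟨hr.symm, a, b, hab, hb, fun t ht => (h1 t ht).symm, fun t ht => (h2 t ht).symm⟩

theorem VirtualDiagram.IsLeftBranch.congr {D D' : VirtualDiagram} {P : ℝ → Prop}
    (hP : ∀ t, D.curve t ∈ D.real → P t)
    (he : ∀ t, P t → D'.curve =ᶠ[𝓝 t] D.curve) {t : ℝ} (ht : D.curve t ∈ D.real)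
    (h : D.IsLeftBranch t) : D'.IsLeftBranch t := by
  obtain ⟨s, h1, h2, h3⟩ := h
  have e1 := he t (hP t ht)
  have e2 := he s (hP s (by rwa [h2]))
  exact ⟨s, h1, by rw [e1.eq_of_nhds, e2.eq_of_nhds, h2], by rwa [e1.deriv_eq, e2.deriv_eq]⟩

theorem DetourMove.hasGaussCode {n : ℕ} {D D' : VirtualDiagram} (h : DetourMove D D')
    {w : GaussCode n} (hw : D.HasGaussCode w) : D'.HasGaussCode w := by
  obtain ⟨hr, a, b, hab, hb, h1, h2⟩ := h
  obtain ⟨f, t₀, ts, hf, h0, hts, hw⟩ := hw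
  have out : ∀ t, D.curve t ∈ D.real → ∀ k : ℤ, t + (k : ℝ) ∉ Icc a b := by
    intro t ht k hk
    exact (h1 _ hk).1 (by rwa [D.curve_add_int])
  have out' : ∀ t, D'.curve t ∈ D'.real → ∀ k : ℤ, t + (k : ℝ) ∉ Icc a b := by
    intro t ht k hk
    exact (h1 _ hk).2 (by rwa [D'.curve_add_int])
  have he : ∀ t, (∀ k : ℤ, t + (k : ℝ) ∉ Icc a b) → D'.curve =ᶠ[𝓝 t] D.curve := by
    intro t ht
    obtain ⟨m, hm⟩ := exists_gap_of_forall_notMem ht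
    filter_upwards [isOpen_Ioo.mem_nhds hm] with s hs
    exact h2 s (forall_notMem_of_mem_gap hs)
  have hmem : ∀ t, D'.curve t ∈ D'.real ↔ D.curve t ∈ D.real := by
    intro t
    constructor
    · intro ht
      rw [← h2 t (out' t ht), ← hr]; exact ht
    · intro ht
      rw [h2 t (out t ht), hr]; exact ht
  refine ⟨f, t₀, ts, by rw [hr]; exact hf, by rwa [hmem], ⟨hts.1, fun t => by rw [hmem]; exact hts.2 t⟩, ?_⟩
  rw [hw]
  refine List.map_congr_left fun t ht => ?_
  have ht' := ((hts.2 t).1 ht).2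
  refine VirtualDiagram.label_congr ⟨fun h => h.congr out he ht', fun h => ?_⟩ ?_
  · exact h.congr out' (fun t ht => (he t ht).symm) ((hmem t).2 ht')
  · rw [h2 t (out t ht')]

theorem VirtualDiagram.HasGaussCode.card_real {n : ℕ} {D : VirtualDiagram} {w : GaussCode n}
    (h : D.HasGaussCode w) : D.real.card = n := by
  obtain ⟨f, -, -, hf, -⟩ := h
  have h1 : D.real.image f = Finset.univ := by
    apply Finset.coe_injective
    rw [Finset.coe_image, hf.image_eq, Finset.coe_univ]
  have h2 := Finset.card_image_of_injOn hf.injOn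
  rw [h1, Finset.card_univ, Fintype.card_fin] at h2
  exact h2.symm

theorem StrictEquiv.hasGaussCode_iff {n : ℕ} [NeZero n] {D D' : VirtualDiagram}
    (h : StrictEquiv D D') (w : GaussCode n) : D.HasGaussCode w ↔ D'.HasGaussCode w := by
  induction h with
  | rel D D' h =>
    rcases h with h | h
    · refine ⟨h.hasGaussCode, fun hw' => ?_⟩
      -- The isotopy is not inverted. Instead, any code of `D` is also one of `D'`, hence equivalent
      -- to `w`, and the codes of `D` form a full class.
      have hcard : D.real.card = n := by
        obtain ⟨H, -, -, -, -, hr⟩ := h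
        have := hw'.card_real
        rwa [hr, Finset.card_map] at this
      obtain ⟨v, hv⟩ := exists_isGaussCodeOf (⟨D, hcard⟩ : Diagram n)
      have hv' := isGaussCodeOf_iff.1 hv
      exact hv'.of_codeEquiv ((h.hasGaussCode hv').codeEquiv hw')
    · exact ⟨h.hasGaussCode, h.symm.hasGaussCode⟩
  | refl D => exact Iff.rfl
  | symm D D' _ ih => exact ih.symm
  | trans D D' D'' _ _ ih1 ih2 => exact ih1.trans ih2

end VirtualDoodle

namespace VirtualDoodle
open Set Filter Topology

/-! ### Bump functions on the circle -/

/-- A smooth function of period `1`, equal to `1` at distance at most `ρ'` from `m` modulo `1` and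
positive exactly at distance less than `ρ`. -/
noncomputable def arcBump (m ρ' ρ t : ℝ) : ℝ :=
  Real.smoothTransition ((Real.cos (2 * Real.pi * (t - m)) - Real.cos (2 * Real.pi * ρ)) /
    (Real.cos (2 * Real.pi * ρ') - Real.cos (2 * Real.pi * ρ)))

theorem contDiff_arcBump (m ρ' ρ : ℝ) : ContDiff ℝ ∞ (arcBump m ρ' ρ) := by
  unfold arcBump
  have h : ContDiff ℝ ∞ Real.smoothTransition := Real.smoothTransition.contDiff
  refine h.comp ?_
  simp only [div_eq_mul_inv]
  have h2 : ContDiff ℝ ∞ Real.cos := Real.contDiff_cos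
  fun_prop

theorem arcBump_nonneg (m ρ' ρ t : ℝ) : 0 ≤ arcBump m ρ' ρ t := Real.smoothTransition.nonneg _

theorem cos_two_pi_mul_add_int (t : ℝ) (k : ℤ) :
    Real.cos (2 * Real.pi * (t + k)) = Real.cos (2 * Real.pi * t) := by
  rw [mul_add, mul_comm (2 * Real.pi) (k : ℝ), Real.cos_add_int_mul_two_pi]

theorem sin_two_pi_mul_add_int (t : ℝ) (k : ℤ) :
    Real.sin (2 * Real.pi * (t + k)) = Real.sin (2 * Real.pi * t) := by
  rw [mul_add, mul_comm (2 * Real.pi) (k : ℝ), Real.sin_add_int_mul_two_pi]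

theorem arcBump_add_int (m ρ' ρ t : ℝ) (k : ℤ) :
    arcBump m ρ' ρ (t + k) = arcBump m ρ' ρ t := by
  unfold arcBump
  rw [show t + (k : ℝ) - m = t - m + k by ring, cos_two_pi_mul_add_int]

theorem cos_two_pi_lt_iff {x y : ℝ} (hx : |x| ≤ 1 / 2) (hy0 : 0 ≤ y) (hy : y ≤ 1 / 2) :
    Real.cos (2 * Real.pi * y) < Real.cos (2 * Real.pi * x) ↔ |x| < y := by
  have hpi := Real.pi_pos
  have e : Real.cos (2 * Real.pi * x) = Real.cos (2 * Real.pi * |x|) := by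
    rw [← Real.cos_abs, abs_mul, abs_of_pos (by positivity)]
  rw [e, Real.strictAntiOn_cos.lt_iff_gt ⟨by positivity, by nlinarith⟩
    ⟨by positivity, by nlinarith⟩]
  constructor
  · intro h; exact lt_of_mul_lt_mul_left h (by positivity)
  · intro h; exact mul_lt_mul_of_pos_left h (by positivity)

theorem exists_int_abs_add_le (x : ℝ) : ∃ k : ℤ, |x + k| ≤ 1 / 2 :=
  ⟨-round x, by push_cast; rw [← sub_eq_add_neg]; exact abs_sub_round x⟩

section
variable {m ρ' ρ : ℝ}

theorem arcBump_denom_pos (h0 : 0 < ρ') (h1 : ρ' < ρ) (h2 : ρ ≤ 1 / 2) :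
    0 < Real.cos (2 * Real.pi * ρ') - Real.cos (2 * Real.pi * ρ) := by
  have := (cos_two_pi_lt_iff (x := ρ') (y := ρ) (by rw [abs_of_pos h0]; linarith) (by linarith)
    h2).2 (by rwa [abs_of_pos h0])
  linarith

theorem arcBump_ne_zero_iff (h0 : 0 < ρ') (h1 : ρ' < ρ) (h2 : ρ ≤ 1 / 2) {t : ℝ} :
    arcBump m ρ' ρ t ≠ 0 ↔ ∃ k : ℤ, |t - m + k| < ρ := by
  have hd := arcBump_denom_pos h0 h1 h2
  unfold arcBump
  rw [Ne, Real.smoothTransition.zero_iff_nonpos, not_le, div_pos_iff_of_pos_right hd, sub_pos]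
  constructor
  · intro h
    obtain ⟨k, hk⟩ := exists_int_abs_add_le (t - m)
    refine ⟨k, ?_⟩
    rw [← cos_two_pi_mul_add_int (t - m) k] at h
    exact (cos_two_pi_lt_iff hk (by linarith) h2).1 h
  · rintro ⟨k, hk⟩
    rw [← cos_two_pi_mul_add_int (t - m) k]
    exact (cos_two_pi_lt_iff (by linarith) (by linarith) h2).2 hk

theorem arcBump_eq_one (h0 : 0 < ρ') (h1 : ρ' < ρ) (h2 : ρ ≤ 1 / 2) {t : ℝ} {k : ℤ}
    (h : |t - m + k| ≤ ρ') : arcBump m ρ' ρ t = 1 := by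
  have hd := arcBump_denom_pos h0 h1 h2
  unfold arcBump
  apply Real.smoothTransition.one_of_one_le
  rw [one_le_div hd]
  have : Real.cos (2 * Real.pi * ρ') ≤ Real.cos (2 * Real.pi * (t - m)) := by
    rw [← cos_two_pi_mul_add_int (t - m) k]
    by_contra hcon
    push Not at hcon
    have hcon' : Real.cos (2 * Real.pi * |t - m + k|) < Real.cos (2 * Real.pi * ρ') := by
      rwa [← Real.cos_abs, abs_mul, abs_abs, ← abs_mul, Real.cos_abs]
    have := (cos_two_pi_lt_iff (x := ρ') (y := |t - m + k|) (by rw [abs_of_pos h0]; linarith)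
      (abs_nonneg _) (by linarith)).1 hcon'
    rw [abs_of_pos h0] at this
    linarith
  linarith

theorem arcBump_eq_zero (h0 : 0 < ρ') (h1 : ρ' < ρ) (h2 : ρ ≤ 1 / 2) {t : ℝ}
    (h : ∀ k : ℤ, ρ ≤ |t - m + k|) : arcBump m ρ' ρ t = 0 := by
  by_contra hne
  obtain ⟨k, hk⟩ := (arcBump_ne_zero_iff h0 h1 h2).1 hne
  linarith [h k]

end

/-! ### Reparametrizations -/

/-- A smooth degree one staircase that rises only on `(0, 1 / N)` modulo `1`. -/
theorem exists_staircase (N : ℕ) (hN : 1 ≤ N) : ∃ Θ : ℝ → ℝ, ContDiff ℝ ∞ Θ ∧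
    (∀ t, 0 ≤ deriv Θ t) ∧ (∀ t, Θ (t + 1) = Θ t + 1) ∧ Θ 0 = 0 ∧
    ∀ j : ℕ, 1 ≤ j → j ≤ N → Θ (j / N) = 1 := by
  have hN' : (1 : ℝ) ≤ N := by exact_mod_cast hN
  have hN0 : (0 : ℝ) < N := by linarith
  -- A bump of radius ρ centred at ρ is positive exactly on (0, 1/N) modulo 1; the staircase is its
  -- normalized integral.
  set ρ : ℝ := 1 / (2 * N) with hρ
  have hρ0 : 0 < ρ := by positivity
  have hρ1 : ρ ≤ 1 / 2 := by
    rw [hρ, div_le_div_iff₀ (by positivity) (by norm_num)]; linarith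
  set φ : ℝ → ℝ := arcBump ρ (ρ / 2) ρ with hφ
  have hφs : ContDiff ℝ ∞ φ := contDiff_arcBump _ _ _
  have hφc : Continuous φ := hφs.continuous
  have hφp : Function.Periodic φ 1 := fun t => by
    have := arcBump_add_int ρ (ρ / 2) ρ t 1
    simpa using this
  have hint : ∀ a b, IntervalIntegrable φ MeasureTheory.volume a b := fun a b =>
    hφc.intervalIntegrable a b
  set I := ∫ x in (0 : ℝ)..1, φ x with hI
  have hIpos : 0 < I := by
    refine intervalIntegral.integral_pos (by norm_num) hφc.continuousOn
      (fun x _ => arcBump_nonneg _ _ _ _) ⟨ρ, ⟨hρ0.le, by linarith⟩, ?_⟩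
    have : φ ρ ≠ 0 := (arcBump_ne_zero_iff (by linarith) (by linarith) hρ1).2 ⟨0, by simpa using hρ0⟩
    exact lt_of_le_of_ne (arcBump_nonneg _ _ _ _) this.symm
  have hzero : ∀ x ∈ Icc (1 / N : ℝ) 1, φ x = 0 := by
    intro x hx
    refine arcBump_eq_zero (by linarith) (by linarith) hρ1 fun k => ?_
    have h1 : (1 / N : ℝ) = 2 * ρ := by rw [hρ]; field_simp
    rcases le_or_gt 0 k with hk | hk
    · have : (0 : ℝ) ≤ k := by exact_mod_cast hk
      exact le_trans (by linarith [hx.1]) (le_abs_self _)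
    · have : (k : ℝ) ≤ -1 := by
        have : k ≤ -1 := by omega
        exact_mod_cast this
      exact le_trans (by linarith [hx.2]) (neg_le_abs _)
  have hder : ∀ t, HasDerivAt (fun t => (∫ x in (0 : ℝ)..t, φ x) / I) (φ t / I) t := fun t =>
    (intervalIntegral.integral_hasDerivAt_right (hint _ _)
      hφc.stronglyMeasurable.stronglyMeasurableAtFilter hφc.continuousAt).div_const I
  have hderiv : deriv (fun t => (∫ x in (0 : ℝ)..t, φ x) / I) = fun t => φ t / I :=
    funext fun t => (hder t).deriv
  refine ⟨fun t => (∫ x in (0 : ℝ)..t, φ x) / I, ?_, fun t => ?_, fun t => ?_, by simp,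
    fun j hj1 hj2 => ?_⟩
  · rw [contDiff_infty_iff_deriv]
    refine ⟨fun t => (hder t).differentiableAt, ?_⟩
    rw [hderiv]
    exact hφs.div_const I
  · rw [hderiv]
    exact div_nonneg (arcBump_nonneg _ _ _ _) hIpos.le
  · have h1 : (∫ x in (0 : ℝ)..(t + 1), φ x) = (∫ x in (0 : ℝ)..t, φ x) + I := by
      rw [← intervalIntegral.integral_add_adjacent_intervals (hint 0 t) (hint t (t + 1)),
        hφp.intervalIntegral_add_eq t 0, zero_add]
    simp only [h1]
    field_simp
  · have hj1' : (1 : ℝ) ≤ j := by exact_mod_cast hj1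
    have hj2' : (j : ℝ) ≤ N := by exact_mod_cast hj2
    have e1 : (1 / N : ℝ) ≤ j / N := by gcongr
    have e2 : (j / N : ℝ) ≤ 1 := by rw [div_le_one hN0]; exact hj2'
    have h1 : (∫ x in (j / N : ℝ)..1, φ x) = 0 := by
      rw [intervalIntegral.integral_congr (g := fun _ => (0 : ℝ))]
      · simp
      · intro x hx
        rw [uIcc_of_le e2] at hx
        exact hzero x ⟨e1.trans hx.1, hx.2⟩
    have h2 := intervalIntegral.integral_add_adjacent_intervals (hint 0 (j / N)) (hint (j / N) 1)
    rw [h1, add_zero] at h2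
    simp only [h2]
    exact div_self hIpos.ne'

/-- A line of slope ε N, which keeps the derivative positive, plus one staircase for each interval
that adds the remaining rise `d i` there. With ε the least gap all `d i` are nonnegative. -/
theorem exists_reparametrization {N : ℕ} (hN : 1 ≤ N) {s : ℕ → ℝ} (hs : ∀ i < N, s i < s (i + 1))
    (hsN : s N = s 0 + 1) :
    ∃ σ, IsReparametrization σ ∧ ∀ k < N, σ (k / N) = s k := by
  obtain ⟨Θ, hΘ, hΘ', hΘ1, hΘ0, hΘj⟩ := exists_staircase N hN
  have hN0 : (0 : ℝ) < N := by exact_mod_cast hN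
  obtain ⟨ε, hε, hεs⟩ : ∃ ε > 0, ∀ i ∈ Finset.range N, ε ≤ s (i + 1) - s i := by
    obtain ⟨i, hi, hmin⟩ := Finset.exists_min_image (Finset.range N) (fun i => s (i + 1) - s i)
      ⟨0, Finset.mem_range.2 hN⟩
    exact ⟨s (i + 1) - s i, by linarith [hs i (Finset.mem_range.1 hi)], hmin⟩
  have dΘ : Differentiable ℝ Θ := hΘ.differentiable (by simp)
  set d : ℕ → ℝ := fun i => s (i + 1) - s i - ε with hd
  have hsum : ∀ k, ∑ i ∈ Finset.range k, d i = s k - s 0 - k * ε := by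
    intro k
    simp only [hd]
    rw [Finset.sum_sub_distrib, Finset.sum_range_sub]
    simp
  have hder : ∀ t, HasDerivAt (fun t => s 0 + ε * N * t + ∑ i ∈ Finset.range N, d i * Θ (t - i / N))
      (ε * N + ∑ i ∈ Finset.range N, d i * deriv Θ (t - i / N)) t := by
    intro t
    have h1 : HasDerivAt (fun t => s 0 + ε * N * t) (ε * N) t := by
      simpa using ((hasDerivAt_id t).const_mul (ε * N)).const_add (s 0)
    refine h1.add (HasDerivAt.fun_sum fun i _ => ?_)
    exact ((dΘ _).hasDerivAt.comp_sub_const t (i / N)).const_mul (d i)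
  refine ⟨fun t => s 0 + ε * N * t + ∑ i ∈ Finset.range N, d i * Θ (t - i / N),
    ⟨?_, fun t => ?_, fun t => ?_⟩, fun k hk => ?_⟩
  · have : ∀ i : ℕ, ContDiff ℝ ∞ fun t : ℝ => Θ (t - i / N) := fun i => hΘ.comp (by fun_prop)
    fun_prop
  · rw [(hder t).deriv]
    have : 0 ≤ ∑ i ∈ Finset.range N, d i * deriv Θ (t - i / N) :=
      Finset.sum_nonneg fun i hi => mul_nonneg (by simp only [hd]; linarith [hεs i hi]) (hΘ' _)
    have := mul_pos hε hN0
    linarith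
  · have : ∀ i : ℕ, Θ (t + 1 - i / N) = Θ (t - i / N) + 1 := fun i => by
      rw [← hΘ1]; congr 1; ring
    simp only [this, mul_add, Finset.sum_add_distrib, mul_one, hsum]
    rw [hsN]; ring
  · have hval : ∀ i ∈ Finset.range N, d i * Θ ((k : ℝ) / N - i / N) = if i < k then d i else 0 := by
      intro i hi
      have hi' := Finset.mem_range.1 hi
      split_ifs with hik
      · have := hΘj (k - i) (by omega) (by omega)
        rw [Nat.cast_sub hik.le, sub_div] at this
        rw [this, mul_one]
      · have h0 : Θ ((k : ℝ) / N - i / N) = 0 := by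
          rcases eq_or_lt_of_le (not_lt.1 hik) with h | h
          · rw [h, sub_self, hΘ0]
          · have h1 := hΘj (N + k - i) (by omega) (by omega)
            rw [Nat.cast_sub (by omega), Nat.cast_add] at h1
            have h2 := hΘ1 ((k : ℝ) / N - i / N)
            have h3 : (k : ℝ) / N - i / N + 1 = ((N : ℝ) + k - i) / N := by
              field_simp; ring
            rw [h3, h1] at h2
            linarith
        rw [h0, mul_zero]
    have hcalc : ∑ i ∈ Finset.range N, d i * Θ ((k : ℝ) / N - i / N) = s k - s 0 - k * ε := by
      rw [Finset.sum_congr rfl hval, ← hsum k, ← Finset.sum_filter]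
      congr 1
      ext i; simp; omega
    beta_reduce
    rw [hcalc]
    field_simp
    ring

/-! ### Transformed diagrams -/

theorem deriv_transform {h : Plane → Plane} {γ : ℝ → Plane} {σ : ℝ → ℝ} (hh : ContDiff ℝ ∞ h)
    (hγ : ContDiff ℝ ∞ γ) (hσ : ContDiff ℝ ∞ σ) (t : ℝ) :
    deriv (fun t => h (γ (σ t))) t = deriv σ t • fderiv ℝ h (γ (σ t)) (deriv γ (σ t)) := by
  have h1 : HasFDerivAt h (fderiv ℝ h (γ (σ t))) (γ (σ t)) :=
    ((hh.differentiable (by simp)) _).hasFDerivAt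
  have h2 : HasDerivAt γ (deriv γ (σ t)) (σ t) := ((hγ.differentiable (by simp)) _).hasDerivAt
  have h3 : HasDerivAt σ (deriv σ t) t := ((hσ.differentiable (by simp)) _).hasDerivAt
  have h4 := h1.comp_hasDerivAt t (h2.scomp t h3)
  rw [map_smul] at h4
  exact h4.deriv

theorem planeDet_smul_smul (a b : ℝ) (u v : Plane) :
    planeDet (a • u) (b • v) = (a * b) * planeDet u v := by
  simp [planeDet]; ring

/-- The image of a diagram under a diffeomorphism of the plane, reparametrized. -/
def VirtualDiagram.transform (D : VirtualDiagram) (h : Plane ≃ Plane) (h1 : ContDiff ℝ ∞ h)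
    (h2 : ContDiff ℝ ∞ h.symm) (σ : ℝ → ℝ) (hσ : IsReparametrization σ) : VirtualDiagram where
  curve t := h (D.curve (σ t))
  periodic t := by
    change h (D.curve (σ (t + 1))) = h (D.curve (σ t))
    rw [hσ.2.2, D.periodic]
  smooth := h1.comp (D.smooth.comp hσ.1)
  immersed t := by
    rw [deriv_transform h1 D.smooth hσ.1]
    refine smul_ne_zero (hσ.2.1 t).ne' fun h0 => ?_
    have hj := jacobian_ne_zero h1 h2 (D.curve (σ t))
    set u := deriv D.curve (σ t)
    have hu : u ≠ 0 := D.immersed (σ t)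
    -- The rotated vector (-u.2, u.1) has determinant |u|² with u, so a vanishing image would force
    -- u = 0.
    have h3 := planeDet_map (fderiv ℝ h (D.curve (σ t))) u (-u.2, u.1)
    rw [h0] at h3
    have h4 : planeDet u (-u.2, u.1) = 0 := by
      have : planeDet 0 (fderiv ℝ h (D.curve (σ t)) (-u.2, u.1)) = 0 := by simp [planeDet]
      rw [this] at h3
      exact (mul_eq_zero.1 h3.symm).resolve_left hj
    simp only [planeDet] at h4
    exact hu (Prod.ext (by simp; nlinarith [sq_nonneg u.1, sq_nonneg u.2])
      (by simp; nlinarith [sq_nonneg u.1, sq_nonneg u.2]))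
  transverse s t hst hne := by
    have hst' := h.injective hst
    rw [deriv_transform h1 D.smooth hσ.1, deriv_transform h1 D.smooth hσ.1, planeDet_smul_smul,
      hst', planeDet_map]
    exact mul_ne_zero (mul_ne_zero (hσ.2.1 s).ne' (hσ.2.1 t).ne')
      (mul_ne_zero (jacobian_ne_zero h1 h2 _)
        (D.transverse _ _ hst' fun h => hne (hσ.samePoint_iff.1 h)))
  no_triple r s t hrs hrt := by
    have := D.no_triple _ _ _ (h.injective hrs) (h.injective hrt)
    simpa only [hσ.samePoint_iff] using this
  real := D.real.map h.toEmbedding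
  real_crossing c hc := by
    obtain ⟨p, hp, rfl⟩ := Finset.mem_map.1 hc
    obtain ⟨s, t, hst, hs, ht⟩ := D.real_crossing p hp
    obtain ⟨s, rfl⟩ := hσ.surjective s
    obtain ⟨t, rfl⟩ := hσ.surjective t
    exact ⟨s, t, fun h => hst (hσ.samePoint_iff.2 h), by simp [hs], by simp [ht]⟩

theorem isReparametrization_id : IsReparametrization id :=
  ⟨contDiff_id, fun t => by simp, fun _ => rfl⟩

theorem isPlaneIsotopy_refl : IsPlaneIsotopy fun _ => Equiv.refl Plane :=
  ⟨rfl, contDiff_snd, fun _ => contDiff_id⟩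

theorem IsPlaneIsotopy.strictEquiv_transform {H : ℝ → Plane ≃ Plane} (hH : IsPlaneIsotopy H)
    (D : VirtualDiagram) {σ : ℝ → ℝ} (hσ : IsReparametrization σ) :
    StrictEquiv D (D.transform (H 1) (hH.contDiff 1) (hH.2.2 1) σ hσ) :=
  .rel _ _ (.inl ⟨H, σ, hH, hσ, fun _ => rfl, rfl⟩)

/-- `H` carries the transformed diagram back to `D`. Using symmetry of strict equivalence avoids
showing that the inverse family is jointly smooth. -/
theorem IsPlaneIsotopy.strictEquiv_transform_symm {H : ℝ → Plane ≃ Plane} (hH : IsPlaneIsotopy H)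
    (D : VirtualDiagram) :
    StrictEquiv D (D.transform (H 1).symm (hH.2.2 1) (by simpa using hH.contDiff 1) id
      isReparametrization_id) := by
  refine .symm _ _ (.rel _ _ (.inl ⟨H, id, hH, isReparametrization_id, fun t => ?_, ?_⟩))
  · simp [VirtualDiagram.transform]
  · ext p; simp [VirtualDiagram.transform]

/-! ### Diagrams with crossings at prescribed parameters -/

section
variable {n : ℕ}

/-- The parameter at which the branch with label `x` is met, in a parametrization adapted
to the Gauss code `w`. -/
noncomputable def codeTime (w : GaussCode n) (x : Letter n) : ℝ := (w.1.idxOf x : ℝ) / (2 * n : ℕ)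

theorem idxOf_lt (w : GaussCode n) (x : Letter n) : w.1.idxOf x < 2 * n := by
  have := List.idxOf_lt_length_of_mem (w.2.2 x)
  rwa [w.2.1] at this

theorem codeTime_mem_Ico (w : GaussCode n) (x : Letter n) : codeTime w x ∈ Ico (0 : ℝ) (0 + 1) := by
  have h := idxOf_lt w x
  have h' : ((w.1.idxOf x : ℕ) : ℝ) < (2 * n : ℕ) := by exact_mod_cast h
  have h0 : (0 : ℝ) < (2 * n : ℕ) := lt_of_le_of_lt (Nat.cast_nonneg _) h'
  unfold codeTime
  exact ⟨by positivity, by rw [zero_add, div_lt_one h0]; exact h'⟩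

theorem codeTime_injective (w : GaussCode n) : Function.Injective (codeTime w) := by
  intro x y h
  have h0 : ((2 * n : ℕ) : ℝ) ≠ 0 := by
    have := idxOf_lt w x
    exact_mod_cast (by omega : 2 * n ≠ 0)
  unfold codeTime at h
  rw [div_left_inj' h0] at h
  exact (List.idxOf_inj (w.2.2 x)).1 (by exact_mod_cast h)

theorem not_samePoint_codeTime (w : GaussCode n) {x y : Letter n} (h : x ≠ y) :
    ¬ SamePoint (codeTime w x) (codeTime w y) := fun h' =>
  h (codeTime_injective w (h'.eq_of_mem (codeTime_mem_Ico w x) (codeTime_mem_Ico w y)))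

theorem letterL_ne_letterR (i j : Fin n) : letterL i ≠ letterR j := by
  intro h
  have := congrArg Letter.isL h
  simp [Letter.isL, letterL, letterR] at this

theorem eq_letter (x : Letter n) : x = letterL x.index ∨ x = letterR x.index := by
  rcases h : x.isL with _ | _
  · right
    have h2 : (ofLex x).2 = true := by simpa [Letter.isL] using h
    change x = toLex ((ofLex x).1, true)
    rw [← h2]; rfl
  · exact .inl (eq_letterL_of_isL h)

/-- The diagram `D` has its real crossings at the points `c j`, and passes through them as
prescribed by the Gauss code `w`, at the parameters `codeTime w x`. -/
structure VirtualDiagram.Marked (D : VirtualDiagram) (w : GaussCode n) (c : Fin n → Plane) :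
    Prop where
  inj : Function.Injective c
  real : ∀ p, p ∈ D.real ↔ ∃ j, c j = p
  point : ∀ x, D.curve (codeTime w x) = c x.index
  sign : ∀ j, planeDet (deriv D.curve (codeTime w (letterL j)))
    (deriv D.curve (codeTime w (letterR j))) < 0

/-- The two code times of a crossing already exhaust its preimages, as there are no triple points.
-/
theorem VirtualDiagram.Marked.exists_samePoint {D : VirtualDiagram} {w : GaussCode n}
    {c : Fin n → Plane} (h : D.Marked w c) {t : ℝ} (ht : D.curve t ∈ D.real) :
    ∃ x, SamePoint (codeTime w x) t := by
  obtain ⟨j, hj⟩ := (h.real _).1 ht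
  have hL := h.point (letterL j)
  have hR := h.point (letterR j)
  rcases D.no_triple t (codeTime w (letterL j)) (codeTime w (letterR j))
    (hj.symm.trans hL.symm) (hj.symm.trans hR.symm) with h' | h' | h'
  · exact ⟨_, h'.symm⟩
  · exact ⟨_, h'.symm⟩
  · exact absurd h' (not_samePoint_codeTime w (letterL_ne_letterR j j))

/-- A reparametrization moves the k-th real crossing parameter to k/(2n); the plane stays fixed. -/
theorem VirtualDiagram.HasGaussCode.exists_marked [NeZero n] {D : VirtualDiagram} {w : GaussCode n}
    (h : D.HasGaussCode w) : ∃ D' c, StrictEquiv D D' ∧ D'.Marked w c := by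
  obtain ⟨f, t₀, ts, hf, h0, hts, hw⟩ := h
  have hlen : ts.length = 2 * n := by rw [← w.2.1, hw, List.length_map]
  have hn : 1 ≤ 2 * n := by have := NeZero.ne n; omega
  set s : ℕ → ℝ := fun k => if h : k < ts.length then ts[k] else ts[0]'(by omega) + 1 with hs
  have hsk : ∀ k (hk : k < ts.length), s k = ts[k] := fun k hk => by simp [hs, hk]
  have hsN : s (2 * n) = s 0 + 1 := by
    rw [hsk 0 (by omega)]; simp [hs, hlen]
  have hmem : ∀ k (hk : k < ts.length), (t₀ < ts[k] ∧ ts[k] < t₀ + 1) ∧ D.curve ts[k] ∈ D.real :=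
    fun k hk => (hts.2 _).1 (List.getElem_mem hk)
  obtain ⟨σ, hσ, hσs⟩ := exists_reparametrization (N := 2 * n) hn (s := s) (fun i hi => by
    rw [hsk i (by omega)]
    by_cases h1 : i + 1 < ts.length
    · rw [hsk _ h1]
      exact List.pairwise_iff_getElem.1 hts.1 i (i + 1) _ _ (by omega)
    · have h2 : i + 1 = 2 * n := by omega
      rw [h2, hsN, hsk 0 (by omega)]
      linarith [(hmem i (by omega)).1.2, (hmem 0 (by omega)).1.1]) hsN
  have hσx : ∀ x, D.curve (σ (codeTime w x)) ∈ D.real ∧ D.label f (σ (codeTime w x)) = x := by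
    intro x
    have hx := idxOf_lt w x
    have h1 : σ (codeTime w x) = ts[w.1.idxOf x] := by
      rw [← hsk _ (by omega)]; exact hσs _ hx
    rw [h1]
    refine ⟨(hmem _ _).2, ?_⟩
    have h2 : w.1[w.1.idxOf x]'(by rw [w.2.1]; exact hx) = x := List.getElem_idxOf _
    have h3 := List.getElem_of_eq hw (i := w.1.idxOf x) (by rw [w.2.1]; exact hx)
    rw [List.getElem_map] at h3
    exact h3.symm.trans h2
  have hidx : ∀ x, f (D.curve (σ (codeTime w x))) = x.index := by
    intro x
    have := congrArg Letter.index (hσx x).2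
    unfold VirtualDiagram.label at this
    split_ifs at this <;> simpa [Letter.index, letterL, letterR] using this
  obtain ⟨c, hc1, hc2⟩ : ∃ c : Fin n → Plane, (∀ j, c j ∈ D.real) ∧ ∀ j, f (c j) = j := by
    have hg : ∀ j, ∃ c ∈ (D.real : Set Plane), f c = j := fun j => hf.surjOn (mem_univ j)
    choose c h1 h2 using hg
    exact ⟨c, h1, h2⟩
  have hpt : ∀ x, D.curve (σ (codeTime w x)) = c x.index := fun x =>
    hf.injOn (hσx x).1 (hc1 _) ((hidx x).trans (hc2 _).symm)
  refine ⟨D.transform (Equiv.refl Plane) contDiff_id contDiff_id σ hσ, c, ?_, ?_, ?_, ?_, ?_⟩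
  · exact isPlaneIsotopy_refl.strictEquiv_transform D hσ
  · intro i j hij
    rw [← hc2 i, ← hc2 j, hij]
  · intro p
    simp only [VirtualDiagram.transform, Finset.mem_map]
    constructor
    · rintro ⟨q, hq, rfl⟩
      exact ⟨f q, hf.injOn (hc1 _) hq (hc2 _)⟩
    · rintro ⟨j, rfl⟩
      exact ⟨c j, hc1 j, rfl⟩
  · exact hpt
  · intro j
    have hLR := not_samePoint_codeTime w (letterL_ne_letterR j j)
    have hcurve : D.curve (σ (codeTime w (letterR j))) = D.curve (σ (codeTime w (letterL j))) := by
      rw [hpt, hpt]; rfl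
    have hleft : D.IsLeftBranch (σ (codeTime w (letterL j))) := by
      have := congrArg Letter.isL (hσx (letterL j)).2
      unfold VirtualDiagram.label at this
      split_ifs at this with h'
      · exact h'
      · simp [Letter.isL, letterL, letterR] at this
    rw [D.isLeftBranch_iff (fun h => hLR (hσ.samePoint_iff.1 h)) hcurve] at hleft
    have hd : ∀ t, deriv (D.transform (Equiv.refl Plane) contDiff_id contDiff_id σ hσ).curve t
        = deriv σ t • deriv D.curve (σ t) := fun t => by
      have := deriv_transform (h := id) contDiff_id D.smooth hσ.1 t
      rw [fderiv_id] at this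
      exact this
    rw [hd, hd, planeDet_smul_smul]
    exact mul_neg_of_pos_of_neg (mul_pos (hσ.2.1 _) (hσ.2.1 _)) hleft

theorem VirtualDiagram.Marked.hasGaussCode [NeZero n] {D : VirtualDiagram} {w : GaussCode n}
    {c : Fin n → Plane} (h : D.Marked w c) : D.HasGaussCode w := by
  have hn0 : (0 : ℝ) < (2 * n : ℕ) := by
    have := NeZero.ne n
    exact_mod_cast (by omega : 0 < 2 * n)
  have hn1 : (1 : ℝ) ≤ (2 * n : ℕ) := by
    have := NeZero.ne n
    exact_mod_cast (by omega : 1 ≤ 2 * n)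
  -- Half a step before the first code time. It is no code time modulo 1, since that would make an
  -- even integer equal to -1.
  set t₀ : ℝ := -(1 / (2 * (2 * n : ℕ))) with ht₀
  have hcf : ∀ j, Function.invFun c (c j) = j := Function.leftInverse_invFun h.inj
  have hlt : ∀ x, t₀ < codeTime w x ∧ codeTime w x < t₀ + 1 := by
    intro x
    have h1 : (w.1.idxOf x : ℝ) + 1 ≤ (2 * n : ℕ) := by exact_mod_cast idxOf_lt w x
    have h2 : 0 < 1 / (2 * (2 * n : ℕ) : ℝ) := by positivity
    refine ⟨by linarith [(codeTime_mem_Ico w x).1], ?_⟩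
    unfold codeTime
    rw [ht₀, div_lt_iff₀ hn0]
    field_simp
    linarith
  refine ⟨Function.invFun c, t₀, w.1.map (codeTime w), ⟨fun _ _ => mem_univ _, ?_, ?_⟩, ?_,
    ⟨?_, fun t => ?_⟩, ?_⟩
  · intro p hp q hq hpq
    obtain ⟨i, rfl⟩ := (h.real p).1 hp
    obtain ⟨j, rfl⟩ := (h.real q).1 hq
    rw [hcf, hcf] at hpq; rw [hpq]
  · intro j _
    exact ⟨c j, (h.real _).2 ⟨j, rfl⟩, hcf j⟩
  · intro hr
    obtain ⟨x, k, hk⟩ := h.exists_samePoint hr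
    have e : (w.1.idxOf x : ℝ) + k * (2 * n : ℕ) = -(1 / 2) := by
      unfold codeTime at hk
      rw [ht₀] at hk
      field_simp at hk
      linarith
    have e2 : 2 * ((w.1.idxOf x : ℤ) + k * (2 * n : ℕ)) = -1 := by
      have : (2 : ℝ) * ((w.1.idxOf x : ℝ) + k * (2 * n : ℕ)) = -1 := by rw [e]; norm_num
      exact_mod_cast this
    omega
  · rw [List.pairwise_map, List.pairwise_iff_getElem]
    intro i j hi hj hij
    unfold codeTime
    rw [w.nodup.idxOf_getElem, w.nodup.idxOf_getElem]
    gcongr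
  · rw [List.mem_map]
    constructor
    · rintro ⟨x, -, rfl⟩
      exact ⟨hlt x, by rw [h.point]; exact (h.real _).2 ⟨_, rfl⟩⟩
    · rintro ⟨ht, hr⟩
      obtain ⟨x, hx⟩ := h.exists_samePoint hr
      exact ⟨x, w.2.2 x, hx.eq_of_mem (a := t₀) ⟨(hlt x).1.le, (hlt x).2⟩ ⟨ht.1.le, ht.2⟩⟩
  · rw [List.map_map]
    conv_lhs => rw [← List.map_id w.1]
    refine List.map_congr_left fun x _ => ?_
    have hp : ∀ j, D.curve (codeTime w (letterL j)) = D.curve (codeTime w (letterR j)) := fun j => by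
      rw [h.point, h.point]; rfl
    have hL : ∀ j, D.IsLeftBranch (codeTime w (letterL j)) := fun j =>
      (D.isLeftBranch_iff (not_samePoint_codeTime w (letterL_ne_letterR j j)) (hp j).symm).2 (h.sign j)
    have hR : ∀ j, ¬ D.IsLeftBranch (codeTime w (letterR j)) := fun j =>
      (D.isLeftBranch_iff_not (not_samePoint_codeTime w (letterL_ne_letterR j j)) (hp j)).1 (hL j)
    change x = D.label (Function.invFun c) (codeTime w x)
    unfold VirtualDiagram.label
    rw [h.point, hcf]
    rcases eq_letter x with hx | hx
    · rw [if_pos (by rw [hx]; exact hL _)]; exact hx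
    · rw [if_neg (by rw [hx]; exact hR _)]; exact hx

end
end VirtualDoodle

namespace VirtualDoodle
open Set Filter Topology

/-! ### Straightening the real crossings -/

section
variable {n : ℕ}

/-- The direction of the branch with label `x` in a straightened diagram. -/
def Letter.dir (x : Letter n) : Plane := if x.isL then (0, 1) else (1, 0)

theorem dir_letterL (j : Fin n) : (letterL j).dir = (0, 1) := rfl

theorem dir_letterR (j : Fin n) : (letterR j).dir = (1, 0) := rfl

theorem deriv_line (p v : Plane) (a : ℝ) : deriv (fun t : ℝ => p + (t - a) • v) a = v := by
  have : HasDerivAt (fun t : ℝ => p + (t - a) • v) ((1 : ℝ) • v) a :=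
    (((hasDerivAt_id a).sub_const a).smul_const v).const_add p
  rw [this.deriv, one_smul]

/-- The map z ↦ α(a + y) + β(b + x) - p, with (x, y) = z - p, carries the vertical and horizontal
lines through p onto the two branches. Its derivative at p is the identity, so it is realized near p
by a local isotopy, whose inverse straightens both branches together. -/
theorem exists_isotopy_onto_branches {α β : ℝ → Plane} (hα : ContDiff ℝ ∞ α) (hβ : ContDiff ℝ ∞ β)
    {a b : ℝ} {p : Plane} (hαp : α a = p) (hβp : β b = p) (hα' : deriv α a = (0, 1))
    (hβ' : deriv β b = (1, 0)) {K : Set Plane} (hK : K.Finite) (hp : p ∉ K) :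
    ∃ G : ℝ → Plane ≃ Plane, IsPlaneIsotopy G ∧ (∀ k ∈ K, ∀ᶠ z in 𝓝 k, G 1 z = z) ∧
      ∀ᶠ z in 𝓝 p, G 1 z = α (a + (z.2 - p.2)) + β (b + (z.1 - p.1)) - p := by
  obtain ⟨η, hη, key⟩ := exists_local_isotopy
  set Ψ : Plane → Plane := fun z => α (a + (z.2 - p.2)) + β (b + (z.1 - p.1)) - p with hΨ
  set r : Plane → Plane := fun z => Ψ z - z with hr
  have hΨs : ContDiff ℝ ∞ Ψ := by
    have h1 : ContDiff ℝ ∞ fun z : Plane => α (a + (z.2 - p.2)) := hα.comp (by fun_prop)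
    have h2 : ContDiff ℝ ∞ fun z : Plane => β (b + (z.1 - p.1)) := hβ.comp (by fun_prop)
    exact (h1.add h2).sub contDiff_const
  have hrs : ContDiff ℝ ∞ r := hΨs.sub contDiff_id
  have dr : Differentiable ℝ r := hrs.differentiable (by simp)
  have hr0 : r p = 0 := by simp [hr, hΨ, hαp, hβp]
  have hdr0 : fderiv ℝ r p = 0 := by
    have e1 : HasFDerivAt (fun z : Plane => a + (z.2 - p.2)) (ContinuousLinearMap.snd ℝ ℝ ℝ) p :=
      (hasFDerivAt_snd.sub_const p.2).const_add a
    have e2 : HasFDerivAt (fun z : Plane => b + (z.1 - p.1)) (ContinuousLinearMap.fst ℝ ℝ ℝ) p :=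
      (hasFDerivAt_fst.sub_const p.1).const_add b
    have f1 : HasFDerivAt α (ContinuousLinearMap.toSpanSingleton ℝ (deriv α a))
        (a + (p.2 - p.2)) := by
      rw [sub_self, add_zero]; exact ((hα.differentiable (by simp)) a).hasDerivAt.hasFDerivAt
    have f2 : HasFDerivAt β (ContinuousLinearMap.toSpanSingleton ℝ (deriv β b))
        (b + (p.1 - p.1)) := by
      rw [sub_self, add_zero]; exact ((hβ.differentiable (by simp)) b).hasDerivAt.hasFDerivAt
    have g := (((f1.comp p e1).add (f2.comp p e2)).sub_const p).sub (hasFDerivAt_id p)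
    have : HasFDerivAt r _ p := g
    rw [this.fderiv, hα', hβ']
    ext <;> simp
  have hc : Continuous (fderiv ℝ r) := hrs.continuous_fderiv (by simp)
  have hev : ∀ᶠ z in 𝓝 p, ‖fderiv ℝ r z‖ < η :=
    hc.norm.continuousAt.eventually_lt continuousAt_const (by rw [hdr0]; simpa using hη)
  obtain ⟨ε₁, hε₁, h1⟩ := Metric.eventually_nhds_iff_ball.1 hev
  obtain ⟨ε₂, hε₂, h2⟩ := Metric.nhds_basis_closedBall.mem_iff.1
    (hK.isClosed.isOpen_compl.mem_nhds hp)
  set ε := min ε₁ ε₂ with hε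
  have hε0 : 0 < ε := lt_min hε₁ hε₂
  have hb1 : ∀ z ∈ Metric.ball p ε, ‖fderiv ℝ r z‖ ≤ η := fun z hz =>
    (h1 z (Metric.ball_subset_ball (min_le_left _ _) hz)).le
  -- The displacement vanishes at p, so the mean value inequality turns the derivative bound η into
  -- the size bound η ε.
  obtain ⟨G, hG, hG1, hG2⟩ := key p ε r hε0 hrs (fun z hz => by
    have := (convex_ball p ε).norm_image_sub_le_of_norm_fderiv_le (fun y _ => dr y) hb1
      (Metric.mem_ball_self hε0) hz
    rw [hr0, sub_zero] at this
    refine this.trans ?_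
    gcongr
    exact (mem_ball_iff_norm.1 hz).le) hb1
  refine ⟨G, hG, fun k hk => ?_, ?_⟩
  · have : k ∉ Metric.closedBall p ε := fun h =>
      h2 (Metric.closedBall_subset_closedBall (min_le_right _ _) h) hk
    filter_upwards [Metric.isClosed_closedBall.isOpen_compl.mem_nhds this] with z hz
    exact hG1 z fun h => hz (Metric.ball_subset_closedBall h)
  · filter_upwards [Metric.ball_mem_nhds p (half_pos hε0)] with z hz
    rw [hG2 z hz]
    simp only [hr]
    exact add_sub_cancel _ _

/-- A frame move takes the crossing to `p` with left velocity (0, 1) and right velocity (1, 0), and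
a second isotopy straightens the branches. Both stand still near the other crossings, so their germs
survive. -/
theorem VirtualDiagram.Marked.exists_straight_at {D : VirtualDiagram} {w : GaussCode n}
    {c : Fin n → Plane} (h : D.Marked w c) (j : Fin n) {p : Plane} (hp : ∀ i, i ≠ j → c i ≠ p) :
    ∃ D', StrictEquiv D D' ∧ D'.Marked w (Function.update c j p) ∧
      (∀ x : Letter n, x.index ≠ j → D'.curve =ᶠ[𝓝 (codeTime w x)] D.curve) ∧
      ∀ x : Letter n, x.index = j →
        D'.curve =ᶠ[𝓝 (codeTime w x)] fun t => p + (t - codeTime w x) • x.dir := by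
  set K : Set Plane := c '' {i | i ≠ j} with hKdef
  have hK : K.Finite := (Set.toFinite _).image _
  have hpK : p ∉ K := by
    rintro ⟨i, hi, hc⟩; exact hp i hi hc
  have hcK : c j ∉ K := by
    rintro ⟨i, hi, hc⟩; exact hi (h.inj hc)
  have hmemK : ∀ i, i ≠ j → c i ∈ K := fun i hi => ⟨i, hi, rfl⟩
  set a := codeTime w (letterL j) with ha
  set b := codeTime w (letterR j) with hb
  have hca : D.curve a = c j := h.point (letterL j)
  have hcb : D.curve b = c j := h.point (letterR j)
  obtain ⟨H, hH, H1, H2, H3, H4⟩ := frameMove hK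
    (x := (c j, deriv D.curve a, deriv D.curve b)) (y := (p, (0, 1), (1, 0))) hcK (h.sign j) hpK
    (by simp [planeDet])
  have hαs : ContDiff ℝ ∞ fun t => H 1 (D.curve t) := (hH.contDiff 1).comp D.smooth
  have hder : ∀ t, deriv (fun t => H 1 (D.curve t)) t =
      fderiv ℝ (H 1) (D.curve t) (deriv D.curve t) := fun t => by
    have := deriv_transform (hH.contDiff 1) D.smooth contDiff_id t
    simpa using this
  obtain ⟨G, hG, G1, G2⟩ := exists_isotopy_onto_branches hαs hαs (a := a) (b := b)
    (by rw [hca]; exact H2) (by rw [hcb]; exact H2) (by rw [hder, hca]; exact H3)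
    (by rw [hder, hcb]; exact H4) hK hpK
  set D₁ := D.transform (H 1) (hH.contDiff 1) (hH.2.2 1) id isReparametrization_id with hD₁
  set D₂ := D₁.transform (G 1).symm (hG.2.2 1) (by simpa using hG.contDiff 1) id
    isReparametrization_id with hD₂
  have hcurve : ∀ t, D₂.curve t = (G 1).symm (H 1 (D.curve t)) := fun t => rfl
  have hD : Continuous D.curve := D.smooth.continuous
  have germ1 : ∀ x : Letter n, x.index ≠ j → D₂.curve =ᶠ[𝓝 (codeTime w x)] D.curve := by
    intro x hx
    have ht : Tendsto D.curve (𝓝 (codeTime w x)) (𝓝 (c x.index)) := by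
      rw [← h.point x]; exact hD.continuousAt
    filter_upwards [ht.eventually (H1 _ (hmemK _ hx)), ht.eventually (G1 _ (hmemK _ hx))] with t h1 h2
    rw [hcurve, h1, Equiv.symm_apply_eq, h2]
  have germ2 : ∀ x : Letter n, x.index = j →
      D₂.curve =ᶠ[𝓝 (codeTime w x)] fun t => p + (t - codeTime w x) • x.dir := by
    intro x hx
    have hcont : Tendsto (fun t => p + (t - codeTime w x) • x.dir) (𝓝 (codeTime w x)) (𝓝 p) := by
      have : Continuous fun t => p + (t - codeTime w x) • x.dir := by fun_prop
      have := this.tendsto (codeTime w x)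
      simpa using this
    filter_upwards [hcont.eventually G2] with t ht
    rw [hcurve, Equiv.symm_apply_eq, ht]
    rcases eq_letter x with hx' | hx' <;> rw [hx, ] at hx' <;> subst hx'
    · simp [dir_letterL, ← ha, hcb, show H 1 (c j) = p from H2]
    · simp [dir_letterR, ← hb, hca, show H 1 (c j) = p from H2]
  have hval : ∀ x : Letter n, D₂.curve (codeTime w x) = Function.update c j p x.index := by
    intro x
    by_cases hx : x.index = j
    · rw [(germ2 x hx).eq_of_nhds, hx]; simp
    · rw [(germ1 x hx).eq_of_nhds, h.point, Function.update_of_ne hx]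
  refine ⟨D₂, ?_, ⟨?_, fun q => ?_, hval, fun i => ?_⟩, germ1, germ2⟩
  · exact .trans _ _ _ (hH.strictEquiv_transform D isReparametrization_id)
      (hG.strictEquiv_transform_symm D₁)
  · intro i k hik
    by_cases hi : i = j <;> by_cases hk : k = j
    · rw [hi, hk]
    · subst hi
      rw [Function.update_self, Function.update_of_ne hk] at hik
      exact absurd hik.symm (hp k hk)
    · subst hk
      rw [Function.update_self, Function.update_of_ne hi] at hik
      exact absurd hik (hp i hi)
    · rw [Function.update_of_ne hi, Function.update_of_ne hk] at hik
      exact h.inj hik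
  · have hmem : q ∈ D₂.real ↔ ∃ d ∈ D.real, (G 1).symm (H 1 d) = q := by
      change q ∈ (D.real.map _).map _ ↔ _
      simp only [Finset.mem_map, exists_exists_and_eq_and, Equiv.coe_toEmbedding]
    have hi : ∀ i, (G 1).symm (H 1 (c i)) = Function.update c j p i := fun i => by
      have := hval (letterL i)
      rw [hcurve, h.point] at this
      exact this
    rw [hmem]
    constructor
    · rintro ⟨d, hd, rfl⟩
      obtain ⟨i, rfl⟩ := (h.real d).1 hd
      exact ⟨i, (hi i).symm⟩
    · rintro ⟨i, rfl⟩
      exact ⟨c i, (h.real _).2 ⟨i, rfl⟩, hi i⟩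
  · by_cases hi : i = j
    · subst hi
      rw [(germ2 (letterL i) rfl).deriv_eq, (germ2 (letterR i) rfl).deriv_eq, deriv_line, deriv_line,
        dir_letterL, dir_letterR]
      simp [planeDet]
    · rw [(germ1 (letterL i) hi).deriv_eq, (germ1 (letterR i) hi).deriv_eq]
      exact h.sign i

/-- The crossings are treated one after another. The old points are kept away from the new ones so
that a new position is never occupied by a crossing not yet moved. -/
theorem VirtualDiagram.Marked.exists_straight {D : VirtualDiagram} {w : GaussCode n}
    {c q : Fin n → Plane} (h : D.Marked w c) (hq : Function.Injective q)
    (hqc : ∀ i j, c i ≠ q j) :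
    ∃ D', StrictEquiv D D' ∧ D'.Marked w q ∧ ∀ x : Letter n,
      D'.curve =ᶠ[𝓝 (codeTime w x)] fun t => q x.index + (t - codeTime w x) • x.dir := by
  have key : ∀ S : Finset (Fin n), ∃ D', StrictEquiv D D' ∧
      D'.Marked w (fun j => if j ∈ S then q j else c j) ∧ ∀ x : Letter n, x.index ∈ S →
      D'.curve =ᶠ[𝓝 (codeTime w x)] fun t => q x.index + (t - codeTime w x) • x.dir := by
    intro S
    induction S using Finset.induction_on with
    | empty => exact ⟨D, .refl _, by simpa using h, by simp⟩
    | insert j S hj ih =>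
      obtain ⟨D₁, h1, h2, h3⟩ := ih
      obtain ⟨D₂, k1, k2, k3, k4⟩ := h2.exists_straight_at j (p := q j) (fun i hi => by
        split_ifs with hS
        · exact fun h => hi (hq h)
        · exact hqc i j)
      refine ⟨D₂, .trans _ _ _ h1 k1, ?_, fun x hx => ?_⟩
      · convert k2 using 1
        funext i
        by_cases hi : i = j
        · subst hi; simp
        · rw [Function.update_of_ne hi]
          simp [hi]
      · by_cases hxj : x.index = j
        · have := k4 x hxj
          rwa [← hxj] at this
        · exact (k3 x hxj).trans (h3 x ((Finset.mem_insert.1 hx).resolve_left hxj))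
  obtain ⟨D', h1, h2, h3⟩ := key Finset.univ
  exact ⟨D', h1, by simpa using h2, fun x => h3 x (Finset.mem_univ _)⟩

end

/-! ### Replacing semiarcs -/

theorem GenericOn.congr {γ γ' : ℝ → Plane} {V : Set ℝ} (h : GenericOn γ V)
    (h0 : ∀ t ∈ V, γ' t = γ t) (h1 : ∀ t ∈ V, deriv γ' t = deriv γ t) : GenericOn γ' V := by
  refine ⟨fun t ht => by rw [h1 t ht]; exact h.immersed t ht, fun s hs t ht hst hne => ?_,
    fun r hr s hs t ht hrs hrt => ?_⟩
  · rw [h1 s hs, h1 t ht]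
    rw [h0 s hs, h0 t ht] at hst
    exact h.transverse s hs t ht hst hne
  · rw [h0 r hr, h0 s hs] at hrs
    rw [h0 r hr, h0 t ht] at hrt
    exact h.no_triple r hr s hs t ht hrs hrt

theorem VirtualDiagram.genericOn (D : VirtualDiagram) (V : Set ℝ) : GenericOn D.curve V :=
  ⟨fun t _ => D.immersed t, fun s _ t _ => D.transverse s t, fun r _ s _ t _ => D.no_triple r s t⟩

/-- The function used to perturb on the arc around `m`. -/
noncomputable def arcSin (m t : ℝ) : ℝ := Real.sin (2 * Real.pi * (t - m))

theorem contDiff_arcSin (m : ℝ) : ContDiff ℝ ∞ (arcSin m) := by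
  unfold arcSin
  exact Real.contDiff_sin.comp (by fun_prop)

theorem arcSin_add_int (m t : ℝ) (k : ℤ) : arcSin m (t + k) = arcSin m t := by
  unfold arcSin
  rw [show t + (k : ℝ) - m = t - m + k by ring, sin_two_pi_mul_add_int]

theorem cos_pos_of_abs_lt {m ρ t : ℝ} (hρ : ρ < 1 / 4) {k : ℤ} (h : |t - m + k| < ρ) :
    0 < Real.cos (2 * Real.pi * (t - m)) := by
  rw [← cos_two_pi_mul_add_int _ k]
  have hpi := Real.pi_pos
  rw [abs_lt] at h
  apply Real.cos_pos_of_mem_Ioo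
  constructor <;> nlinarith

section
variable {m ρ' ρ : ℝ}

theorem deriv_arcSin_ne_zero (hρ : ρ < 1 / 4) {t : ℝ} {k : ℤ} (h : |t - m + k| < ρ) :
    deriv (arcSin m) t ≠ 0 := by
  have h1 : HasDerivAt (fun t : ℝ => 2 * Real.pi * (t - m)) (2 * Real.pi) t := by
    simpa using ((hasDerivAt_id t).sub_const m).const_mul (2 * Real.pi)
  have h2 := (Real.hasDerivAt_sin (2 * Real.pi * (t - m))).comp t h1
  have : deriv (arcSin m) t = Real.cos (2 * Real.pi * (t - m)) * (2 * Real.pi) := h2.deriv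
  rw [this]
  exact mul_ne_zero (cos_pos_of_abs_lt hρ h).ne' Real.two_pi_pos.ne'

theorem samePoint_of_arcSin_eq (hρ : ρ < 1 / 4) {s t : ℝ} {k l : ℤ} (hs : |s - m + k| < ρ)
    (ht : |t - m + l| < ρ) (h : arcSin m s = arcSin m t) : SamePoint s t := by
  have c1 := cos_pos_of_abs_lt hρ hs
  have c2 := cos_pos_of_abs_lt hρ ht
  unfold arcSin at h
  have hcos : Real.cos (2 * Real.pi * (s - m)) = Real.cos (2 * Real.pi * (t - m)) := by
    have e1 := Real.sin_sq_add_cos_sq (2 * Real.pi * (s - m))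
    have e2 := Real.sin_sq_add_cos_sq (2 * Real.pi * (t - m))
    rw [h] at e1
    have : Real.cos (2 * Real.pi * (s - m)) ^ 2 = Real.cos (2 * Real.pi * (t - m)) ^ 2 := by linarith
    exact (pow_left_inj₀ c1.le c2.le two_ne_zero).1 this
  have hang := Real.Angle.cos_sin_inj hcos h
  obtain ⟨q, hq⟩ := Real.Angle.angle_eq_iff_two_pi_dvd_sub.1 hang
  refine SamePoint.symm ⟨q, ?_⟩
  have hpi := Real.two_pi_pos.ne'
  have : 2 * Real.pi * (s - t - q) = 0 := by linear_combination hq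
  have := (mul_eq_zero.1 this).resolve_left hpi
  linarith

theorem deriv_arcBump_eq_zero {t : ℝ} (h : arcBump m ρ' ρ t = 0) :
    deriv (arcBump m ρ' ρ) t = 0 :=
  IsLocalMin.deriv_eq_zero (Eventually.of_forall fun s => by
    rw [h]; exact arcBump_nonneg _ _ _ _)

/-- On an arc of half-length less than 1/4 the sine is injective modulo 1 and has nonzero
derivative, so it can serve as the coordinate `g` while remaining periodic. -/
theorem ae_genericOn_arc (h0 : 0 < ρ') (h1 : ρ' < ρ) (h2 : ρ < 1 / 4) {β : ℝ → Plane}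
    (hβ : ContDiff ℝ ∞ β) {V : Set ℝ} (hV : ∀ t ∈ V, arcBump m ρ' ρ t = 0) (h : GenericOn β V) :
    ∀ᵐ l : Perturbation, GenericOn (perturb β (arcBump m ρ' ρ) (arcSin m) l)
      (V ∪ {t | arcBump m ρ' ρ t ≠ 0}) := by
  refine ae_genericOn_perturb hβ (contDiff_arcBump _ _ _) (contDiff_arcSin m)
    (arcBump_nonneg _ _ _) hV (fun t ht => ?_) (fun s t hs ht hst => ?_) h
  · obtain ⟨k, hk⟩ := (arcBump_ne_zero_iff h0 h1 (by linarith)).1 ht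
    exact deriv_arcSin_ne_zero h2 hk
  · obtain ⟨k, hk⟩ := (arcBump_ne_zero_iff h0 h1 (by linarith)).1 hs
    obtain ⟨l, hl⟩ := (arcBump_ne_zero_iff h0 h1 (by linarith)).1 ht
    exact samePoint_of_arcSin_eq h2 hk hl hst

theorem periodic_perturb_arc {β : ℝ → Plane} (hβ : Function.Periodic β 1) (l : Perturbation) :
    Function.Periodic (perturb β (arcBump m ρ' ρ) (arcSin m) l) 1 := by
  intro t
  have e1 := arcBump_add_int m ρ' ρ t 1
  have e2 := arcSin_add_int m t 1
  rw [Int.cast_one] at e1 e2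
  simp only [perturb, e1, e2, hβ t]

/-- The curve `β` agrees with `D` off the arc but is arbitrary on it; a perturbation supported on
the arc makes it generic. The new arc then misses the real crossings automatically. -/
theorem VirtualDiagram.ae_detourMove (D : VirtualDiagram) (h0 : 0 < ρ') (h1 : ρ' < ρ)
    (h2 : ρ < 1 / 4) (hD : ∀ t, |t - m| ≤ ρ → D.curve t ∉ D.real) {β : ℝ → Plane}
    (hβ : ContDiff ℝ ∞ β) (hβp : Function.Periodic β 1)
    (hβ0 : ∀ t, arcBump m ρ' ρ t = 0 → β t = D.curve t)
    (hβ1 : ∀ t, arcBump m ρ' ρ t = 0 → deriv β t = deriv D.curve t) :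
    ∀ᵐ l : Perturbation, ∃ D' : VirtualDiagram,
      D'.curve = perturb β (arcBump m ρ' ρ) (arcSin m) l ∧ D'.real = D.real ∧ DetourMove D D' := by
  set φ := arcBump m ρ' ρ with hφ
  have hgen : GenericOn β {t | φ t = 0} := (D.genericOn _).congr hβ0 hβ1
  filter_upwards [ae_genericOn_arc h0 h1 h2 hβ (V := {t | φ t = 0}) (fun t ht => ht) hgen] with l hl
  set γ := perturb β φ (arcSin m) l with hγ
  have hmem : ∀ t, t ∈ {t | φ t = 0} ∪ {t | φ t ≠ 0} := fun t => em (φ t = 0)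
  have hγ0 : ∀ t, φ t = 0 → γ t = D.curve t := fun t ht => by
    rw [hγ, perturb_eq_of_eq_zero ht, hβ0 t ht]
  have hne : ∀ t, φ t ≠ 0 ↔ ∃ k : ℤ, |t - m + k| < ρ := fun t =>
    arcBump_ne_zero_iff h0 h1 (by linarith)
  have hreal : ∀ t, D.curve t ∈ D.real → φ t = 0 := by
    intro t ht
    by_contra hcon
    obtain ⟨k, hk⟩ := (hne t).1 hcon
    refine hD (t + k) ?_ ?_
    · rw [show t + (k : ℝ) - m = t - m + k by ring]; exact hk.le
    · rwa [D.curve_add_int]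
  have hsame : ∀ s t, SamePoint s t → φ s = 0 → φ t = 0 := by
    rintro s t ⟨k, rfl⟩ hs
    rw [hφ, arcBump_add_int]; exact hs
  have hcross : ∀ c ∈ D.real, ∃ s t, ¬ SamePoint s t ∧ φ s = 0 ∧ φ t = 0 ∧ γ s = c ∧ γ t = c := by
    intro c hc
    obtain ⟨s, t, hst, hs, ht⟩ := D.real_crossing c hc
    have h3 : φ s = 0 := hreal s (by rwa [hs])
    have h4 : φ t = 0 := hreal t (by rwa [ht])
    exact ⟨s, t, hst, h3, h4, by rw [hγ0 s h3, hs], by rw [hγ0 t h4, ht]⟩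
  let D' : VirtualDiagram :=
    { curve := γ
      periodic := periodic_perturb_arc hβp l
      smooth := contDiff_perturb hβ (contDiff_arcBump _ _ _) (contDiff_arcSin m) l
      immersed := fun t => hl.immersed t (hmem t)
      transverse := fun s t => hl.transverse s (hmem s) t (hmem t)
      no_triple := fun r s t => hl.no_triple r (hmem r) s (hmem s) t (hmem t)
      real := D.real
      real_crossing := fun c hc => by
        obtain ⟨s, t, hst, -, -, hs, ht⟩ := hcross c hc
        exact ⟨s, t, hst, hs, ht⟩ }
  refine ⟨D', rfl, rfl, rfl, m - ρ, m + ρ, by linarith, by linarith, fun t ht => ?_, fun t ht => ?_⟩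
  · have ht' : |t - m| ≤ ρ := abs_le.2 ⟨by linarith [ht.1], by linarith [ht.2]⟩
    refine ⟨hD t ht', fun hr => ?_⟩
    by_cases hz : φ t = 0
    · have : D'.curve t = D.curve t := hγ0 t hz
      rw [this] at hr
      exact hD t ht' hr
    -- A real crossing already has two distinct preimages off the arc; a third on the arc would be a
    -- triple point.
    · obtain ⟨s, u, hsu, hs0, hu0, hs, hu⟩ := hcross _ hr
      rcases D'.no_triple t s u hs.symm hu.symm with h | h | h
      · exact hz (hsame _ _ h.symm hs0)
      · exact hz (hsame _ _ h.symm hu0)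
      · exact hsu h
  · refine hγ0 t ?_
    by_contra hcon
    obtain ⟨k, hk⟩ := (hne t).1 hcon
    rw [abs_lt] at hk
    exact ht k ⟨by linarith [hk.1], by linarith [hk.2]⟩

end

/-! ### Exchange of all semiarcs -/

theorem VirtualDiagram.ext_of_eq {D D' : VirtualDiagram} (h : D.curve = D'.curve)
    (hr : D.real = D'.real) : D = D' := by
  cases D; cases D'
  simp only [VirtualDiagram.mk.injEq]
  exact ⟨h, hr⟩

/-- The middle of the `k`-th semiarc. -/
noncomputable def arcMid (N k : ℕ) : ℝ := (k + 1 / 2) / N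

/-- Distinct midpoints differ modulo 1 by nonzero multiples of 1/N, so arcs of half-length at most
1/(2N) do not overlap. -/
theorem arcMid_separated {N : ℕ} {ρ : ℝ} (hρ : ρ ≤ 1 / (2 * N)) {i k : ℕ} (hi : i < N)
    (hk : k < N) (hik : i ≠ k) {t : ℝ} {p : ℤ} (ht : |t - arcMid N i + p| ≤ ρ) (q : ℤ) :
    ρ ≤ |t - arcMid N k + q| := by
  have hN0 : (0 : ℝ) < N := by exact_mod_cast (by omega : 0 < N)
  have hne : (k : ℤ) - i + (p - q) * N ≠ 0 := by
    intro h
    have h1 : (N : ℤ) ∣ k - i := ⟨q - p, by linear_combination h⟩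
    have h2 : ((k : ℤ) - i) = 0 := Int.eq_zero_of_abs_lt_dvd h1 (by rw [abs_lt]; omega)
    omega
  have h1 : (1 : ℝ) ≤ |((k : ℤ) - i + (p - q) * N : ℤ)| := by
    exact_mod_cast Int.one_le_abs hne
  have h2 : ((t - arcMid N i + p) - (t - arcMid N k + q)) * N = ((k : ℤ) - i + (p - q) * N : ℤ) := by
    unfold arcMid
    push_cast
    field_simp
    ring
  have h3 : (1 : ℝ) / N ≤ |(t - arcMid N i + p) - (t - arcMid N k + q)| := by
    have h2' := congrArg abs h2
    rw [abs_mul, abs_of_pos hN0] at h2'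
    rw [div_le_iff₀ hN0, h2']
    exact_mod_cast h1
  have h4 := abs_sub (t - arcMid N i + p) (t - arcMid N k + q)
  have h5 : (1 : ℝ) / N = 2 * (1 / (2 * N)) := by field_simp
  linarith

/-- Arcs are removed from `S` one at a time. Transplanting an arc of `D` into `D'` may fail to be
generic, so `D` and the transplanted curve are perturbed on that arc by the same amount. Each result
is one detour move away from its origin, and the two now agree there too. -/
theorem strictEquiv_of_eq_off_arcs {N : ℕ} (hN : 2 ≤ N) {ρ' ρ : ℝ} (h0 : 0 < ρ') (h1 : ρ' < ρ)
    (h2 : ρ < 1 / (2 * N)) (S : Finset ℕ) : ∀ (_ : ∀ k ∈ S, k < N) (D D' : VirtualDiagram)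
    (_ : D'.real = D.real)
    (_ : ∀ k ∈ S, ∀ t, |t - arcMid N k| ≤ ρ → D.curve t ∉ D.real ∧ D'.curve t ∉ D'.real)
    (_ : ∀ t, (∀ k ∈ S, ∀ j : ℤ, ρ' < |t - arcMid N k + j|) → D.curve t = D'.curve t),
    StrictEquiv D D' := by
  have hN' : (2 : ℝ) ≤ N := by exact_mod_cast hN
  have h3 : ρ < 1 / 4 := by
    refine lt_of_lt_of_le h2 ?_
    rw [div_le_div_iff₀ (by linarith) (by norm_num)]; linarith
  induction S using Finset.induction_on with
  | empty =>
    intro _ D D' hr _ he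
    rw [VirtualDiagram.ext_of_eq (funext fun t => he t (by simp)) hr.symm]
    exact .refl _
  | insert k S hk ih =>
    intro hS D D' hr hnc he
    set m := arcMid N k with hm
    set φ := arcBump m ρ' ρ with hφ
    have hφs : ContDiff ℝ ∞ φ := contDiff_arcBump _ _ _
    -- `D'` with the inner part of the arc taken from `D`. In the collar between ρ' and ρ, where the
    -- interpolation takes place, the two curves agree because of `he` and the separation of the
    -- arcs.
    set β : ℝ → Plane := fun t => D'.curve t + φ t • (D.curve t - D'.curve t) with hβ
    have hβs : ContDiff ℝ ∞ β := D'.smooth.add (hφs.smul (D.smooth.sub D'.smooth))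
    have hβp : Function.Periodic β 1 := by
      intro t
      have e1 := arcBump_add_int m ρ' ρ t 1
      rw [Int.cast_one] at e1
      simp only [hβ, D.periodic t, D'.periodic t, hφ, e1]
    have hβ0 : ∀ t, φ t = 0 → β t = D'.curve t := fun t ht => by simp [hβ, ht]
    have hβ1 : ∀ t, φ t = 0 → deriv β t = deriv D'.curve t := by
      intro t ht
      have a1 := ((D.smooth.differentiable (by simp)) t).hasDerivAt
      have a2 := ((D'.smooth.differentiable (by simp)) t).hasDerivAt
      have a3 := ((hφs.differentiable (by simp)) t).hasDerivAt
      have : HasDerivAt β _ t := a2.add (a3.smul (a1.sub a2))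
      rw [this.deriv, ht, deriv_arcBump_eq_zero ht]
      simp
    have hkS : k ∈ insert k S := Finset.mem_insert_self k S
    have ae1 := D.ae_detourMove h0 h1 h3 (fun t ht => (hnc k hkS t ht).1) D.smooth D.periodic
      (fun _ _ => rfl) (fun _ _ => rfl)
    have ae2 := D'.ae_detourMove h0 h1 h3 (fun t ht => (hnc k hkS t ht).2) hβs hβp hβ0 hβ1
    -- Two conditions that hold for almost every parameter hold together for some common one.
    obtain ⟨l, ⟨E, hE, hEr, hEd⟩, E', hE', hEr', hEd'⟩ := (ae1.and ae2).exists
    refine .trans _ _ _ (.rel _ _ (.inr hEd)) (.trans _ _ _ (ih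
      (fun i hi => hS i (Finset.mem_insert_of_mem hi)) E E' (by rw [hEr', hEr, hr]) ?_ ?_)
      (.symm _ _ (.rel _ _ (.inr hEd'))))
    · intro i hi t ht
      have hik : i ≠ k := by rintro rfl; exact hk hi
      have hz : φ t = 0 := by
        refine arcBump_eq_zero h0 h1 (by linarith) fun q => ?_
        exact arcMid_separated h2.le (hS i (Finset.mem_insert_of_mem hi)) (hS k hkS) hik
          (p := 0) (by simpa using ht) q
      obtain ⟨n1, n2⟩ := hnc i (Finset.mem_insert_of_mem hi) t ht
      rw [hE, hE', hEr, hEr', perturb_eq_of_eq_zero hz, perturb_eq_of_eq_zero hz, hβ0 t hz]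
      exact ⟨n1, n2⟩
    · intro t ht
      have : D.curve t = β t := by
        by_cases hin : ∃ j : ℤ, |t - m + j| ≤ ρ'
        · obtain ⟨j, hj⟩ := hin
          have : φ t = 1 := arcBump_eq_one h0 h1 (by linarith) hj
          simp [hβ, this]
        · push Not at hin
          have := he t fun i hi j => by
            rcases Finset.mem_insert.1 hi with rfl | hi
            · exact hin j
            · exact ht i hi j
          simp [hβ, this]
      rw [hE, hE']
      simp only [perturb, this]

/-- A parameter is close to a multiple of `1 / N`, or inside an arc between two such multiples. -/
theorem exists_near_or_mem_arc {N : ℕ} (hN : 0 < N) (δ t : ℝ) :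
    (∃ (i : ℕ) (j : ℤ), i < N ∧ |t + j - i / N| ≤ δ) ∨
      ∃ (k : ℕ) (j : ℤ), k < N ∧ |t - arcMid N k + j| < 1 / (2 * N) - δ := by
  have hN0 : (0 : ℝ) < N := by exact_mod_cast hN
  set z : ℤ := ⌊N * t⌋ with hz
  have z1 : (z : ℝ) ≤ N * t := Int.floor_le _
  have z2 : N * t < z + 1 := Int.lt_floor_add_one _
  have hdecomp : ∀ y : ℤ, ∃ (i : ℕ) (j : ℤ), i < N ∧ (y : ℝ) / N + j = i / N := by
    intro y
    have hNz : (0 : ℤ) < N := by exact_mod_cast hN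
    have e1 := Int.emod_nonneg y hNz.ne'
    have e2 := Int.emod_lt_of_pos y hNz
    refine ⟨(y % N).toNat, -(y / N), by omega, ?_⟩
    have e3 : ((y % N).toNat : ℝ) = ((y % N : ℤ) : ℝ) := by
      exact_mod_cast congrArg (Int.cast (R := ℝ)) (Int.toNat_of_nonneg e1)
    have e4 : (y : ℝ) = (y % N : ℤ) + N * (y / N : ℤ) := by
      exact_mod_cast (Int.emod_add_mul_ediv y N).symm
    rw [e3, e4]
    push_cast
    field_simp
    ring
  by_cases hlow : t - z / N ≤ δ
  · obtain ⟨i, j, hi, hij⟩ := hdecomp z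
    refine .inl ⟨i, j, hi, ?_⟩
    rw [← hij, abs_of_nonneg] <;> rw [show t + (j : ℝ) - (z / N + j) = t - z / N by ring]
    · exact hlow
    · rw [sub_nonneg, div_le_iff₀ hN0]; linarith
  by_cases hup : (z + 1 : ℝ) / N - t ≤ δ
  · obtain ⟨i, j, hi, hij⟩ := hdecomp (z + 1)
    refine .inl ⟨i, j, hi, ?_⟩
    rw [← hij, abs_sub_comm, abs_of_nonneg] <;>
      rw [show ((z + 1 : ℤ) : ℝ) / N + (j : ℝ) - (t + j) = (z + 1 : ℝ) / N - t by push_cast; ring]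
    · exact hup
    · rw [sub_nonneg, le_div_iff₀ hN0]; linarith
  · right
    obtain ⟨k, j, hk, hkj⟩ := hdecomp z
    refine ⟨k, j, hk, ?_⟩
    push Not at hlow hup
    have e : t - arcMid N k + j = t - z / N - 1 / (2 * N) := by
      unfold arcMid
      rw [add_div, ← hkj]
      field_simp
      ring
    rw [e, abs_lt]
    have e2 : (z + 1 : ℝ) / N = z / N + 2 * (1 / (2 * N)) := by field_simp
    constructor <;> linarith

section
variable {n : ℕ}

theorem codeTime_getElem (w : GaussCode n) {i : ℕ} (hi : i < w.1.length) :
    codeTime w w.1[i] = i / (2 * n : ℕ) := by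
  unfold codeTime
  rw [w.nodup.idxOf_getElem]

theorem VirtualDiagram.Marked.notMem_real_of_mem_arc [NeZero n] {D : VirtualDiagram}
    {w : GaussCode n} {q : Fin n → Plane} (h : D.Marked w q) {ρ : ℝ}
    (hρ : ρ < 1 / (2 * (2 * n : ℕ))) {k : ℕ} {t : ℝ} (ht : |t - arcMid (2 * n) k| ≤ ρ) :
    D.curve t ∉ D.real := by
  intro hr
  have hN0 : (0 : ℝ) < (2 * n : ℕ) := by
    have := NeZero.ne n
    exact_mod_cast (by omega : 0 < 2 * n)
  obtain ⟨x, j, hj⟩ := h.exists_samePoint hr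
  have h1 : (t - arcMid (2 * n) k) * (2 * n : ℕ) =
      ((w.1.idxOf x + j * (2 * n : ℕ) - k : ℤ) : ℝ) - 1 / 2 := by
    have hn : (n : ℝ) ≠ 0 := Nat.cast_ne_zero.2 (NeZero.ne n)
    rw [hj]
    unfold codeTime arcMid
    push_cast
    field_simp
    ring
  have h2 : |((w.1.idxOf x + j * (2 * n : ℕ) - k : ℤ) : ℝ) - 1 / 2| < 1 / 2 := by
    rw [← h1, abs_mul, abs_of_pos hN0]
    calc _ ≤ ρ * (2 * n : ℕ) := by gcongr
      _ < 1 / (2 * (2 * n : ℕ)) * (2 * n : ℕ) := by gcongr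
      _ = 1 / 2 := by field_simp
  -- A crossing inside the arc would yield an integer strictly between 0 and 1.
  rw [abs_lt] at h2
  have h3 : (0 : ℝ) < ((w.1.idxOf x + j * (2 * n : ℕ) - k : ℤ) : ℝ) := by linarith [h2.1]
  have h4 : ((w.1.idxOf x + j * (2 * n : ℕ) - k : ℤ) : ℝ) < 1 := by linarith [h2.2]
  have h5 : (0 : ℤ) < w.1.idxOf x + j * (2 * n : ℕ) - k := by exact_mod_cast h3
  have h6 : (w.1.idxOf x + j * (2 * n : ℕ) - k : ℤ) < 1 := by exact_mod_cast h4
  omega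

/-- Equality of germs at the finitely many code times gives equality within a uniform distance δ of
all of them, so the curves differ only in arcs of half-length 1/(4n) - δ around the midpoints, which
contain no real crossing. -/
theorem VirtualDiagram.Marked.strictEquiv [NeZero n] {D D' : VirtualDiagram} {w : GaussCode n}
    {q : Fin n → Plane} (h : D.Marked w q) (h' : D'.Marked w q)
    (hg : ∀ x, D.curve =ᶠ[𝓝 (codeTime w x)] D'.curve) : StrictEquiv D D' := by
  have hn := NeZero.ne n
  have hN0 : (0 : ℝ) < (2 * n : ℕ) := by exact_mod_cast (by omega : 0 < 2 * n)
  obtain ⟨ε, hε, hεg⟩ : ∃ ε > 0, ∀ s, |s| < ε → ∀ x, D.curve (codeTime w x + s) =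
      D'.curve (codeTime w x + s) := by
    have : ∀ᶠ s in 𝓝 (0 : ℝ), ∀ x, D.curve (codeTime w x + s) = D'.curve (codeTime w x + s) := by
      rw [eventually_all]
      intro x
      have ht : Tendsto (fun s => codeTime w x + s) (𝓝 0) (𝓝 (codeTime w x)) := by
        have : Continuous fun s => codeTime w x + s := by fun_prop
        simpa using this.tendsto 0
      exact ht.eventually (hg x)
    obtain ⟨ε, hε, h⟩ := Metric.eventually_nhds_iff.1 this
    exact ⟨ε, hε, fun s hs => h (by simpa using hs)⟩
  set R : ℝ := 1 / (2 * (2 * n : ℕ)) with hR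
  have hR0 : 0 < R := by positivity
  set δ := min (ε / 2) (R / 2) with hδ
  have hδ0 : 0 < δ := lt_min (by linarith) (by linarith)
  have hδ1 : δ < ε := lt_of_le_of_lt (min_le_left _ _) (by linarith)
  have hδ2 : δ ≤ R / 2 := min_le_right _ _
  refine strictEquiv_of_eq_off_arcs (N := 2 * n) (by omega) (ρ' := R - δ) (ρ := R - δ / 2)
    (by linarith) (by linarith) (by linarith) (Finset.range (2 * n))
    (fun k hk => Finset.mem_range.1 hk) D D' ?_ ?_ ?_
  · ext p
    rw [h.real, h'.real]
  · intro k _ t ht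
    exact ⟨h.notMem_real_of_mem_arc (by linarith) ht, h'.notMem_real_of_mem_arc (by linarith) ht⟩
  · intro t ht
    rcases exists_near_or_mem_arc (N := 2 * n) (by omega) δ t with ⟨i, j, hi, hij⟩ | ⟨k, j, hk, hkj⟩
    · have hi' : i < w.1.length := by rw [w.2.1]; exact hi
      have := hεg (t + j - i / (2 * n : ℕ)) (by linarith) w.1[i]
      rw [codeTime_getElem, add_sub_cancel, D.curve_add_int, D'.curve_add_int] at this
      exact this
    · have := ht k (Finset.mem_range.2 hk) j
      linarith

theorem VirtualDiagram.HasGaussCode.strictEquiv [NeZero n] {D D' : VirtualDiagram}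
    {w : GaussCode n} (h : D.HasGaussCode w) (h' : D'.HasGaussCode w) : StrictEquiv D D' := by
  obtain ⟨E, c, hE, hm⟩ := h.exists_marked
  obtain ⟨E', c', hE', hm'⟩ := h'.exists_marked
  -- The common target points avoid the crossings of both diagrams, as the straightening requires.
  have hF : (range c ∪ range c').Finite := (finite_range c).union (finite_range c')
  have hinf : ((range c ∪ range c')ᶜ).Infinite := hF.infinite_compl
  set e := hinf.natEmbedding
  set q : Fin n → Plane := fun j => (e j.val).1 with hq
  have hqi : Function.Injective q := fun i j hij =>
    Fin.val_injective (e.injective (Subtype.ext hij))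
  have hqc : ∀ i j, c i ≠ q j := fun i j h => (e j.val).2 (.inl ⟨i, h⟩)
  have hqc' : ∀ i j, c' i ≠ q j := fun i j h => (e j.val).2 (.inr ⟨i, h⟩)
  obtain ⟨F, h1, h2, h3⟩ := hm.exists_straight hqi hqc
  obtain ⟨F', h1', h2', h3'⟩ := hm'.exists_straight hqi hqc'
  have hFF : StrictEquiv F F' := h2.strictEquiv h2' fun x => (h3 x).trans (h3' x).symm
  exact ((hE.trans _ _ _ h1).trans _ _ _ hFF).trans _ _ _ ((hE'.trans _ _ _ h1').symm _ _)

end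
end VirtualDoodle

namespace VirtualDoodle
open Set Filter Topology

/-! ### Realizing Gauss codes -/

section
variable {n : ℕ}

theorem hasDerivAt_arcSin (m t : ℝ) : HasDerivAt (arcSin m) (deriv (arcSin m) t) t :=
  ((contDiff_arcSin m).differentiable (by simp) t).hasDerivAt

theorem deriv_arcSin_self_pos (m : ℝ) : 0 < deriv (arcSin m) m := by
  have h1 : HasDerivAt (fun t : ℝ => 2 * Real.pi * (t - m)) (2 * Real.pi) m := by
    simpa using ((hasDerivAt_id m).sub_const m).const_mul (2 * Real.pi)
  have : deriv (arcSin m) m = Real.cos (2 * Real.pi * (m - m)) * (2 * Real.pi) :=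
    ((Real.hasDerivAt_sin (2 * Real.pi * (m - m))).comp m h1).deriv
  rw [this, sub_self, mul_zero, Real.cos_zero, one_mul]
  exact Real.two_pi_pos

theorem abs_arcSin_le_one (m t : ℝ) : |arcSin m t| ≤ 1 := Real.abs_sin_le_one _

theorem arcSin_self (m : ℝ) : arcSin m m = 0 := by simp [arcSin]

theorem codeTime_separated (w : GaussCode n) {x y : Letter n} (hxy : x ≠ y) {t : ℝ} {p : ℤ}
    (ht : |t - codeTime w x + p| ≤ 1 / (2 * (2 * n : ℕ))) (q : ℤ) :
    1 / (2 * (2 * n : ℕ)) ≤ |t - codeTime w y + q| := by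
  have e : ∀ (z : Letter n) (r : ℤ), t + 1 / (2 * (2 * n : ℕ)) - arcMid (2 * n) (w.1.idxOf z) + r =
      t - codeTime w z + r := fun z r => by
    unfold codeTime arcMid
    rw [add_div, div_div]
    ring
  rw [← e] at ht ⊢
  exact arcMid_separated le_rfl (idxOf_lt w x) (idxOf_lt w y)
    (fun h => hxy ((List.idxOf_inj (w.2.2 x)).1 h)) ht q

/-- Midpoints and code times differ by odd multiples of half a step, hence by at least half a step.
-/
theorem arcMid_codeTime_separated [NeZero n] (w : GaussCode n) (x : Letter n) {δ t : ℝ} {p : ℤ}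
    (ht : |t - codeTime w x + p| ≤ δ) (k : ℕ) (q : ℤ) :
    1 / (2 * (2 * n : ℕ)) - δ ≤ |t - arcMid (2 * n) k + q| := by
  have hn := NeZero.ne n
  have hN0 : (0 : ℝ) < (2 * n : ℕ) := by exact_mod_cast (by omega : 0 < 2 * n)
  set z : ℤ := 2 * (k - w.1.idxOf x + (p - q) * (2 * n : ℕ)) + 1 with hz
  have h1 : (1 : ℝ) ≤ |(z : ℝ)| := by exact_mod_cast Int.one_le_abs (by omega : z ≠ 0)
  have h2 : ((t - codeTime w x + p) - (t - arcMid (2 * n) k + q)) * (2 * (2 * n : ℕ)) = z := by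
    have hn' : (n : ℝ) ≠ 0 := Nat.cast_ne_zero.2 hn
    rw [hz]
    unfold codeTime arcMid
    push_cast
    field_simp
    ring
  have h2' := congrArg abs h2
  rw [abs_mul, abs_of_pos (by linarith : (0 : ℝ) < 2 * (2 * n : ℕ))] at h2'
  have h3 : (1 : ℝ) / (2 * (2 * n : ℕ)) ≤ |(t - codeTime w x + p) - (t - arcMid (2 * n) k + q)| := by
    rw [div_le_iff₀ (by linarith), h2']
    exact h1
  have h4 := abs_sub (t - codeTime w x + p) (t - arcMid (2 * n) k + q)
  linarith

/-- The vertices of the realized Gauss codes. -/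
def vertex (j : Fin n) : Plane := (3 * (j : ℝ), 0)

theorem vertex_injective : Function.Injective (vertex : Fin n → Plane) := by
  intro i j h
  have := congrArg Prod.fst h
  simp only [vertex] at this
  exact Fin.val_injective (by exact_mod_cast (mul_left_cancel₀ three_ne_zero this))

/-- The vertices are three apart and the segments reach at most one to either side, so crosses at
distinct vertices are disjoint. -/
theorem index_eq_of_vertex_add_eq {x y : Letter n} {a b : ℝ} (ha : |a| ≤ 1) (hb : |b| ≤ 1)
    (h : vertex x.index + a • x.dir = vertex y.index + b • y.dir) : x.index = y.index := by
  have hd : ∀ (z : Letter n) (c : ℝ), |c| ≤ 1 → |c * z.dir.1| ≤ 1 := by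
    intro z c hc
    rcases eq_letter z with hz | hz <;> rw [hz]
    · simp [dir_letterL]
    · simpa [dir_letterR] using hc
  have h1 := congrArg Prod.fst h
  simp only [vertex, Prod.fst_add, Prod.smul_fst, smul_eq_mul] at h1
  have h2 := abs_le.1 (hd x a ha)
  have h3 := abs_le.1 (hd y b hb)
  have h4 : ((x.index : ℕ) : ℝ) < (y.index : ℕ) + 1 := by linarith [h2.1, h3.2]
  have h5 : ((y.index : ℕ) : ℝ) < (x.index : ℕ) + 1 := by linarith [h2.2, h3.1]
  have h6 : (x.index : ℕ) < y.index + 1 := by exact_mod_cast h4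
  have h7 : (y.index : ℕ) < x.index + 1 := by exact_mod_cast h5
  exact Fin.ext (by omega)

theorem smul_dir_injective (x : Letter n) : Function.Injective fun a : ℝ => a • x.dir := by
  intro a b h
  rcases eq_letter x with hx | hx <;> rw [hx] at h
  · simpa [dir_letterL] using h
  · simpa [dir_letterR] using h

theorem planeDet_dir_ne_zero {x y : Letter n} (h : x.index = y.index) (hxy : x ≠ y) :
    planeDet x.dir y.dir ≠ 0 := by
  rcases eq_letter x with hx | hx <;> rcases eq_letter y with hy | hy
  · exact absurd (by rw [hx, hy, h]) hxy
  · rw [hx, hy]; simp [dir_letterL, dir_letterR, planeDet]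
  · rw [hx, hy]; simp [dir_letterL, dir_letterR, planeDet]
  · exact absurd (by rw [hx, hy, h]) hxy

theorem eq_or_eq_or_eq_of_index {x y z : Letter n} (hxy : x.index = y.index)
    (hxz : x.index = z.index) : x = y ∨ x = z ∨ y = z := by
  have hyz := hxy.symm.trans hxz
  rcases eq_letter x with hx | hx <;> rcases eq_letter y with hy | hy <;>
    rcases eq_letter z with hz | hz
  · exact .inl (by rw [hx, hy, hxy])
  · exact .inl (by rw [hx, hy, hxy])
  · exact .inr (.inl (by rw [hx, hz, hxz]))
  · exact .inr (.inr (by rw [hy, hz, hyz]))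
  · exact .inr (.inr (by rw [hy, hz, hyz]))
  · exact .inr (.inl (by rw [hx, hz, hxz]))
  · exact .inl (by rw [hx, hy, hxy])
  · exact .inl (by rw [hx, hy, hxy])

/-- A closed curve with straight crossings at the vertices as prescribed by a Gauss code. -/
theorem exists_crossings [NeZero n] (w : GaussCode n) : ∃ (γ : ℝ → Plane) (δ : ℝ), 0 < δ ∧
    δ < 1 / (2 * (2 * n : ℕ)) ∧ ContDiff ℝ ∞ γ ∧ Function.Periodic γ 1 ∧
    ∀ (x : Letter n) (p : ℤ) (t : ℝ), |t - codeTime w x + p| ≤ δ →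
      γ t = vertex x.index + arcSin (codeTime w x) t • x.dir ∧
      deriv γ t = deriv (arcSin (codeTime w x)) t • x.dir := by
  have hn := NeZero.ne n
  have hN : (2 : ℝ) ≤ (2 * n : ℕ) := by exact_mod_cast (by omega : 2 ≤ 2 * n)
  set R : ℝ := 1 / (2 * (2 * n : ℕ)) with hR
  have hR0 : 0 < R := by positivity
  have hR1 : R ≤ 1 / 2 := by
    rw [hR, div_le_div_iff₀ (by linarith) (by norm_num)]; linarith
  set χ : Letter n → ℝ → ℝ := fun x => arcBump (codeTime w x) (R / 2) R with hχ
  set f : Letter n → ℝ → Plane := fun x t => vertex x.index + arcSin (codeTime w x) t • x.dir with hf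
  -- The bumps have disjoint supports, so near a code time only its own term survives; between them
  -- the curve is uncontrolled and need not be generic.
  set γ : ℝ → Plane := fun t => ∑ x, χ x t • f x t with hγ
  have key : ∀ (x : Letter n) (p : ℤ) (t : ℝ), |t - codeTime w x + p| ≤ R / 2 → γ t = f x t := by
    intro x p t ht
    rw [hγ]
    simp only
    rw [Finset.sum_eq_single x]
    · rw [show χ x t = 1 from arcBump_eq_one (half_pos hR0) (half_lt_self hR0) hR1 ht, one_smul]
    · intro y _ hyx
      rw [show χ y t = 0 from arcBump_eq_zero (half_pos hR0) (half_lt_self hR0) hR1 fun q =>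
        codeTime_separated w hyx.symm (ht.trans (half_le_self hR0.le)) q, zero_smul]
    · simp
  refine ⟨γ, R / 4, by linarith, by linarith, ?_, fun t => ?_, fun x p t ht => ⟨?_, ?_⟩⟩
  · refine ContDiff.sum fun x _ => (contDiff_arcBump _ _ _).smul ?_
    exact contDiff_const.add ((contDiff_arcSin _).smul contDiff_const)
  · refine Finset.sum_congr rfl fun x _ => ?_
    have e1 := arcBump_add_int (codeTime w x) (R / 2) R t 1
    have e2 := arcSin_add_int (codeTime w x) t 1
    rw [Int.cast_one] at e1 e2
    simp only [hχ, hf, e1, e2]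
  · exact key x p t (by linarith)
  · have hev : γ =ᶠ[𝓝 t] f x := by
      have hc : Continuous fun s : ℝ => |s - codeTime w x + p| := by fun_prop
      filter_upwards [hc.continuousAt.eventually_lt continuousAt_const
        (show |t - codeTime w x + p| < R / 2 by linarith)] with s hs
      exact key x p s hs.le
    rw [hev.deriv_eq]
    exact (((hasDerivAt_arcSin _ t).smul_const x.dir).const_add _).deriv

/-- Near the code times the curve runs along disjoint crosses of perpendicular segments, each
segment being traversed injectively with nonzero speed. So two parameters can collide only as the
two branches of one cross. -/
theorem genericOn_crossings {w : GaussCode n} {γ : ℝ → Plane} {δ : ℝ} (hδ : δ < 1 / 4)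
    (h : ∀ (x : Letter n) (p : ℤ) (t : ℝ), |t - codeTime w x + p| ≤ δ →
      γ t = vertex x.index + arcSin (codeTime w x) t • x.dir ∧
      deriv γ t = deriv (arcSin (codeTime w x)) t • x.dir) :
    GenericOn γ {t | ∃ (x : Letter n) (p : ℤ), |t - codeTime w x + p| ≤ δ} := by
  have hδ' : δ < (δ + 1 / 4) / 2 := by linarith
  have hρ : (δ + 1 / 4) / 2 < 1 / 4 := by linarith
  have hidx : ∀ {x y : Letter n} {p q : ℤ} {s t : ℝ}, |s - codeTime w x + p| ≤ δ →
      |t - codeTime w y + q| ≤ δ → γ s = γ t → x.index = y.index := by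
    intro x y p q s t hs ht hst
    rw [(h x p s hs).1, (h y q t ht).1] at hst
    exact index_eq_of_vertex_add_eq (abs_arcSin_le_one _ _) (abs_arcSin_le_one _ _) hst
  have hsame : ∀ {x : Letter n} {p q : ℤ} {s t : ℝ}, |s - codeTime w x + p| ≤ δ →
      |t - codeTime w x + q| ≤ δ → γ s = γ t → SamePoint s t := by
    intro x p q s t hs ht hst
    rw [(h x p s hs).1, (h x q t ht).1] at hst
    exact samePoint_of_arcSin_eq hρ (hs.trans_lt hδ') (ht.trans_lt hδ')
      (smul_dir_injective x (add_left_cancel hst))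
  refine ⟨?_, ?_, ?_⟩
  · rintro t ⟨x, p, ht⟩
    rw [(h x p t ht).2]
    intro h0
    exact deriv_arcSin_ne_zero hρ (ht.trans_lt hδ')
      (smul_dir_injective x (h0.trans (zero_smul ℝ x.dir).symm))
  · rintro s ⟨x, p, hs⟩ t ⟨y, q, ht⟩ hst hne
    have hxy : x ≠ y := by
      rintro rfl
      exact hne (hsame hs ht hst)
    rw [(h x p s hs).2, (h y q t ht).2, planeDet_smul_smul]
    exact mul_ne_zero (mul_ne_zero (deriv_arcSin_ne_zero hρ (hs.trans_lt hδ'))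
      (deriv_arcSin_ne_zero hρ (ht.trans_lt hδ'))) (planeDet_dir_ne_zero (hidx hs ht hst) hxy)
  · rintro r ⟨x, p, hr⟩ s ⟨y, q, hs⟩ t ⟨z, u, ht⟩ hrs hrt
    rcases eq_or_eq_or_eq_of_index (hidx hr hs hrs) (hidx hr ht hrt) with rfl | rfl | rfl
    · exact .inl (hsame hr hs hrs)
    · exact .inr (.inl (hsame hr ht hrt))
    · exact .inr (.inr (hsame hs ht (hrs.symm.trans hrt)))

/-- A curve generic near the crossings is made generic by perturbing the arcs in between. -/
theorem exists_genericOn_univ [NeZero n] (w : GaussCode n) {γ : ℝ → Plane} {δ : ℝ} (hδ0 : 0 < δ)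
    (hδ : δ < 1 / (2 * (2 * n : ℕ))) (hγ : ContDiff ℝ ∞ γ) (hγp : Function.Periodic γ 1) {V : Set ℝ}
    (hV : ∀ t, t ∈ V ↔ ∃ (x : Letter n) (p : ℤ), |t - codeTime w x + p| ≤ δ)
    (hgen : GenericOn γ V) :
    ∃ β : ℝ → Plane, ContDiff ℝ ∞ β ∧ Function.Periodic β 1 ∧ GenericOn β univ ∧
      (∀ t ∈ V, β t = γ t) ∧ ∀ t ∈ V, deriv β t = deriv γ t := by
  have hn := NeZero.ne n
  have hN : (2 : ℝ) ≤ (2 * n : ℕ) := by exact_mod_cast (by omega : 2 ≤ 2 * n)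
  set R : ℝ := 1 / (2 * (2 * n : ℕ)) with hR
  have hR1 : R ≤ 1 / 4 := by
    rw [hR, div_le_div_iff₀ (by linarith) (by norm_num)]; linarith
  -- Arcs of this half-length around the midpoints fill the gaps between the δ-neighbourhoods of the
  -- code times, so perturbing all of them reaches every parameter outside `V`.
  set ρ := R - δ with hρ
  have hρ0 : 0 < ρ := by linarith
  have h0 : 0 < ρ / 2 := half_pos hρ0
  have h1 : ρ / 2 < ρ := half_lt_self hρ0
  set φ : ℕ → ℝ → ℝ := fun k => arcBump (arcMid (2 * n) k) (ρ / 2) ρ with hφ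
  have key : ∀ K ≤ 2 * n, ∃ β : ℝ → Plane, ContDiff ℝ ∞ β ∧ Function.Periodic β 1 ∧
      GenericOn β (V ∪ {t | ∃ k < K, φ k t ≠ 0}) ∧
      (∀ t ∈ V, β t = γ t) ∧ ∀ t ∈ V, deriv β t = deriv γ t := by
    intro K
    induction K with
    | zero =>
      refine fun _ => ⟨γ, hγ, hγp, ?_, fun _ _ => rfl, fun _ _ => rfl⟩
      convert hgen using 1
      simp
    | succ K ih =>
      intro hK
      obtain ⟨β, hβ, hβp, hβg, e0, e1⟩ := ih (by omega)
      have hzV : ∀ t ∈ V, φ K t = 0 := by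
        intro t ht
        obtain ⟨x, p, hx⟩ := (hV t).1 ht
        exact arcBump_eq_zero h0 h1 (by linarith) fun q => arcMid_codeTime_separated w x hx K q
      have hz : ∀ t ∈ V ∪ {t | ∃ k < K, φ k t ≠ 0}, φ K t = 0 := by
        rintro t (ht | ⟨k, hk, ht⟩)
        · exact hzV t ht
        · obtain ⟨p, hp⟩ := (arcBump_ne_zero_iff h0 h1 (by linarith)).1 ht
          exact arcBump_eq_zero h0 h1 (by linarith) fun q =>
            arcMid_separated (by linarith) (by omega) (by omega) hk.ne hp.le q
      obtain ⟨l, hl⟩ := (ae_genericOn_arc h0 h1 (by linarith) hβ hz hβg).exists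
      refine ⟨perturb β (φ K) (arcSin (arcMid (2 * n) K)) l, contDiff_perturb hβ (contDiff_arcBump _ _ _) (contDiff_arcSin _) l,
        periodic_perturb_arc hβp l, ?_, fun t ht => ?_, fun t ht => ?_⟩
      · convert hl using 1
        ext t
        simp only [mem_union, mem_ofPred_eq, Nat.lt_succ_iff_lt_or_eq, or_and_right, exists_or,
          exists_eq_left, or_assoc]
        rfl
      · rw [perturb_eq_of_eq_zero (hzV t ht), e0 t ht]
      · rw [deriv_perturb_eq_of_eq_zero (hβ.differentiable (by simp))
          ((contDiff_arcBump _ _ _).differentiable (by simp))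
          ((contDiff_arcSin _).differentiable (by simp)) (hzV t ht)
          (deriv_arcBump_eq_zero (hzV t ht)), e1 t ht]
  obtain ⟨β, hβ, hβp, hβg, e0, e1⟩ := key (2 * n) le_rfl
  refine ⟨β, hβ, hβp, ?_, e0, e1⟩
  convert hβg using 1
  refine (eq_univ_of_forall fun t => ?_).symm
  rcases exists_near_or_mem_arc (N := 2 * n) (by omega) δ t with ⟨i, j, hi, hij⟩ | ⟨k, j, hk, hkj⟩
  · have hi' : i < w.1.length := by rw [w.2.1]; exact hi
    refine .inl ((hV t).2 ⟨w.1[i], j, ?_⟩)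
    rwa [codeTime_getElem, sub_add_eq_add_sub]
  · exact .inr ⟨k, hk, (arcBump_ne_zero_iff h0 h1 (by linarith)).2 ⟨j, hkj⟩⟩

/-- Every Gauss code is a Gauss code of a virtual diagram. -/
theorem exists_hasGaussCode [NeZero n] (w : GaussCode n) :
    ∃ D : VirtualDiagram, D.HasGaussCode w := by
  classical
  obtain ⟨γ, δ, hδ0, hδ, hγ, hγp, h⟩ := exists_crossings w
  have hn := NeZero.ne n
  have hN : (2 : ℝ) ≤ (2 * n : ℕ) := by exact_mod_cast (by omega : 2 ≤ 2 * n)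
  have hδ1 : δ < 1 / 4 := by
    refine hδ.trans_le ?_
    rw [div_le_div_iff₀ (by linarith) (by norm_num)]; linarith
  obtain ⟨β, hβ, hβp, hβg, e0, e1⟩ := exists_genericOn_univ w hδ0 hδ hγ hγp (fun t => Iff.rfl)
    (genericOn_crossings hδ1 h)
  have hx : ∀ x : Letter n, |codeTime w x - codeTime w x + (0 : ℤ)| ≤ δ := fun x => by
    simpa using hδ0.le
  have hp : ∀ x : Letter n, β (codeTime w x) = vertex x.index := fun x => by
    rw [e0 _ ⟨x, 0, hx x⟩, (h x 0 _ (hx x)).1, arcSin_self, zero_smul, add_zero]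
  have hd : ∀ x : Letter n, deriv β (codeTime w x) =
      deriv (arcSin (codeTime w x)) (codeTime w x) • x.dir := fun x => by
    rw [e1 _ ⟨x, 0, hx x⟩, (h x 0 _ (hx x)).2]
  let D : VirtualDiagram :=
    { curve := β
      periodic := hβp
      smooth := hβ
      immersed := fun t => hβg.immersed t trivial
      transverse := fun s t => hβg.transverse s trivial t trivial
      no_triple := fun r s t => hβg.no_triple r trivial s trivial t trivial
      real := Finset.univ.image (vertex : Fin n → Plane)
      real_crossing := fun c hc => by
        obtain ⟨j, -, rfl⟩ := Finset.mem_image.1 hc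
        exact ⟨_, _, not_samePoint_codeTime w (letterL_ne_letterR j j), hp _, hp _⟩ }
  have hD : D.Marked w vertex := by
    refine ⟨vertex_injective, fun p => ?_, hp, fun j => ?_⟩
    · change p ∈ Finset.univ.image (vertex : Fin n → Plane) ↔ _
      simp
    · change planeDet (deriv β _) (deriv β _) < 0
      rw [hd, hd, planeDet_smul_smul, dir_letterL, dir_letterR]
      have := mul_pos (deriv_arcSin_self_pos (codeTime w (letterL j)))
        (deriv_arcSin_self_pos (codeTime w (letterR j)))
      simpa [planeDet] using this
  exact ⟨D, hD.hasGaussCode⟩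

end
end VirtualDoodle

namespace VirtualDoodle

/-! ### Classification of virtual diagrams -/

section
variable {n : ℕ} [NeZero n]

/-- Invariance of the codes gives one direction. For the other, an equivalent code is again a code
of the same diagram, and two diagrams with a common code are strictly equivalent. -/
theorem strictEquiv_iff_codeEquiv {D D' : VirtualDiagram} {w w' : GaussCode n}
    (h : D.HasGaussCode w) (h' : D'.HasGaussCode w') : StrictEquiv D D' ↔ CodeEquiv w w' :=
  ⟨fun e => ((e.hasGaussCode_iff w).1 h).codeEquiv h', fun e => (h.of_codeEquiv e).strictEquiv h'⟩

theorem strictEquiv_iff_projLC_eq {D D' : VirtualDiagram} {w w' : GaussCode n}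
    (h : D.HasGaussCode w) (h' : D'.HasGaussCode w') :
    StrictEquiv D D' ↔ projLC w = projLC w' :=
  (strictEquiv_iff_codeEquiv h h').trans projLC_eq_iff.symm

theorem hasGaussCode_gaussCode (D : Diagram n) : D.1.HasGaussCode (gaussCode D) :=
  isGaussCodeOf_iff.1 (exists_isGaussCodeOf D).choose_spec

theorem projLC_gaussCode {D : Diagram n} {w : GaussCode n} (h : D.1.HasGaussCode w) :
    projLC (gaussCode D) = projLC w :=
  projLC_eq_iff.2 ((hasGaussCode_gaussCode D).codeEquiv h)

theorem exists_diagram (v : GaussLC n) : ∃ D : Diagram n, projLC (gaussCode D) = v := by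
  obtain ⟨D, hD⟩ := exists_hasGaussCode v.1.1
  exact ⟨⟨D, hD.card_real⟩, (projLC_gaussCode hD).trans (projLC_eq_self v)⟩

theorem projLC_gaussCode_rev (D : Diagram n) :
    projLC (gaussCode D.rev) = revLC (projLC (gaussCode D)) :=
  (projLC_gaussCode (hasGaussCode_gaussCode D).rev).trans (revLC_projLC _).symm

/-- The classes generated by an involution have at most two elements, so no longer chains of
reversals are needed. -/
theorem mk_revLC_eq_iff {v v' : GaussLC n} :
    (Quot.mk (fun w w' : GaussLC n => w' = revLC w) v = Quot.mk _ v') ↔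
      v = v' ∨ v = revLC v' := by
  rw [Quot.eq]
  constructor
  · intro h
    induction h with
    | rel a b h => exact .inr (by rw [h, revLC_involutive a])
    | refl a => exact .inl rfl
    | symm a b _ ih =>
      rcases ih with rfl | rfl
      · exact .inl rfl
      · exact .inr (revLC_involutive b).symm
    | trans a b c _ _ ih ih' =>
      rcases ih with rfl | rfl <;> rcases ih' with rfl | rfl
      · exact .inl rfl
      · exact .inr rfl
      · exact .inr rfl
      · exact .inl (revLC_involutive _)
  · rintro (rfl | rfl)
    · exact .refl _
    · exact .symm _ _ (.rel _ _ rfl)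

/-- The left canonical Gauss codes classify diagrams up to strict equivalence. -/
noncomputable def strictEquivGaussLC (n : ℕ) [NeZero n] : DiagramStrict n ≃ GaussLC n :=
  Equiv.ofBijective
    (Quotient.lift (fun D : Diagram n => projLC (gaussCode D)) fun _ _ h =>
      (strictEquiv_iff_projLC_eq (hasGaussCode_gaussCode _) (hasGaussCode_gaussCode _)).1 h)
    ⟨by
      rintro ⟨D⟩ ⟨D'⟩ h
      exact Quotient.sound ((strictEquiv_iff_projLC_eq (hasGaussCode_gaussCode D)
        (hasGaussCode_gaussCode D')).2 h),
    fun v => by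
      obtain ⟨D, hD⟩ := exists_diagram v
      exact ⟨Quotient.mk _ D, hD⟩⟩

/-- The classes of left canonical Gauss codes under reversal classify diagrams up to strict
equivalence and reversal. -/
noncomputable def strictRevEquivGaussLCRev (n : ℕ) [NeZero n] :
    DiagramStrictRev n ≃ GaussLCRev n :=
  Equiv.ofBijective
    (Quotient.lift (fun D : Diagram n =>
        (Quot.mk _ (projLC (gaussCode D)) : GaussLCRev n)) fun D D' h => by
      induction (h : Relation.EqvGen _ D D') with
      | rel D D' h =>
        rcases h with h | rfl
        · exact congrArg _ ((strictEquiv_iff_projLC_eq (hasGaussCode_gaussCode _)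
            (hasGaussCode_gaussCode _)).1 h)
        · exact Quot.sound (projLC_gaussCode_rev D)
      | refl D => rfl
      | symm D D' _ ih => exact ih.symm
      | trans D D' D'' _ _ ih ih' => exact ih.trans ih')
    ⟨by
      rintro ⟨D⟩ ⟨D'⟩ h
      refine Quotient.sound ?_
      rcases mk_revLC_eq_iff.1 h with h | h
      · exact .rel _ _ (.inl ((strictEquiv_iff_projLC_eq (hasGaussCode_gaussCode D)
          (hasGaussCode_gaussCode D')).2 h))
      · rw [← projLC_gaussCode_rev] at h
        exact .trans _ D'.rev _ (.rel _ _ (.inl ((strictEquiv_iff_projLC_eq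
          (hasGaussCode_gaussCode D) (hasGaussCode_gaussCode D'.rev)).2 h)))
          (.symm _ _ (.rel _ _ (.inr rfl))),
    fun v => by
      obtain ⟨v, rfl⟩ := Quot.exists_rep v
      obtain ⟨D, hD⟩ := exists_diagram v
      exact ⟨Quotient.mk _ D, congrArg (Quot.mk _) hD⟩⟩

end
end VirtualDoodle

theorem theorem1p1 (n : ℕ) [NeZero n] :
    -- the maps `D ↦ proj^LC(w)`, for any Gauss code `w` of `D`, are well defined and bijective
    (∃ Φ : DiagramStrict n ≃ GaussLC n, ∀ (D : Diagram n) (w : GaussCode n),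
      IsGaussCodeOf D w → Φ (Quotient.mk (strictSetoid n) D) = projLC w) ∧
    (∃ Ψ : DiagramStrictRev n ≃ GaussLCRev n, ∀ (D : Diagram n) (w : GaussCode n),
      IsGaussCodeOf D w → Ψ (Quotient.mk (strictRevSetoid n) D) = Quot.mk _ (projLC w)) ∧
    -- `rev^LC` is an involution, so that the elements of the quotient are the `{w, rev^LC w}`
    Function.Involutive (revLC : GaussLC n → GaussLC n) ∧
    -- `G_ori` and `G_unori` do not depend on the choice of the Gauss code
    (∀ (D : Diagram n) (w : GaussCode n), IsGaussCodeOf D w →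
      Gori D = (projLC w).1 ∧ Gunori D = min (projLC w).1 (projLC (rev w)).1) ∧
    -- they are complete invariants
    (∀ D D' : Diagram n, StrictEquiv D.1 D'.1 ↔ Gori D = Gori D') ∧
    (∀ D D' : Diagram n,
      (StrictEquiv D.1 D'.1 ∨ StrictEquiv D.1 D'.rev.1) ↔ Gunori D = Gunori D') := by
  refine ⟨⟨strictEquivGaussLC n, fun D w h => projLC_gaussCode (isGaussCodeOf_iff.1 h)⟩,
    ⟨strictRevEquivGaussLCRev n, fun D w h =>
      congrArg (Quot.mk _) (projLC_gaussCode (isGaussCodeOf_iff.1 h))⟩,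
    revLC_involutive, fun D w h => ⟨congrArg Subtype.val (projLC_gaussCode (isGaussCodeOf_iff.1 h)),
      ?_⟩, fun D D' => ?_, fun D D' => ?_⟩
  · have hw := (hasGaussCode_gaussCode D).codeEquiv (isGaussCodeOf_iff.1 h)
    rw [← leastUnori_projLP]
    exact leastUnori_projLP_eq_iff.2 (.inl hw)
  · exact (strictEquiv_iff_projLC_eq (hasGaussCode_gaussCode D) (hasGaussCode_gaussCode D')).trans
      Subtype.ext_iff
  · exact (or_congr
      (strictEquiv_iff_codeEquiv (hasGaussCode_gaussCode D) (hasGaussCode_gaussCode D'))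
      (strictEquiv_iff_codeEquiv (hasGaussCode_gaussCode D) (hasGaussCode_gaussCode D').rev)).trans
      leastUnori_projLP_eq_iff.symm
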